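/- Let $\Sigma$ be a closed connected smooth surface and let $V\subset\Sigma$ be an essential (not null-homotopic) two-sided simple closed curve, with a tubular neighbourhood with smooth coordinates $(u,v)\in S^1\times\mathbb{R}$ in which $V=\{v=1/2\}$. Let $\ast_\Sigma=(1,1)$, let $\widetilde V$ be the loop $t\mapsto(e^{2\pi i t},1)$, $t\in[0,1]$, and let $\tau_V$ be the Dehn twist $(u,v)\mapsto(u\,e^{-2\pi i\chi(v)},v)$, extended by the identity, where $\chi:\mathbb{R}\to[0,1]$ is a smooth monotone function (the standard smooth transition function $\chi(v)=f(v)/(f(v)+f(1-v))$ with $f(x)=e^{-1/x}$ for $x>0$ and $f(x)=0$ for $x\le 0$) that is $0$ for $v\le 0$ and $1$ for $v\ge1$. (This is the right-handed twist if $\Sigma$ is oriented so that $S^1\times[0,1]$ is a planar annulus with $u$ counterclockwise and $v$ increasing outwards.) Let $\pi^V:E^V\to D$ be the Lefschetz fibration over the closed unit disk with fibre $\Sigma$, exactly one critical point $x_0$, lying over $0$, and vanishing cycle $V$. Explicitly, let $q(x_1,x_2)=x_1^2+x_2^2$ on $\mathbb{C}^2$, put $a=x_1+ix_2$, $b=x_1-ix_2$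 (so $q=ab$) and $h=|a|^2-|b|^2$. Then $E^V$ is the part over $D$ of the space obtained by gluing $\mathbb{C}^2$ (projecting by $q$) to $\mathbb{C}\times(\Sigma\setminus V)$ (projecting to the first factor): a point $x\in\mathbb{C}^2$ with $h(x)\neq0$ is identified with $\big(q(x),(u,v)\big)$, where $v=\tfrac12+h(x)$, and $u=a/|a|$ if $h(x)>0$, $u=\bar b/|b|$ if $h(x)<0$. The critical point is $x_0=(0,0)\in\mathbb{C}^2$. The fibre over $1$ is identified with $\Sigma$ by $x\mapsto(1,x)$ on $\Sigma\setminus V$, extended over $V$ by sending $(u,\tfrac12)$ to the point of $\mathbb{C}^2$ with $a=u$, $b=\bar u$. The restriction $E^V|_{\partial D}$ is the mapping torus of $\tau_V$, and $\pi_1(E^V|_{\partial D},\ast_\Sigma)\cong\pi_1(\Sigma,\ast_\Sigma)\rtimes\mathbb{Z}$, where $([\alpha],n)$ stands for the image of $[\alpha]$ under the inclusion of the fibre over $1$ followed by the $n$-th power of the class of the horizontal section $z\mapsto(z,\ast_\Sigma)$. Products of loops are concatenations from left to right, and $\overline\zeta$ is the reverse of $\zeta$. Let $s$ be a continuous section of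 $E^V|_{\partial D}$ with $s(1)=\ast_\Sigma$ that represents $([\alpha],1)$, where $[\alpha]\in\pi_1(\Sigma,\ast_\Sigma)$. 1. There is a continuous section $\sigma$ of $E^V\to D$ that extends $s$ and passes through the critical point $x_0$ if and only if $$[\alpha]=[\zeta]\cdot[\widetilde V]^m\cdot(\tau_V^{-1})_*[\overline\zeta]\in\pi_1(\Sigma,\ast_\Sigma)\qquad(\star)$$ for some loop $\zeta$ based at $\ast_\Sigma$ and some $m\in\mathbb{Z}$. 2. There is a continuous section of $E^V\to D$ that extends $s$ and avoids the critical point if and only if $(\star)$ holds for some loop $\zeta$ based at $\ast_\Sigma$ and some $m\in\{0,1\}$. 3. If $s$ is smooth, then there is a smooth section of $E^V\to D$ that extends $s$ if and only if $(\star)$ holds for some loop $\zeta$ based at $\ast_\Sigma$ and some $m\in\{0,1\}$. -/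

import Mathlib

open scoped Manifold ContDiff Topology

noncomputable section

/-- Product of classes of loops in the order of concatenation: first `p`, then `q`. (The
multiplication of Mathlib's `FundamentalGroup` is in the opposite order.) -/
def loopMul {X : Type*} [TopologicalSpace X] {x : X} (p q : FundamentalGroup X x) :
    FundamentalGroup X x :=
  FundamentalGroup.fromPath (p.toPath.trans q.toPath)

/-- The class of a loop. -/
def loopClass {X : Type*} [TopologicalSpace X] {x : X} (p : Path x x) : FundamentalGroup X x :=
  FundamentalGroup.fromPath (Path.Homotopic.Quotient.mk p)

/-! ### The quadratic local model `ℂ² → ℂ` -/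

namespace QuadraticModel

/-- The local model `q(x₁, x₂) = x₁² + x₂²` of a Lefschetz critical point. -/
def q (x : ℂ × ℂ) : ℂ := x.1 ^ 2 + x.2 ^ 2

/-- The linear coordinate `a = x₁ + i x₂`; with `b = x₁ - i x₂` one has `q = a b`. -/
def a (x : ℂ × ℂ) : ℂ := x.1 + Complex.I * x.2

/-- The second linear coordinate `b = x₁ - i x₂`. -/
def b (x : ℂ × ℂ) : ℂ := x.1 - Complex.I * x.2

/-- The height `|a|² - |b|² = 4 Im (x₁ x̄₂)`. Its zero set is the union of the
vanishing cycles `√z · S¹`, `z ∈ ℂ`, (the thimble family), which contains the critical point. -/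
def height (x : ℂ × ℂ) : ℝ := ‖a x‖ ^ 2 - ‖b x‖ ^ 2

/-- The angular coordinate off the thimble family: `a / |a|` on the side `height > 0`, and
`b̄ / |b|` on the side `height < 0`. Over a positive real `z = a b` the two
expressions coincide. -/
def angle (x : ℂ × ℂ) : Circle :=
  if 0 < height x then Circle.exp (Complex.arg (a x)) else Circle.exp (-Complex.arg (b x))

/-- The positive solution `ρ` of `ρ² - ρ⁻² = h`. -/
def radius (h : ℝ) : ℝ := Real.sqrt ((h + Real.sqrt (h ^ 2 + 4)) / 2)

/-- The point of the fibre `q = 1` with `a = ρ u`, `b = ρ⁻¹ u⁻¹` and height `h`. -/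
def fiberPoint (u : Circle) (h : ℝ) : ℂ × ℂ :=
  (((radius h : ℂ) * u + (radius h : ℂ)⁻¹ * ((u⁻¹ : Circle) : ℂ)) / 2,
    ((radius h : ℂ) * u - (radius h : ℂ)⁻¹ * ((u⁻¹ : Circle) : ℂ)) / (2 * Complex.I))

lemma radius_aux (h : ℝ) : 0 < (h + Real.sqrt (h ^ 2 + 4)) / 2 := by
  have h1 : |h| < Real.sqrt (h ^ 2 + 4) := by
    apply Real.lt_sqrt_of_sq_lt
    rw [sq_abs]; linarith
  have := neg_abs_le h
  linarith

lemma radius_pos (h : ℝ) : 0 < radius h := Real.sqrt_pos.2 (radius_aux h)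

lemma radius_sq (h : ℝ) : radius h ^ 2 - (radius h)⁻¹ ^ 2 = h := by
  have hp := radius_aux h
  have h2 : Real.sqrt (h ^ 2 + 4) ^ 2 = h ^ 2 + 4 := Real.sq_sqrt (by positivity)
  rw [inv_pow, radius, Real.sq_sqrt hp.le]
  have hne := hp.ne'
  generalize Real.sqrt (h ^ 2 + 4) = r at *
  have : h + r ≠ 0 := fun h0 => hne (by rw [h0]; simp)
  field_simp
  nlinarith

lemma a_fiberPoint (u : Circle) (h : ℝ) : a (fiberPoint u h) = (radius h : ℂ) * u := by
  simp only [a, fiberPoint]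
  have := Complex.I_ne_zero
  generalize (radius h : ℂ)⁻¹ * ((u⁻¹ : Circle) : ℂ) = c
  field_simp
  ring

lemma b_fiberPoint (u : Circle) (h : ℝ) :
    b (fiberPoint u h) = (radius h : ℂ)⁻¹ * ((u⁻¹ : Circle) : ℂ) := by
  simp only [b, fiberPoint]
  have := Complex.I_ne_zero
  generalize (radius h : ℂ)⁻¹ * ((u⁻¹ : Circle) : ℂ) = c
  field_simp
  ring

lemma q_eq (x : ℂ × ℂ) : q x = a x * b x := by
  simp only [q, a, b]
  linear_combination (x.2 ^ 2) * Complex.I_sq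

lemma q_fiberPoint (u : Circle) (h : ℝ) : q (fiberPoint u h) = 1 := by
  have h1 : (radius h : ℂ) ≠ 0 := by exact_mod_cast (radius_pos h).ne'
  have h2 : (u : ℂ) ≠ 0 := u.coe_ne_zero
  rw [q_eq, a_fiberPoint, b_fiberPoint, Circle.coe_inv]
  field_simp

lemma height_fiberPoint (u : Circle) (h : ℝ) : height (fiberPoint u h) = h := by
  rw [height, a_fiberPoint, b_fiberPoint, norm_mul, norm_mul, Circle.norm_coe, Circle.norm_coe,
    norm_inv, Complex.norm_real, Real.norm_of_nonneg (radius_pos h).le, mul_one, mul_one,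
    radius_sq]

lemma angle_fiberPoint (u : Circle) (h : ℝ) : angle (fiberPoint u h) = u := by
  rw [angle, a_fiberPoint, b_fiberPoint, ← Complex.ofReal_inv,
    Complex.arg_real_mul _ (radius_pos h), Complex.arg_real_mul _ (inv_pos.2 (radius_pos h)),
    Circle.exp_neg, Circle.exp_arg, Circle.exp_arg, inv_inv, ite_self]

lemma continuous_radius : Continuous radius := by unfold radius; fun_prop

lemma continuous_fiberPoint : Continuous fun p : Circle × ℝ => fiberPoint p.1 (p.2 - 1 / 2) := by
  have h1 : Continuous fun p : Circle × ℝ => (radius (p.2 - 1 / 2) : ℂ) :=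
    Complex.continuous_ofReal.comp (continuous_radius.comp (by fun_prop))
  have h2 : Continuous fun p : Circle × ℝ => (radius (p.2 - 1 / 2) : ℂ)⁻¹ :=
    h1.inv₀ fun p => by exact_mod_cast (radius_pos _).ne'
  have h3 : Continuous fun p : Circle × ℝ => ((p.1 : Circle) : ℂ) := by fun_prop
  have h4 : Continuous fun p : Circle × ℝ => ((p.1⁻¹ : Circle) : ℂ) := by fun_prop
  unfold fiberPoint
  fun_prop

end QuadraticModel

/-- A two-sided simple closed curve in a surface `S`, together with a tubular neighbourhood and
coordinates `(u, v) ∈ S¹ × ℝ` on it: an injective local diffeomorphism (that is, a diffeomorphism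
onto an open set) `S¹ × ℝ → S`. The curve itself is `v = 1/2`, and the closed annulus
`0 ≤ v ≤ 1` is the neighbourhood that carries the Dehn twist. -/
structure AnnularCurve (S : Type*) [TopologicalSpace S]
    [ChartedSpace (EuclideanSpace ℝ (Fin 2)) S] where
  toFun : Circle × ℝ → S
  injective : Function.Injective toFun
  isLocalDiffeomorph : IsLocalDiffeomorph ((𝓡 1).prod 𝓘(ℝ, ℝ)) (𝓡 2) ∞ toFun

namespace AnnularCurve

variable {S : Type*} [TopologicalSpace S] [ChartedSpace (EuclideanSpace ℝ (Fin 2)) S]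

instance : CoeFun (AnnularCurve S) fun _ => Circle × ℝ → S := ⟨AnnularCurve.toFun⟩

variable (j : AnnularCurve S)

lemma continuous : Continuous j := j.isLocalDiffeomorph.contMDiff.continuous

lemma isOpenEmbedding : Topology.IsOpenEmbedding j :=
  .of_continuous_injective_isOpenMap j.continuous j.injective j.isLocalDiffeomorph.isOpenMap

/-- The coordinates `(u, v)` of a point of the tubular neighbourhood. -/
def coords (x : S) : Circle × ℝ := Function.invFun j x

lemma coords_apply (p : Circle × ℝ) : j.coords (j p) = p :=
  Function.leftInverse_invFun j.injective p

/-- The curve `V = {v = 1/2}`. -/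
def cycle : Set S := j '' {p | p.2 = 1 / 2}

/-- The curve is essential: it is not homotopic to a constant map. -/
def IsEssential : Prop :=
  ¬ (ContinuousMap.mk (fun u : Circle => j (u, 1 / 2))
      (j.continuous.comp (by fun_prop))).Nullhomotopic

/-- The base point `(u, v) = (1, 1)` of the surface. -/
def base : S := j (1, 1)

/-- The loop `t ↦ (e^{2π i t}, 1)`, a based push-off of the curve. -/
def pushOff : Path j.base j.base where
  toFun t := j (Circle.exp (2 * Real.pi * t), 1)
  continuous_toFun := j.continuous.comp (by fun_prop)
  source' := by simp [base]
  target' := by simp [base]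

lemma apply_mem_cycle_iff (p : Circle × ℝ) : j p ∈ j.cycle ↔ p.2 = 1 / 2 := by
  simp [cycle, j.injective.eq_iff]

lemma base_notMem : j.base ∉ j.cycle := by
  rw [base, apply_mem_cycle_iff]; norm_num

lemma isClosed_cycle [T2Space S] : IsClosed j.cycle := by
  have : j.cycle = j '' ((Set.univ : Set Circle) ×ˢ {1 / 2}) := by
    rw [cycle]; congr 1; ext p; simp
  rw [this]
  exact ((isCompact_univ.prod isCompact_singleton).image j.continuous).isClosed

/-! ### The Dehn twist -/

open Classical in
/-- The map `(u, v) ↦ (u e^{-2π i n χ(v)}, v)` on the annulus and the identity elsewhere, where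
the smooth function `χ` is `0` for `v ≤ 0` and `1` for `v ≥ 1`. -/
def twist (n : ℤ) (x : S) : S :=
  if x ∈ Set.range j then
    j ((j.coords x).1 * Circle.exp (-(2 * Real.pi * n * Real.smoothTransition (j.coords x).2)),
      (j.coords x).2)
  else x

lemma twist_apply (n : ℤ) (p : Circle × ℝ) :
    j.twist n (j p) =
      j (p.1 * Circle.exp (-(2 * Real.pi * n * Real.smoothTransition p.2)), p.2) := by
  rw [twist, if_pos (Set.mem_range_self p), coords_apply]

lemma exp_int (n : ℤ) : Circle.exp (2 * Real.pi * n) = 1 := by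
  rw [mul_comm, Circle.exp_intCast_mul, Circle.exp_two_pi, one_zpow]

lemma twist_of_notMem (n : ℤ) {x : S}
    (hx : x ∉ j '' ((Set.univ : Set Circle) ×ˢ Set.Icc (0 : ℝ) 1)) : j.twist n x = x := by
  by_cases h : x ∈ Set.range j
  · obtain ⟨⟨u, v⟩, rfl⟩ := h
    have hv : v ∉ Set.Icc (0 : ℝ) 1 := fun hv => hx ⟨(u, v), by simpa using hv, rfl⟩
    rw [twist_apply]
    rcases lt_or_ge v 0 with h0 | h0
    · simp [Real.smoothTransition.zero_of_nonpos h0.le]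
    · have h1 : 1 ≤ v := by
        by_contra h1
        exact hv ⟨h0, (not_le.1 h1).le⟩
      simp [Real.smoothTransition.one_of_one_le h1, exp_int]
  · rw [twist, if_neg h]

lemma continuous_twist [T2Space S] (n : ℤ) : Continuous (j.twist n) := by
  rw [continuous_iff_continuousAt]
  intro x
  by_cases h : x ∈ j '' ((Set.univ : Set Circle) ×ˢ Set.Icc (0 : ℝ) 1)
  · obtain ⟨p, -, rfl⟩ := h
    rw [← j.isOpenEmbedding.continuousAt_iff]
    have : j.twist n ∘ j = fun p : Circle × ℝ =>
        j (p.1 * Circle.exp (-(2 * Real.pi * n * Real.smoothTransition p.2)), p.2) :=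
      funext (j.twist_apply n)
    rw [this]
    have := Real.smoothTransition.continuous
    exact (j.continuous.comp (by fun_prop)).continuousAt
  · have hc : IsClosed (j '' ((Set.univ : Set Circle) ×ˢ Set.Icc (0 : ℝ) 1)) :=
      ((isCompact_univ.prod isCompact_Icc).image j.continuous).isClosed
    refine continuousAt_id.congr ?_
    filter_upwards [hc.isOpen_compl.mem_nhds h] with y hy
    exact (j.twist_of_notMem n hy).symm

lemma twist_twist (n m : ℤ) (h : n + m = 0) (x : S) : j.twist n (j.twist m x) = x := by
  by_cases hx : x ∈ Set.range j
  · obtain ⟨p, rfl⟩ := hx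
    rw [twist_apply, twist_apply, mul_assoc, ← Circle.exp_add]
    have : (n : ℝ) + m = 0 := by exact_mod_cast h
    have : -(2 * Real.pi * m * Real.smoothTransition p.2) +
        -(2 * Real.pi * n * Real.smoothTransition p.2) = 0 := by
      linear_combination (-(2 * Real.pi * Real.smoothTransition p.2)) * this
    simp [this]
  · have : j.twist m x = x := by rw [twist, if_neg hx]
    rw [this, twist, if_neg hx]

/-- The Dehn twist `τ_V` along the curve, `(u, v) ↦ (u e^{-2π i χ(v)}, v)`. It is the
right-handed twist for the orientation of the annulus for which `S¹ × [0, 1]` is a planar annulus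
with `u` running counterclockwise and `v` increasing outwards. -/
def dehnTwist [T2Space S] : S ≃ₜ S where
  toFun := j.twist 1
  invFun := j.twist (-1)
  left_inv := j.twist_twist (-1) 1 (by norm_num)
  right_inv := j.twist_twist 1 (-1) (by norm_num)
  continuous_toFun := j.continuous_twist 1
  continuous_invFun := j.continuous_twist (-1)

lemma dehnTwist_symm_base [T2Space S] : j.dehnTwist.symm j.base = j.base := by
  change j.twist (-1) (j (1, 1)) = j (1, 1)
  rw [twist_apply]
  simp [Real.smoothTransition.one_of_one_le le_rfl]

/-- The automorphism `(τ_V⁻¹)_*` of `π₁(S, *)`. -/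
def dehnTwistInvMap [T2Space S] : FundamentalGroup S j.base →* FundamentalGroup S j.base :=
  FundamentalGroup.mapOfEq (j.dehnTwist.symm : C(S, S)) j.dehnTwist_symm_base

/-- `[α] = [ζ] · [Ṽ]^m · (τ_V⁻¹)_* [ζ̄]` for some loop `ζ`. -/
def IsTwistedConj [T2Space S] (m : ℤ) (α : FundamentalGroup S j.base) : Prop :=
  ∃ ζ : FundamentalGroup S j.base,
    α = loopMul (loopMul ζ (loopClass j.pushOff ^ m)) (j.dehnTwistInvMap ζ⁻¹)

/-! ### The Lefschetz fibration -/

/-- The identification of the part of the local model off the thimble family with an open subset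
of the trivial family `ℂ × (S ∖ V)`: the point `x` corresponds to the point over `q x` with
annulus coordinates `(angle x, 1/2 + height x)`. -/
inductive Glue : (ℂ × ℂ) ⊕ (ℂ × (j.cycleᶜ : Set S)) → (ℂ × ℂ) ⊕ (ℂ × (j.cycleᶜ : Set S)) → Prop
  | mk (x : ℂ × ℂ) (w : ℂ × (j.cycleᶜ : Set S)) (hx : QuadraticModel.height x ≠ 0)
      (h₁ : w.1 = QuadraticModel.q x)
      (h₂ : (w.2 : S) = j (QuadraticModel.angle x, 1 / 2 + QuadraticModel.height x)) :
      Glue (Sum.inl x) (Sum.inr w)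

/-- The total space of the Lefschetz fibration with vanishing cycle `V`, obtained by gluing the
local model `ℂ²` to the trivial family `ℂ × (S ∖ V)`. It is fibred over all of `ℂ`; the fibration
over the disk is its restriction to the closed unit disk. -/
def Total : Type _ := Quot j.Glue

instance : TopologicalSpace j.Total := inferInstanceAs (TopologicalSpace (Quot j.Glue))

/-- The holomorphic neighbourhood `ℂ²` of the critical point. -/
def inModel (x : ℂ × ℂ) : j.Total := Quot.mk _ (Sum.inl x)

/-- The trivial part `ℂ × (S ∖ V)` of the fibration. -/
def inTrivial (w : ℂ × (j.cycleᶜ : Set S)) : j.Total := Quot.mk _ (Sum.inr w)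

/-- The projection of the fibration. -/
def proj : j.Total → ℂ :=
  Quot.lift (Sum.elim QuadraticModel.q Prod.fst) (by
    rintro _ _ ⟨x, w, hx, h₁, h₂⟩
    exact h₁.symm)

/-- The critical point. -/
def crit : j.Total := j.inModel (0, 0)

lemma continuous_inModel : Continuous j.inModel := continuous_quot_mk.comp continuous_inl

lemma continuous_inTrivial : Continuous j.inTrivial := continuous_quot_mk.comp continuous_inr

/-- A continuous section of the fibration over a subset `A` of the base. -/
structure ContSection (A : Set ℂ) where
  toFun : A → j.Total
  continuous_toFun : Continuous toFun
  proj_toFun : ∀ z : A, j.proj (toFun z) = z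

instance (A : Set ℂ) : CoeFun (j.ContSection A) fun _ => A → j.Total := ⟨ContSection.toFun⟩

variable {j} in
lemma ContSection.proj_mem {A : Set ℂ} (s : j.ContSection A) (z : A) : j.proj (s z) ∈ A := by
  rw [s.proj_toFun]; exact z.2

variable {j} in
/-- A section over `A` is smooth if near every point of `A` it is given by a smooth map to the
local model `ℂ²` or by a smooth map to the fibre `S ∖ V` of the trivial part; these two parts form
an open cover of the total space by smooth manifolds, with smooth transition map. -/
def ContSection.IsSmooth {A : Set ℂ} (σ : j.ContSection A) : Prop :=
  ∀ z : A,
    (∃ f : ℂ → ℂ × ℂ, ContDiffWithinAt ℝ ∞ f A z ∧ ∀ᶠ w : A in 𝓝 z, σ w = j.inModel (f w)) ∨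
    (∃ g : ℂ → S, ContMDiffWithinAt 𝓘(ℝ, ℂ) (𝓡 2) ∞ g A z ∧
      ∀ᶠ w : A in 𝓝 z, ∃ hw : g w ∈ j.cycleᶜ, σ w = j.inTrivial (w, ⟨g w, hw⟩))

variable {j} in
/-- A section over the closed unit disk extends a section over the unit circle. -/
def ContSection.Extends (σ : j.ContSection (Metric.closedBall 0 1))
    (s : j.ContSection (Metric.sphere 0 1)) : Prop :=
  ∀ z : Metric.sphere (0 : ℂ) 1, σ ⟨z, Metric.sphere_subset_closedBall z.2⟩ = s z

/-! ### The boundary, a mapping torus of the Dehn twist -/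

/-- The restriction of the fibration to the boundary circle. -/
abbrev Boundary : Type _ := {e : j.Total // j.proj e ∈ Metric.sphere (0 : ℂ) 1}

lemma inModel_fiberPoint {u : Circle} {v : ℝ} (h : j (u, v) ∈ j.cycleᶜ) :
    j.inModel (QuadraticModel.fiberPoint u (v - 1 / 2)) = j.inTrivial (1, ⟨j (u, v), h⟩) := by
  refine Quot.sound (Glue.mk _ _ ?_ ?_ ?_)
  · rw [QuadraticModel.height_fiberPoint]
    exact fun h0 => h ((j.apply_mem_cycle_iff _).2 (by simpa using by linarith))
  · rw [QuadraticModel.q_fiberPoint]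
  · rw [QuadraticModel.angle_fiberPoint, QuadraticModel.height_fiberPoint]
    simp

open Classical in
/-- The identification of the surface `S` with the fibre over `1`: on the trivial part it is
`x ↦ (1, x)`, and near the curve it sends the point with annulus coordinates `(u, v)` to the point
of the local model with `q = 1`, angle `u` and height `v - 1/2`. -/
def fiberIncl (x : S) : j.Total :=
  if h : x ∈ j.cycleᶜ then j.inTrivial (1, ⟨x, h⟩)
  else j.inModel (QuadraticModel.fiberPoint (j.coords x).1 ((j.coords x).2 - 1 / 2))

lemma fiberIncl_apply (p : Circle × ℝ) :
    j.fiberIncl (j p) = j.inModel (QuadraticModel.fiberPoint p.1 (p.2 - 1 / 2)) := by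
  by_cases h : j p ∈ j.cycleᶜ
  · rw [fiberIncl, dif_pos h]
    exact (j.inModel_fiberPoint h).symm
  · rw [fiberIncl, dif_neg h, coords_apply]

lemma proj_fiberIncl (x : S) : j.proj (j.fiberIncl x) = 1 := by
  by_cases h : x ∈ j.cycleᶜ
  · rw [fiberIncl, dif_pos h]; rfl
  · rw [fiberIncl, dif_neg h]
    exact QuadraticModel.q_fiberPoint _ _

lemma fiberIncl_mem (x : S) : j.proj (j.fiberIncl x) ∈ Metric.sphere (0 : ℂ) 1 := by
  simp [proj_fiberIncl]

lemma continuous_fiberIncl [T2Space S] : Continuous j.fiberIncl := by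
  rw [continuous_iff_continuousAt]
  intro x
  by_cases h : x ∈ j.cycleᶜ
  · have ho : IsOpen (j.cycleᶜ) := j.isClosed_cycle.isOpen_compl
    have : ContinuousOn j.fiberIncl j.cycleᶜ := by
      rw [continuousOn_iff_continuous_domRestrict]
      have h' : (j.cycleᶜ).domRestrict j.fiberIncl = fun y => j.inTrivial (1, y) := by
        funext y
        rw [Set.domRestrict_apply, fiberIncl, dif_pos y.2]
      rw [h']
      exact j.continuous_inTrivial.comp (by fun_prop)
    exact this.continuousAt (ho.mem_nhds h)
  · obtain ⟨p, -, rfl⟩ : x ∈ j.cycle := by simpa using h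
    rw [← j.isOpenEmbedding.continuousAt_iff]
    have : j.fiberIncl ∘ j = fun p : Circle × ℝ =>
        j.inModel (QuadraticModel.fiberPoint p.1 (p.2 - 1 / 2)) := funext j.fiberIncl_apply
    rw [this]
    exact (j.continuous_inModel.comp QuadraticModel.continuous_fiberPoint).continuousAt

/-- The inclusion of the fibre over `1` into the boundary. -/
def boundaryIncl [T2Space S] : C(S, j.Boundary) where
  toFun x := ⟨j.fiberIncl x, j.fiberIncl_mem x⟩
  continuous_toFun := j.continuous_fiberIncl.subtype_mk j.fiberIncl_mem

/-- The base point of the boundary. -/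
def boundaryBase [T2Space S] : j.Boundary := j.boundaryIncl j.base

/-- The point `e^{2π i t}` of the unit circle. -/
def circlePoint (t : unitInterval) : Metric.sphere (0 : ℂ) 1 :=
  ⟨Circle.exp (2 * Real.pi * t), by rw [mem_sphere_zero_iff_norm, Circle.norm_coe]⟩

lemma continuous_circlePoint : Continuous circlePoint := by
  unfold circlePoint
  fun_prop

lemma circlePoint_zero : circlePoint 0 = ⟨1, by simp⟩ := by simp [circlePoint]

lemma circlePoint_one : circlePoint 1 = ⟨1, by simp⟩ := by simp [circlePoint]

/-- The loop `t ↦ s (e^{2π i t})` in the boundary defined by a based section over the circle. -/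
def sectionLoop [T2Space S] (s : j.ContSection (Metric.sphere 0 1))
    (hs : s ⟨1, by simp⟩ = j.fiberIncl j.base) : Path j.boundaryBase j.boundaryBase where
  toFun t := ⟨s (circlePoint t), s.proj_mem (circlePoint t)⟩
  continuous_toFun :=
    (s.continuous_toFun.comp continuous_circlePoint).subtype_mk fun t => s.proj_mem (circlePoint t)
  source' := Subtype.ext (by rw [circlePoint_zero]; exact hs)
  target' := Subtype.ext (by rw [circlePoint_one]; exact hs)

/-- The horizontal section swept out by the base point. -/
def horizontal : j.ContSection (Metric.sphere 0 1) where
  toFun z := j.inTrivial (z, ⟨j.base, j.base_notMem⟩)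
  continuous_toFun := j.continuous_inTrivial.comp (by fun_prop)
  proj_toFun _ := rfl

lemma horizontal_one : j.horizontal ⟨1, by simp⟩ = j.fiberIncl j.base := by
  rw [fiberIncl, dif_pos (show j.base ∈ j.cycleᶜ from j.base_notMem)]; rfl

/-- The section `s` of the boundary is based and represents the element `([α], 1)` of
`π₁(S, *) ⋊ ℤ ≅ π₁(∂E, *)`, where `([α], n)` corresponds to the image of `[α]` under the inclusion
of the fibre followed by the `n`-th power of the class of the horizontal section. -/
def Represents [T2Space S] (s : j.ContSection (Metric.sphere 0 1))
    (α : FundamentalGroup S j.base) : Prop :=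
  ∃ hs : s ⟨1, by simp⟩ = j.fiberIncl j.base,
    loopClass (j.sectionLoop s hs) =
      loopMul (FundamentalGroup.map j.boundaryIncl j.base α)
        (loopClass (j.sectionLoop j.horizontal j.horizontal_one))

end AnnularCurve

end

/-! The fibration becomes a product after pulling back along `exp`. For `w : ℂ` the map `transport
w` is a bijection from `S` to the fibre over `exp w`, with inverse `untransport w`, and it satisfies
`transport (w + 2πi) ∘ τ⁻¹ = transport w` for the Dehn twist `τ` (`transport_add_two_pi`). Sections
over the punctured disk therefore correspond to maps `C` from a half plane to `S` with `C (w + 2πi)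
= τ⁻¹ (C w)`, and sections over a circle around `0` correspond to twisted paths, that is, paths `γ`
with `γ 1 = τ⁻¹ (γ 0)`. Under this dictionary `α` is the class of the twisted path of `s`
(`Represents.eq_loopClass`), and `(⋆)` with exponent `m` says that this path is homotopic, through
twisted paths, to the loop that winds `m` times around the push-off (`twistedHomotopic_iff`,
`isTwistedConj_loopClass_iff`). Restricting a section over the disk to smaller and smaller circles
is a homotopy through twisted paths, so everything is decided by the behaviour near `0`.

Through the critical point: near `0` the section lies in the local model, whose nonzero fibres are
annuli. A twisted path in the annulus is classified by an integer
(`exists_twistedHomotopic_windingLoop`), so some `m` occurs. Conversely, a winding loop can spiral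
towards the core curve `v = 1/2` while `z` tends to `0`. The model point then tends to the origin
whatever its angle does (`tendsto_pointA_zero`), so every `m` is realized.

Off the critical point: near `0` the section lies in the trivial part `ℂ × (S ∖ V)`. It can be
contracted there to a horizontal section, and then moved off `V` to one of the sides `v = 0` and `v
= 1`, where horizontal sections correspond to constant twisted paths. The constant path at `v = 1`
is the case `m = 0`. Pushing the constant path at `v = 0` up to `v = 1` collects one full turn from
the twist, which is the case `m = 1` (`twistedHomotopic_windingLoop_one`). Conversely, a homotopy to
such a constant path is filled by a horizontal section near `0`.

Smooth sections: the differential of `q` vanishes at the origin, so a smooth section cannot meet the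
critical point. In the other direction the equivariant map built in the continuous case is constant
near `-∞` and smooth near the boundary, and only the compact range of real parts in between has to
be smoothed equivariantly (`exists_equivariant_smooth`). -/

noncomputable section

/-! ### Twisted paths and their homotopies -/

section TwistedPaths

open unitInterval

variable {X : Type*} [TopologicalSpace X]

/-- A path whose end point is the image of its starting point under `τ`. -/
def IsTwistedPath (τ : X → X) (γ : C(I, X)) : Prop := γ 1 = τ (γ 0)

/-- Homotopy through twisted paths. -/
abbrev TwistedHomotopic (τ : X → X) (γ γ' : C(I, X)) : Prop :=
  γ.HomotopicWith γ' (IsTwistedPath τ)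

lemma TwistedHomotopic.of_square {τ : X → X} {γ γ' : C(I, X)} (F : C(I × I, X))
    (h0 : ∀ t, F (0, t) = γ t) (h1 : ∀ t, F (1, t) = γ' t) (hF : ∀ r, F (r, 1) = τ (F (r, 0))) :
    TwistedHomotopic τ γ γ' :=
  ⟨{ toContinuousMap := F, map_zero_left := h0, map_one_left := h1, prop' := hF }⟩

lemma TwistedHomotopic.exists_square {τ : X → X} {γ γ' : C(I, X)}
    (h : TwistedHomotopic τ γ γ') :
    ∃ F : C(I × I, X), (∀ t, F (0, t) = γ t) ∧ (∀ t, F (1, t) = γ' t) ∧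
      ∀ r, F (r, 1) = τ (F (r, 0)) := by
  obtain ⟨F⟩ := h
  exact ⟨F.toContinuousMap, F.map_zero_left, F.map_one_left, F.prop'⟩

lemma TwistedHomotopic.of_homotopic {τ : X → X} {x y : X} (hxy : y = τ x) {p q : Path x y}
    (h : p.Homotopic q) : TwistedHomotopic τ p q := by
  obtain ⟨F⟩ := h
  refine .of_square F.toContinuousMap F.map_zero_left F.map_one_left fun r => ?_
  change F (r, 1) = τ (F (r, 0))
  rw [F.source, F.target, hxy]

/-- The two ways around a square are homotopic. -/
lemma homotopic_of_square {x₀₀ x₀₁ x₁₀ x₁₁ : X} (F : C(I × I, X)) (b : Path x₀₀ x₀₁)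
    (t : Path x₁₀ x₁₁) (l : Path x₀₀ x₁₀) (r : Path x₀₁ x₁₁) (hb : ∀ s, F (0, s) = b s)
    (ht : ∀ s, F (1, s) = t s) (hl : ∀ s, F (s, 0) = l s) (hr : ∀ s, F (s, 1) = r s) :
    (b.trans r).Homotopic (l.trans t) := by
  have e00 : x₀₀ = F (0, 0) := by rw [hb, b.source]
  have e01 : x₀₁ = F (0, 1) := by rw [hb, b.target]
  have e10 : x₁₀ = F (1, 0) := by rw [ht, t.source]
  have e11 : x₁₁ = F (1, 1) := by rw [ht, t.target]
  let b' : Path ((0, 0) : I × I) (0, 1) := (Path.refl 0).prod Path.id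
  let t' : Path ((1, 0) : I × I) (1, 1) := (Path.refl 1).prod Path.id
  let l' : Path ((0, 0) : I × I) (1, 0) := Path.id.prod (Path.refl 0)
  let r' : Path ((0, 1) : I × I) (1, 1) := Path.id.prod (Path.refl 1)
  have : ContractibleSpace I := (convex_Icc (0 : ℝ) 1).contractibleSpace ⟨0, by simp⟩
  -- The two boundary routes are homotopic in the square itself, which is contractible; `F` carries
  -- this homotopy to `X`.
  have key : (b'.trans r').Homotopic (l'.trans t') := SimplyConnectedSpace.paths_homotopic _ _
  have hkey := (key.map F).pathCast e00 e11
  have hb' : b = (b'.map F.continuous).cast e00 e01 := by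
    ext s; exact (hb s).symm
  have ht' : t = (t'.map F.continuous).cast e10 e11 := by
    ext s; exact (ht s).symm
  have hl' : l = (l'.map F.continuous).cast e00 e10 := by
    ext s; exact (hl s).symm
  have hr' : r = (r'.map F.continuous).cast e01 e11 := by
    ext s; exact (hr s).symm
  rw [hb', ht', hl', hr', ← Path.cast_trans, ← Path.cast_trans, ← Path.map_trans,
    ← Path.map_trans]
  exact hkey

/-- Conjugating by `ζ` and its image under `τ` does not change the class of a twisted loop. -/
lemma twistedHomotopic_conj {τ : C(X, X)} {x : X} (hx : x = τ x) (ζ q : Path x x) :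
    TwistedHomotopic τ ((ζ.trans q).trans ((ζ.map τ.continuous).cast hx hx).symm : Path x x) q := by
  set ζ' := (ζ.map τ.continuous).cast hx hx with hζ'
  have hζe : ∀ s : ℝ, ζ'.extend s = τ (ζ.extend s) := fun s => rfl
  have key : TwistedHomotopic τ ((ζ.trans q).trans ζ'.symm : Path x x)
      (((Path.refl x).trans q).trans (Path.refl x).symm : Path x x) := by
    let F : I × I → X := fun p =>
      if (p.2 : ℝ) ≤ 1 / 2 then
        if (2 * p.2 : ℝ) ≤ 1 / 2 then ζ.extend (p.1 + 2 * (2 * p.2)) else q.extend (2 * (2 * p.2) - 1)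
      else ζ'.extend (p.1 + (1 - (2 * p.2 - 1)))
    have hF : Continuous F := by
      refine Continuous.if_le (Continuous.if_le ?_ ?_ ?_ ?_ ?_) ?_ ?_ ?_ ?_
      · exact ζ.continuous_extend.comp (by fun_prop)
      · exact q.continuous_extend.comp (by fun_prop)
      · fun_prop
      · fun_prop
      · intro p hp
        have h1 : (1 : ℝ) ≤ p.1 + 2 * (2 * p.2) := by rw [hp]; linarith [p.1.2.1]
        rw [ζ.extend_of_one_le h1, hp]; norm_num
      · exact ζ'.continuous_extend.comp (by fun_prop)
      · fun_prop
      · fun_prop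
      · intro p hp
        have h1 : (1 : ℝ) ≤ p.1 + (1 - (2 * p.2 - 1)) := by rw [hp]; linarith [p.1.2.1]
        rw [ζ'.extend_of_one_le h1, if_neg (by rw [hp]; norm_num), hp]; norm_num
    refine .of_square ⟨F, hF⟩ (fun t => ?_) (fun t => ?_) fun r => ?_
    · simp only [F, ContinuousMap.coe_mk, Set.Icc.coe_zero, zero_add]
      simp only [Path.trans, Path.coe_mk_mk, Function.comp_apply]
      split_ifs with h1 h2
      · rw [Path.extend_apply _ (t := 2 * (t : ℝ)) ⟨by linarith [t.2.1], by linarith⟩]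
        simp only [Path.coe_mk_mk, Function.comp_apply, if_pos h2]
      · rw [Path.extend_apply _ (t := 2 * (t : ℝ)) ⟨by linarith [t.2.1], by linarith⟩]
        simp only [Path.coe_mk_mk, Function.comp_apply, if_neg h2]
      · rw [Path.extend_symm_apply]
    · simp only [F, ContinuousMap.coe_mk, Set.Icc.coe_one]
      simp only [Path.trans, Path.coe_mk_mk, Function.comp_apply]
      split_ifs with h1 h2
      · rw [Path.extend_apply _ (t := 2 * (t : ℝ)) ⟨by linarith [t.2.1], by linarith⟩,
          ζ.extend_of_one_le (by linarith [t.2.1])]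
        simp only [Path.coe_mk_mk, Function.comp_apply, Path.refl_extend, ContinuousMap.const_apply,
          if_pos h2]
      · rw [Path.extend_apply _ (t := 2 * (t : ℝ)) ⟨by linarith [t.2.1], by linarith⟩]
        simp only [Path.coe_mk_mk, Function.comp_apply, if_neg h2]
      · rw [ζ'.extend_of_one_le (by linarith [t.2.2])]
        simp
    · simp only [F, ContinuousMap.coe_mk, Set.Icc.coe_one, Set.Icc.coe_zero]
      norm_num [hζe]
  refine key.trans (TwistedHomotopic.of_homotopic hx ?_)
  exact (Path.Homotopic.trans_refl _).trans (Path.Homotopic.refl_trans _)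

/-- Based loops are homotopic through twisted paths if and only if they are twisted conjugate. -/
theorem twistedHomotopic_iff {τ : C(X, X)} {x : X} (hx : x = τ x) (p q : Path x x) :
    TwistedHomotopic τ p q ↔ ∃ ζ : Path x x,
      p.Homotopic ((ζ.trans q).trans ((ζ.map τ.continuous).cast hx hx).symm) := by
  constructor
  · intro h
    obtain ⟨F, h0, h1, hF⟩ := h.exists_square
    let ζ : Path x x := ⟨⟨fun r => F (r, 0), by fun_prop⟩, by simp [h0], by simp [h1]⟩
    refine ⟨ζ, ?_⟩
    have := homotopic_of_square F p q ζ ((ζ.map τ.continuous).cast hx hx) h0 h1 (fun s => rfl)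
      (fun s => hF s)
    set ζ' := (ζ.map τ.continuous).cast hx hx
    have h2 := this.hcomp (Path.Homotopic.refl ζ'.symm)
    refine Path.Homotopic.trans ?_ h2
    refine .symm ((Path.Homotopic.trans_assoc _ _ _).trans ?_)
    exact ((Path.Homotopic.refl p).hcomp (Path.Homotopic.trans_symm _)).trans
      (Path.Homotopic.trans_refl _)
  · rintro ⟨ζ, hζ⟩
    exact (TwistedHomotopic.of_homotopic hx hζ).trans (twistedHomotopic_conj hx ζ q)

/-- A square whose right edge is the image of its left edge extends to an equivariant map of
the plane. -/
theorem exists_equivariant_extension (τ : X ≃ₜ X) (F : C(I × I, X))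
    (hF : ∀ r, F (r, 1) = τ (F (r, 0))) :
    ∃ C : ℝ × ℝ → X, Continuous C ∧ (∀ r t, C (r, t + 1) = τ (C (r, t))) ∧
      ∀ (r : ℝ) (t : I), C (r, t) = F (Set.projIcc 0 1 zero_le_one r, t) := by
  let P : ℝ → I := Set.projIcc 0 1 zero_le_one
  have hP : Continuous P := continuous_projIcc
  let C : ℝ × ℝ → X := fun p => (τ ^ ⌊p.2⌋) (F (P p.1, P (Int.fract p.2)))
  have hpow : ∀ (n : ℤ) (x : X), (τ ^ (n + 1)) x = (τ ^ n) (τ x) := fun n x => by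
    rw [zpow_add_one]; rfl
  have hpow' : ∀ (n : ℤ) (x : X), (τ ^ (n + 1)) x = τ ((τ ^ n) x) := fun n x => by
    rw [add_comm, zpow_add, zpow_one]; rfl
  have hstrip : ∀ (n : ℤ) (r t : ℝ), n ≤ t → t ≤ n + 1 →
      C (r, t) = (τ ^ n) (F (P r, P (t - n))) := by
    intro n r t h1 h2
    rcases h2.lt_or_eq with h2 | h2
    · have : ⌊t⌋ = n := Int.floor_eq_iff.2 ⟨h1, h2⟩
      simp only [C, Int.fract, this]
    -- On the seam `t = n + 1` the definition uses the next strip; the hypothesis on the right edge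
    -- makes the two values agree.
    · have : ⌊t⌋ = n + 1 := by rw [h2]; simp
      simp only [C, Int.fract, this]
      have e1 : P (t - ((n + 1 : ℤ) : ℝ)) = 0 := by
        rw [h2]; push_cast; rw [sub_self]; exact Set.projIcc_left zero_le_one
      have e2 : P (t - n) = 1 := by
        rw [h2]; rw [add_sub_cancel_left]; exact Set.projIcc_right zero_le_one
      rw [e1, e2, hF, hpow]
  refine ⟨C, ?_, fun r t => ?_, fun r t => ?_⟩
  -- Continuity is checked on the locally finite cover by closed strips.
  · let K : ℤ → Set (ℝ × ℝ) := fun n => Prod.snd ⁻¹' Set.Icc (n : ℝ) (n + 1)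
    have hlf : LocallyFinite K := by
      intro p
      refine ⟨Prod.snd ⁻¹' Set.Ioo (p.2 - 1) (p.2 + 1),
        continuous_snd.continuousAt.preimage_mem_nhds (Ioo_mem_nhds (by linarith) (by linarith)), ?_⟩
      refine (Set.finite_Icc (⌊p.2⌋ - 2) (⌊p.2⌋ + 2)).subset ?_
      rintro n ⟨y, hy1, hy2⟩
      have a1 := Int.floor_le p.2
      have a2 := Int.lt_floor_add_one p.2
      have b1 : (n : ℝ) ≤ y.2 := hy1.1
      have b2 : y.2 ≤ (n : ℝ) + 1 := hy1.2
      have c1 : p.2 - 1 < y.2 := hy2.1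
      have c2 : y.2 < p.2 + 1 := hy2.2
      constructor
      · have : ((⌊p.2⌋ - 2 : ℤ) : ℝ) ≤ n := by push_cast; linarith
        exact_mod_cast this
      · have : (n : ℝ) ≤ ((⌊p.2⌋ + 2 : ℤ) : ℝ) := by push_cast; linarith
        exact_mod_cast this
    refine hlf.continuous ?_ (fun n => isClosed_Icc.preimage continuous_snd) fun n => ?_
    · refine Set.eq_univ_of_forall fun p => Set.mem_iUnion.2 ⟨⌊p.2⌋, Int.floor_le _,
        (Int.lt_floor_add_one _).le⟩
    · refine ContinuousOn.congr (f := fun p => (τ ^ n) (F (P p.1, P (p.2 - n)))) ?_ ?_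
      · exact ((τ ^ n).continuous.comp (F.continuous.comp (by fun_prop))).continuousOn
      · exact fun p hp => hstrip n p.1 p.2 hp.1 hp.2
  · rw [hstrip (⌊t⌋ + 1) r (t + 1), hstrip ⌊t⌋ r t (Int.floor_le _) (Int.lt_floor_add_one _).le,
      hpow']
    · push_cast
      rw [add_sub_add_right_eq_sub]
    · push_cast; linarith [Int.floor_le t]
    · push_cast; linarith [Int.lt_floor_add_one t]
  · rw [hstrip 0 r t (by simpa using t.2.1) (by simpa using t.2.2)]
    have : P t = t := Set.projIcc_val _ t
    simp [this, P]

end TwistedPaths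

/-! ### The direction of a complex number -/

/-- The direction `z / |z|` of a nonzero complex number. -/
def Complex.direction (z : ℂ) : Circle := Circle.exp (Complex.arg z)

namespace Complex

lemma norm_mul_direction (z : ℂ) : (‖z‖ : ℂ) * (direction z : ℂ) = z := by
  rw [direction, Circle.coe_exp]; exact Complex.norm_mul_exp_arg_mul_I z

lemma coe_direction {z : ℂ} (hz : z ≠ 0) : (direction z : ℂ) = z / ‖z‖ := by
  rw [eq_div_iff (by exact_mod_cast norm_ne_zero_iff.2 hz), mul_comm, norm_mul_direction]

lemma direction_mul {z w : ℂ} (hz : z ≠ 0) (hw : w ≠ 0) :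
    direction (z * w) = direction z * direction w := by
  apply Circle.ext
  rw [Circle.coe_mul, coe_direction hz, coe_direction hw, coe_direction (mul_ne_zero hz hw),
    norm_mul]
  push_cast
  rw [div_mul_div_comm]

lemma direction_ofReal_mul_circle {r : ℝ} (hr : 0 < r) (u : Circle) :
    direction ((r : ℂ) * u) = u := by
  rw [direction, Complex.arg_real_mul _ hr, Circle.exp_arg]

lemma direction_exp (w : ℂ) : direction (Complex.exp w) = Circle.exp w.im := by
  apply Circle.ext
  rw [coe_direction (Complex.exp_ne_zero w), Complex.norm_exp, Circle.coe_exp,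
    Complex.ofReal_exp, ← Complex.exp_sub]
  congr 1
  apply Complex.ext <;> simp

lemma direction_div {z w : ℂ} (hz : z ≠ 0) (hw : w ≠ 0) :
    direction (z / w) = direction z * (direction w)⁻¹ := by
  rw [eq_mul_inv_iff_mul_eq, ← direction_mul (div_ne_zero hz hw) hw, div_mul_cancel₀ z hw]

/-- `arg` jumps across the negative axis, but the direction equals `z / |z|`, which does not. -/
lemma continuousAt_direction {z : ℂ} (hz : z ≠ 0) : ContinuousAt direction z := by
  have h : Topology.IsInducing ((↑) : Circle → ℂ) := Topology.IsInducing.subtypeVal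
  refine h.continuousAt_iff.2 ?_
  have h1 : ContinuousAt (fun w : ℂ => w / (‖w‖ : ℂ)) z :=
    continuousAt_id.div (by fun_prop) (by exact_mod_cast norm_ne_zero_iff.2 hz)
  refine h1.congr ?_
  filter_upwards [isOpen_ne.mem_nhds hz] with w hw
  exact (coe_direction hw).symm

end Complex

open Complex (direction)

/-! ### Coordinates on the local model: value, angle and height -/

namespace QuadraticModel

lemma continuous_a : Continuous a := by unfold a; fun_prop

lemma continuous_b : Continuous b := by unfold b; fun_prop

lemma continuous_q : Continuous q := by unfold q; fun_prop

lemma continuous_height : Continuous height := by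
  have := continuous_a
  have := continuous_b
  unfold height; fun_prop

/-- The point of `ℂ²` with given coordinates `a` and `b`. -/
def ofAB (a b : ℂ) : ℂ × ℂ := ((a + b) / 2, (a - b) / (2 * Complex.I))

@[simp] lemma a_ofAB (c d : ℂ) : a (ofAB c d) = c := by
  have := Complex.I_ne_zero
  simp only [a, ofAB]; field_simp; ring

@[simp] lemma b_ofAB (c d : ℂ) : b (ofAB c d) = d := by
  have := Complex.I_ne_zero
  simp only [b, ofAB]; field_simp; ring

lemma ext_ab {x y : ℂ × ℂ} (ha : a x = a y) (hb : b x = b y) : x = y := by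
  simp only [a, b] at ha hb
  have := Complex.I_ne_zero
  have h1 : x.1 = y.1 := by linear_combination (ha + hb) / 2
  have h2 : Complex.I * x.2 = Complex.I * y.2 := by linear_combination (ha - hb) / 2
  exact Prod.ext h1 (mul_left_cancel₀ this h2)

@[simp] lemma q_ofAB (c d : ℂ) : q (ofAB c d) = c * d := by rw [q_eq, a_ofAB, b_ofAB]

lemma height_ofAB (c d : ℂ) : height (ofAB c d) = ‖c‖ ^ 2 - ‖d‖ ^ 2 := by
  rw [height, a_ofAB, b_ofAB]

/-- The nonnegative solution `r` of `r² - (ρ / r)² = h`. -/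
def modulus (ρ h : ℝ) : ℝ := Real.sqrt ((h + Real.sqrt (h ^ 2 + 4 * ρ ^ 2)) / 2)

lemma modulus_aux {ρ h : ℝ} (H : ρ ≠ 0 ∨ 0 < h) : 0 < (h + Real.sqrt (h ^ 2 + 4 * ρ ^ 2)) / 2 := by
  rcases H with H | H
  · have h1 : |h| < Real.sqrt (h ^ 2 + 4 * ρ ^ 2) := by
      apply Real.lt_sqrt_of_sq_lt
      rw [sq_abs]; nlinarith [sq_pos_of_ne_zero H]
    have := neg_abs_le h
    linarith
  · have := Real.sqrt_nonneg (h ^ 2 + 4 * ρ ^ 2)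
    linarith

lemma modulus_pos {ρ h : ℝ} (H : ρ ≠ 0 ∨ 0 < h) : 0 < modulus ρ h :=
  Real.sqrt_pos.2 (modulus_aux H)

lemma modulus_sq {ρ h : ℝ} (H : ρ ≠ 0 ∨ 0 < h) :
    modulus ρ h ^ 2 - (ρ / modulus ρ h) ^ 2 = h := by
  have hp := modulus_aux H
  have h2 : Real.sqrt (h ^ 2 + 4 * ρ ^ 2) ^ 2 = h ^ 2 + 4 * ρ ^ 2 := Real.sq_sqrt (by positivity)
  rw [div_pow, modulus, Real.sq_sqrt hp.le]
  have hne := hp.ne'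
  generalize Real.sqrt (h ^ 2 + 4 * ρ ^ 2) = r at *
  have : h + r ≠ 0 := fun h0 => hne (by rw [h0]; simp)
  field_simp
  nlinarith

/-- The discriminant is the perfect square `(r² + s²)²`. With `r = |a|` and `s = |b|` this recovers
`|a|` from `|q|` and the height. -/
lemma modulus_mul_sub {r s : ℝ} (hr : 0 ≤ r) : modulus (r * s) (r ^ 2 - s ^ 2) = r := by
  have h1 : Real.sqrt ((r ^ 2 - s ^ 2) ^ 2 + 4 * (r * s) ^ 2) = r ^ 2 + s ^ 2 := by
    rw [show (r ^ 2 - s ^ 2) ^ 2 + 4 * (r * s) ^ 2 = (r ^ 2 + s ^ 2) ^ 2 by ring,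
      Real.sqrt_sq (by positivity)]
  rw [modulus, h1, show (r ^ 2 - s ^ 2 + (r ^ 2 + s ^ 2)) / 2 = r ^ 2 by ring, Real.sqrt_sq hr]

lemma continuous_modulus : Continuous fun p : ℝ × ℝ => modulus p.1 p.2 := by
  unfold modulus; fun_prop

/-- The point over `z` with height `h` for which `a` has direction `u`. -/
def pointA (z : ℂ) (u : Circle) (h : ℝ) : ℂ × ℂ :=
  ofAB ((modulus ‖z‖ h : ℂ) * u) (z / ((modulus ‖z‖ h : ℂ) * u))

/-- The point over `z` with height `h` for which `b` has direction `u⁻¹`. -/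
def pointB (z : ℂ) (u : Circle) (h : ℝ) : ℂ × ℂ :=
  ofAB (z / ((modulus ‖z‖ (-h) : ℂ) * (u⁻¹ : Circle))) ((modulus ‖z‖ (-h) : ℂ) * (u⁻¹ : Circle))

section pointA

variable {z : ℂ} {h : ℝ} (H : z ≠ 0 ∨ 0 < h)

include H

lemma modulus_norm_pos : 0 < modulus ‖z‖ h :=
  modulus_pos (H.imp_left norm_ne_zero_iff.2)

lemma a_pointA_ne_zero (u : Circle) : (modulus ‖z‖ h : ℂ) * u ≠ 0 :=
  mul_ne_zero (by exact_mod_cast (modulus_norm_pos H).ne') u.coe_ne_zero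

lemma q_pointA (u : Circle) : q (pointA z u h) = z := by
  rw [pointA, q_ofAB, mul_div_cancel₀ _ (a_pointA_ne_zero H u)]

lemma height_pointA (u : Circle) : height (pointA z u h) = h := by
  rw [pointA, height_ofAB, norm_div, norm_mul, Circle.norm_coe, mul_one, Complex.norm_real,
    Real.norm_of_nonneg (modulus_norm_pos H).le, modulus_sq (H.imp_left norm_ne_zero_iff.2)]

lemma direction_a_pointA (u : Circle) : direction (a (pointA z u h)) = u := by
  rw [pointA, a_ofAB, Complex.direction_ofReal_mul_circle (modulus_norm_pos H)]

lemma continuousAt_pointA (u : Circle) :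
    ContinuousAt (fun p : ℂ × Circle × ℝ => pointA p.1 p.2.1 p.2.2) (z, u, h) := by
  have h1 : Continuous fun p : ℂ × Circle × ℝ => (modulus ‖p.1‖ p.2.2 : ℂ) * p.2.1 := by
    have : Continuous fun p : ℂ × Circle × ℝ => modulus ‖p.1‖ p.2.2 :=
      continuous_modulus.comp (f := fun p : ℂ × Circle × ℝ => (‖p.1‖, p.2.2)) (by fun_prop)
    fun_prop
  have h2 : ContinuousAt (fun p : ℂ × Circle × ℝ => p.1 / ((modulus ‖p.1‖ p.2.2 : ℂ) * p.2.1))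
      (z, u, h) := continuousAt_fst.div h1.continuousAt (a_pointA_ne_zero H u)
  have h3 : Continuous fun p : ℂ × ℂ => ofAB p.1 p.2 := by unfold ofAB; fun_prop
  exact h3.continuousAt.comp (h1.continuousAt.prodMk h2)

end pointA

/-- With the three preceding formulas for `pointA`, this makes the value of `q`, the direction of
`a` and the height into coordinates on the set `a ≠ 0`, which contains every fibre over a nonzero
point. -/
lemma pointA_eq {x : ℂ × ℂ} (hx : a x ≠ 0) : pointA (q x) (direction (a x)) (height x) = x := by
  have h1 : modulus ‖q x‖ (height x) = ‖a x‖ := by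
    rw [q_eq, norm_mul, height, modulus_mul_sub (norm_nonneg _)]
  apply ext_ab
  · rw [pointA, a_ofAB, h1, Complex.norm_mul_direction]
  · rw [pointA, b_ofAB, h1, Complex.norm_mul_direction, q_eq, mul_div_cancel_left₀ _ hx]

/-- Exchanging `a` and `b` preserves `q` and negates the height, so all facts about `pointB` follow
from those about `pointA`. -/
lemma pointB_eq_swap (z : ℂ) (u : Circle) (h : ℝ) :
    pointB z u h = ofAB (b (pointA z u⁻¹ (-h))) (a (pointA z u⁻¹ (-h))) := by
  rw [pointA, a_ofAB, b_ofAB, pointB]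

lemma q_pointB {z : ℂ} {h : ℝ} (H : z ≠ 0 ∨ h < 0) (u : Circle) : q (pointB z u h) = z := by
  have H' : z ≠ 0 ∨ 0 < -h := H.imp_right neg_pos.2
  rw [pointB_eq_swap, q_ofAB, mul_comm, ← q_eq, q_pointA H']

lemma height_pointB {z : ℂ} {h : ℝ} (H : z ≠ 0 ∨ h < 0) (u : Circle) :
    height (pointB z u h) = h := by
  have H' : z ≠ 0 ∨ 0 < -h := H.imp_right neg_pos.2
  have := height_pointA H' u⁻¹
  rw [height] at this
  rw [pointB_eq_swap, height_ofAB]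
  linarith

lemma direction_b_pointB {z : ℂ} {h : ℝ} (H : z ≠ 0 ∨ h < 0) (u : Circle) :
    direction (b (pointB z u h)) = u⁻¹ := by
  have H' : z ≠ 0 ∨ 0 < -h := H.imp_right neg_pos.2
  rw [pointB_eq_swap, b_ofAB, direction_a_pointA H']

lemma pointB_eq {x : ℂ × ℂ} (hx : b x ≠ 0) :
    pointB (q x) (direction (b x))⁻¹ (height x) = x := by
  have h1 : modulus ‖q x‖ (-height x) = ‖b x‖ := by
    rw [q_eq, mul_comm, norm_mul, height, neg_sub, modulus_mul_sub (norm_nonneg _)]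
  apply ext_ab
  · rw [pointB, a_ofAB, h1, inv_inv, Complex.norm_mul_direction, q_eq, mul_div_cancel_right₀ _ hx]
  · rw [pointB, b_ofAB, h1, inv_inv, Complex.norm_mul_direction]

lemma continuousAt_pointB {z : ℂ} {h : ℝ} (H : z ≠ 0 ∨ h < 0) (u : Circle) :
    ContinuousAt (fun p : ℂ × Circle × ℝ => pointB p.1 p.2.1 p.2.2) (z, u, h) := by
  have H' : z ≠ 0 ∨ 0 < -h := H.imp_right neg_pos.2
  have h1 : ContinuousAt (fun p : ℂ × Circle × ℝ => pointA p.1 p.2.1⁻¹ (-p.2.2)) (z, u, h) :=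
    ContinuousAt.comp (x := (z, u, h)) (f := fun p : ℂ × Circle × ℝ => (p.1, p.2.1⁻¹, -p.2.2))
      (g := fun p : ℂ × Circle × ℝ => pointA p.1 p.2.1 p.2.2)
      (continuousAt_pointA H' u⁻¹) (by fun_prop)
  simp only [pointB_eq_swap]
  have h3 : Continuous fun p : ℂ × ℂ => ofAB (b p) (a p) := by
    have := continuous_a
    have := continuous_b
    unfold ofAB; fun_prop
  exact h3.continuousAt.comp h1

lemma a_ne_zero_of_height_pos {x : ℂ × ℂ} (hx : 0 < height x) : a x ≠ 0 := fun h => by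
  rw [height, h, norm_zero] at hx
  nlinarith [sq_nonneg ‖b x‖]

lemma b_ne_zero_of_height_neg {x : ℂ × ℂ} (hx : height x < 0) : b x ≠ 0 := fun h => by
  rw [height, h, norm_zero] at hx
  nlinarith [sq_nonneg ‖a x‖]

lemma a_ne_zero_of_q_ne_zero {x : ℂ × ℂ} (hx : q x ≠ 0) : a x ≠ 0 := fun h => by
  rw [q_eq, h, zero_mul] at hx
  exact hx rfl

lemma b_ne_zero_of_q_ne_zero {x : ℂ × ℂ} (hx : q x ≠ 0) : b x ≠ 0 := fun h => by
  rw [q_eq, h, mul_zero] at hx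
  exact hx rfl

lemma angle_of_height_pos {x : ℂ × ℂ} (hx : 0 < height x) : angle x = direction (a x) := by
  rw [angle, if_pos hx]; rfl

lemma angle_of_height_neg {x : ℂ × ℂ} (hx : height x < 0) : angle x = (direction (b x))⁻¹ := by
  rw [angle, if_neg (not_lt.2 hx.le), Circle.exp_neg]; rfl

lemma continuousAt_angle {x : ℂ × ℂ} (hx : height x ≠ 0) : ContinuousAt angle x := by
  rcases hx.lt_or_gt with h | h
  · have h1 : ContinuousAt (fun y => (direction (b y))⁻¹) x :=
      ((Complex.continuousAt_direction (b_ne_zero_of_height_neg h)).comp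
        continuous_b.continuousAt).inv
    refine h1.congr ?_
    filter_upwards [(isOpen_Iio.preimage continuous_height).mem_nhds h] with y hy
    exact (angle_of_height_neg hy).symm
  · have h1 : ContinuousAt (fun y => direction (a y)) x :=
      (Complex.continuousAt_direction (a_ne_zero_of_height_pos h)).comp continuous_a.continuousAt
    refine h1.congr ?_
    filter_upwards [(isOpen_Ioi.preimage continuous_height).mem_nhds h] with y hy
    exact (angle_of_height_pos hy).symm

open Classical in
/-- The point off the thimble family over `z` with given angle and height. -/
def pointOff (z : ℂ) (u : Circle) (h : ℝ) : ℂ × ℂ :=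
  if 0 < h then pointA z u h else pointB z u h

lemma pointOff_eq {x : ℂ × ℂ} (hx : height x ≠ 0) : pointOff (q x) (angle x) (height x) = x := by
  rcases hx.lt_or_gt with h | h
  · rw [pointOff, if_neg (not_lt.2 h.le), angle_of_height_neg h,
      pointB_eq (b_ne_zero_of_height_neg h)]
  · rw [pointOff, if_pos h, angle_of_height_pos h, pointA_eq (a_ne_zero_of_height_pos h)]

lemma pointOff_spec (z : ℂ) (u : Circle) {h : ℝ} (hh : h ≠ 0) :
    q (pointOff z u h) = z ∧ angle (pointOff z u h) = u ∧ height (pointOff z u h) = h := by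
  rcases hh.lt_or_gt with h' | h'
  · have e := height_pointB (z := z) (.inr h') u
    rw [pointOff, if_neg (not_lt.2 h'.le)]
    refine ⟨q_pointB (.inr h') u, ?_, e⟩
    rw [angle_of_height_neg (by rw [e]; exact h'), direction_b_pointB (.inr h'), inv_inv]
  · have e := height_pointA (z := z) (.inr h') u
    rw [pointOff, if_pos h']
    refine ⟨q_pointA (.inr h') u, ?_, e⟩
    rw [angle_of_height_pos (by rw [e]; exact h'), direction_a_pointA (.inr h')]

lemma continuousAt_pointOff (z : ℂ) (u : Circle) {h : ℝ} (hh : h ≠ 0) :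
    ContinuousAt (fun p : ℂ × Circle × ℝ => pointOff p.1 p.2.1 p.2.2) (z, u, h) := by
  have hc : Continuous fun p : ℂ × Circle × ℝ => p.2.2 := by fun_prop
  rcases hh.lt_or_gt with h' | h'
  · refine (continuousAt_pointB (.inr h') u).congr ?_
    filter_upwards [(isOpen_Iio.preimage hc).mem_nhds h'] with p hp
    rw [pointOff, if_neg (not_lt.2 (le_of_lt hp))]
  · refine (continuousAt_pointA (.inr h') u).congr ?_
    filter_upwards [(isOpen_Ioi.preimage hc).mem_nhds h'] with p hp
    rw [pointOff, if_pos (show 0 < p.2.2 from hp)]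

end QuadraticModel

namespace AnnularCurve

open QuadraticModel

variable {S : Type*} [TopologicalSpace S] [ChartedSpace (EuclideanSpace ℝ (Fin 2)) S]
variable (j : AnnularCurve S)

lemma continuousAt_coords (p : Circle × ℝ) : ContinuousAt j.coords (j p) := by
  rw [← j.isOpenEmbedding.continuousAt_iff]
  exact continuousAt_id.congr (.of_forall fun p => (j.coords_apply p).symm)

lemma apply_coords {x : S} (hx : x ∈ Set.range j) : j (j.coords x) = x := by
  obtain ⟨p, rfl⟩ := hx
  rw [coords_apply]

/-! ### The two open pieces of the total space -/

lemma offCycle (x : ℂ × ℂ) (hx : height x ≠ 0) : j (angle x, 1 / 2 + height x) ∈ j.cycleᶜ := by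
  rw [Set.mem_compl_iff, apply_mem_cycle_iff]
  simpa using hx

open Classical in
/-- A normal form for the points of the total space: the trivial part is preferred. -/
def normalForm : j.Total → (ℂ × ℂ) ⊕ (ℂ × (j.cycleᶜ : Set S)) :=
  Quot.lift (Sum.elim (fun x => if hx : height x ≠ 0 then
      Sum.inr (q x, ⟨j (angle x, 1 / 2 + height x), j.offCycle x hx⟩) else Sum.inl x) Sum.inr) (by
    rintro _ _ ⟨x, w, hx, h₁, h₂⟩
    simp only [Sum.elim_inl, Sum.elim_inr, dif_pos hx]
    congr 1
    exact Prod.ext h₁.symm (Subtype.ext h₂.symm))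

lemma normalForm_inTrivial (w : ℂ × (j.cycleᶜ : Set S)) :
    j.normalForm (j.inTrivial w) = Sum.inr w := rfl

lemma normalForm_inModel_of_ne {x : ℂ × ℂ} (hx : height x ≠ 0) :
    j.normalForm (j.inModel x) =
      Sum.inr (q x, ⟨j (angle x, 1 / 2 + height x), j.offCycle x hx⟩) :=
  dif_pos hx

lemma normalForm_inModel_of_eq {x : ℂ × ℂ} (hx : height x = 0) :
    j.normalForm (j.inModel x) = Sum.inl x :=
  dif_neg (not_not.2 hx)

lemma inModel_eq_inTrivial {x : ℂ × ℂ} (hx : height x ≠ 0) :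
    j.inModel x = j.inTrivial (q x, ⟨j (angle x, 1 / 2 + height x), j.offCycle x hx⟩) :=
  Quot.sound (Glue.mk x _ hx rfl rfl)

lemma inTrivial_injective : Function.Injective j.inTrivial := fun w w' h => by
  have := congrArg j.normalForm h
  rwa [normalForm_inTrivial, normalForm_inTrivial, Sum.inr.injEq] at this

/-- No two points of the model are identified by the gluing: off the thimble family a point is
determined by its value, angle and height, and on it the normal form is the point itself. -/
lemma inModel_injective : Function.Injective j.inModel := fun x y h => by
  have h' := congrArg j.normalForm h
  by_cases hx : height x = 0 <;> by_cases hy : height y = 0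
  · rwa [normalForm_inModel_of_eq j hx, normalForm_inModel_of_eq j hy, Sum.inl.injEq] at h'
  · rw [normalForm_inModel_of_eq j hx, normalForm_inModel_of_ne j hy] at h'
    cases h'
  · rw [normalForm_inModel_of_ne j hx, normalForm_inModel_of_eq j hy] at h'
    cases h'
  · rw [normalForm_inModel_of_ne j hx, normalForm_inModel_of_ne j hy, Sum.inr.injEq,
      Prod.mk.injEq, Subtype.mk.injEq, j.injective.eq_iff, Prod.mk.injEq] at h'
    rw [← pointOff_eq hx, ← pointOff_eq hy, h'.1, h'.2.1, add_left_cancel h'.2.2]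

lemma inModel_eq_inTrivial_iff {x : ℂ × ℂ} {w : ℂ × (j.cycleᶜ : Set S)} :
    j.inModel x = j.inTrivial w ↔
      height x ≠ 0 ∧ w.1 = q x ∧ (w.2 : S) = j (angle x, 1 / 2 + height x) := by
  constructor
  · intro h
    have hx : height x ≠ 0 := fun hx => by
      have h' := congrArg j.normalForm h
      rw [normalForm_inModel_of_eq j hx, normalForm_inTrivial] at h'
      cases h'
    rw [j.inModel_eq_inTrivial hx, j.inTrivial_injective.eq_iff] at h
    exact ⟨hx, by rw [← h], by rw [← h]⟩
  · rintro ⟨hx, h₁, h₂⟩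
    exact Quot.sound (Glue.mk x w hx h₁ h₂)

lemma exists_rep (e : j.Total) : (∃ x, e = j.inModel x) ∨ ∃ w, e = j.inTrivial w := by
  induction e using Quot.ind with
  | mk x =>
    rcases x with x | w
    · exact .inl ⟨x, rfl⟩
    · exact .inr ⟨w, rfl⟩

lemma isOpen_total_iff {U : Set j.Total} :
    IsOpen U ↔ IsOpen (j.inModel ⁻¹' U) ∧ IsOpen (j.inTrivial ⁻¹' U) := by
  have h : IsOpen U ↔ IsOpen (Quot.mk j.Glue ⁻¹' U) := isOpen_coinduced.symm
  rw [h, isOpen_sum_iff]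
  rfl

/-- Openness of an image has to be tested in the trivial part. There the model point is recovered
from `z` and the annulus coordinates by `pointOff`, which is continuous at nonzero height. -/
lemma inModel_isOpenEmbedding : Topology.IsOpenEmbedding j.inModel := by
  refine .of_continuous_injective_isOpenMap j.continuous_inModel j.inModel_injective fun O hO => ?_
  rw [isOpen_total_iff, Set.preimage_image_eq _ j.inModel_injective]
  refine ⟨hO, ?_⟩
  rw [isOpen_iff_mem_nhds]
  rintro ⟨z, y, hy⟩ ⟨x, hxO, hx⟩
  obtain ⟨hh, h1, h2⟩ := j.inModel_eq_inTrivial_iff.1 hx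
  dsimp only at h1 h2
  subst h1 h2
  let f : ℂ × (j.cycleᶜ : Set S) → ℂ × Circle × ℝ := fun w =>
    (w.1, (j.coords w.2).1, (j.coords w.2).2 - 1 / 2)
  let w₀ : ℂ × (j.cycleᶜ : Set S) := (q x, ⟨j (angle x, 1 / 2 + height x), hy⟩)
  have hc : ContinuousAt (fun w : ℂ × (j.cycleᶜ : Set S) => j.coords w.2) w₀ :=
    ContinuousAt.comp (f := fun w : ℂ × (j.cycleᶜ : Set S) => (w.2 : S))
      (j.continuousAt_coords (angle x, 1 / 2 + height x)) (by fun_prop)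
  have hf : ContinuousAt f w₀ := by
    refine continuousAt_fst.prodMk ((continuousAt_fst.comp hc).prodMk ?_)
    exact (continuousAt_snd.comp hc).sub continuousAt_const
  have hfw : f w₀ = (q x, angle x, height x) := by simp [f, w₀, coords_apply]
  have hp : ContinuousAt (fun w => pointOff (f w).1 (f w).2.1 (f w).2.2) w₀ :=
    ContinuousAt.comp (f := f) (g := fun p : ℂ × Circle × ℝ => pointOff p.1 p.2.1 p.2.2)
      (by rw [hfw]; exact continuousAt_pointOff _ _ hh) hf
  have hO' : O ∈ 𝓝 (pointOff (f w₀).1 (f w₀).2.1 (f w₀).2.2) := by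
    rw [hfw, pointOff_eq hh]; exact hO.mem_nhds hxO
  have hr : ∀ᶠ w : ℂ × (j.cycleᶜ : Set S) in 𝓝 w₀, (w.2 : S) ∈ Set.range j :=
    (j.isOpenEmbedding.isOpen_range.preimage (by fun_prop : Continuous
      fun w : ℂ × (j.cycleᶜ : Set S) => (w.2 : S))).mem_nhds ⟨_, rfl⟩
  filter_upwards [hp hO', hr] with w hw hwr
  refine ⟨_, hw, j.inModel_eq_inTrivial_iff.2 ?_⟩
  have hne : (j.coords w.2).2 - 1 / 2 ≠ 0 := fun h0 => by
    refine w.2.2 ?_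
    rw [← j.apply_coords hwr, apply_mem_cycle_iff]
    linarith
  obtain ⟨e1, e2, e3⟩ := pointOff_spec (f w).1 (f w).2.1 hne
  refine ⟨by rw [e3]; exact hne, e1.symm, ?_⟩
  rw [e2, e3, ← j.apply_coords hwr]
  simp [f, coords_apply]

/-- Openness is now tested in the model, where the gluing map is continuous because the angle is
continuous off the thimble family. -/
lemma inTrivial_isOpenEmbedding : Topology.IsOpenEmbedding j.inTrivial := by
  refine .of_continuous_injective_isOpenMap j.continuous_inTrivial j.inTrivial_injective
    fun O hO => ?_
  rw [isOpen_total_iff, Set.preimage_image_eq _ j.inTrivial_injective]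
  refine ⟨?_, hO⟩
  rw [isOpen_iff_mem_nhds]
  rintro x ⟨w, hwO, hw⟩
  obtain ⟨hh, h1, h2⟩ := j.inModel_eq_inTrivial_iff.1 hw.symm
  obtain ⟨O', hO', rfl⟩ := (Topology.IsInducing.prodMap (f := (id : ℂ → ℂ)) .id
    (Topology.IsInducing.subtypeVal (t := j.cycleᶜ))).isOpen_iff.1 hO
  let f : ℂ × ℂ → ℂ × S := fun x => (q x, j (angle x, 1 / 2 + height x))
  have hf : ContinuousAt f x := by
    refine continuous_q.continuousAt.prodMk (j.continuous.continuousAt.comp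
      ((continuousAt_angle hh).prodMk ?_))
    exact continuousAt_const.add continuous_height.continuousAt
  have hfx : f x = Prod.map id Subtype.val w := Prod.ext h1.symm h2.symm
  have hO'' : O' ∈ 𝓝 (f x) := by rw [hfx]; exact hO'.mem_nhds hwO
  filter_upwards [hf hO'', (isOpen_ne.preimage continuous_height).mem_nhds hh] with y hy hy'
  exact ⟨(q y, ⟨j (angle y, 1 / 2 + height y), j.offCycle y hy'⟩), hy,
    (j.inModel_eq_inTrivial hy').symm⟩

lemma continuous_proj : Continuous j.proj :=
  continuous_quot_lift _ (continuous_q.sumElim continuous_fst)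

lemma proj_inModel (x : ℂ × ℂ) : j.proj (j.inModel x) = q x := rfl

lemma proj_inTrivial (w : ℂ × (j.cycleᶜ : Set S)) : j.proj (j.inTrivial w) = w.1 := rfl

/-! ### Transport in the fibration over the punctured plane -/

open Classical in
/-- Rotation of the annulus by the angle `κ v` at height `v`. -/
def rotate (κ : ℝ → ℝ) (x : S) : S :=
  if x ∈ Set.range j then j ((j.coords x).1 * Circle.exp (κ (j.coords x).2), (j.coords x).2) else x

lemma rotate_apply (κ : ℝ → ℝ) (u : Circle) (v : ℝ) :
    j.rotate κ (j (u, v)) = j (u * Circle.exp (κ v), v) := by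
  rw [rotate, if_pos (Set.mem_range_self _), coords_apply]

lemma rotate_of_notMem (κ : ℝ → ℝ) {x : S} (hx : x ∉ Set.range j) : j.rotate κ x = x :=
  if_neg hx

lemma twist_eq_rotate (n : ℤ) :
    j.twist n = j.rotate fun v => -(2 * Real.pi * n * Real.smoothTransition v) := rfl

lemma rotate_mem_cycle_iff (κ : ℝ → ℝ) (x : S) : j.rotate κ x ∈ j.cycle ↔ x ∈ j.cycle := by
  by_cases hx : x ∈ Set.range j
  · obtain ⟨⟨u, v⟩, rfl⟩ := hx
    rw [rotate_apply, apply_mem_cycle_iff, apply_mem_cycle_iff]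
  · rw [rotate_of_notMem j κ hx]

lemma rotate_rotate (κ κ' : ℝ → ℝ) (x : S) :
    j.rotate κ (j.rotate κ' x) = j.rotate (fun v => κ' v + κ v) x := by
  by_cases hx : x ∈ Set.range j
  · obtain ⟨⟨u, v⟩, rfl⟩ := hx
    rw [rotate_apply, rotate_apply, rotate_apply, Circle.exp_add, mul_assoc]
  · rw [rotate_of_notMem j κ' hx, rotate_of_notMem j κ hx, rotate_of_notMem j _ hx]

lemma rotate_zero (x : S) : j.rotate (fun _ => 0) x = x := by
  by_cases hx : x ∈ Set.range j
  · obtain ⟨⟨u, v⟩, rfl⟩ := hx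
    rw [rotate_apply, Circle.exp_zero, mul_one]
  · rw [rotate_of_notMem j _ hx]

/-- The rate at which the flat trivialization off the thimble family rotates with respect to
the transport: `χ` below the curve, `χ - 1` above it. -/
def slope (v : ℝ) : ℝ :=
  if 1 / 2 < v then Real.smoothTransition v - 1 else Real.smoothTransition v

lemma slope_of_one_le {v : ℝ} (hv : 1 ≤ v) : slope v = 0 := by
  rw [slope, if_pos (by linarith), Real.smoothTransition.one_of_one_le hv, sub_self]

lemma slope_of_nonpos {v : ℝ} (hv : v ≤ 0) : slope v = 0 := by
  rw [slope, if_neg (by linarith), Real.smoothTransition.zero_of_nonpos hv]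

/-- The only jump of `slope` is at the curve and has size one: turning the angle on one side of `V`
once relative to the other is invisible after a full circuit. -/
lemma slope_eventuallyEq {v : ℝ} (hv : v ≠ 1 / 2) :
    ∃ c : ℝ, slope =ᶠ[𝓝 v] fun v => Real.smoothTransition v - c := by
  rcases hv.lt_or_gt with h | h
  · refine ⟨0, ?_⟩
    filter_upwards [Iio_mem_nhds h] with t ht
    rw [slope, if_neg (not_lt.2 (le_of_lt ht)), sub_zero]
  · refine ⟨1, ?_⟩
    filter_upwards [Ioi_mem_nhds h] with t ht
    rw [slope, if_pos (show 1 / 2 < t from ht)]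

/-- The flat trivialization at angle `θ` read in the transported fibre. -/
def shear (θ : ℝ) : S → S := j.rotate fun v => θ * slope v

lemma shear_of_notMem (θ : ℝ) {x : S}
    (hx : x ∉ j '' ((Set.univ : Set Circle) ×ˢ Set.Icc (0 : ℝ) 1)) : j.shear θ x = x := by
  by_cases h : x ∈ Set.range j
  · obtain ⟨⟨u, v⟩, rfl⟩ := h
    have hv : slope v = 0 := by
      rcases le_total v 0 with h0 | h0
      · exact slope_of_nonpos h0
      · refine slope_of_one_le (le_of_not_ge fun h1 => hx ⟨(u, v), ?_, rfl⟩)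
        simpa using ⟨h0, h1⟩
    rw [shear, rotate_apply, hv, mul_zero, Circle.exp_zero, mul_one]
  · exact rotate_of_notMem j _ h

lemma shear_apply_of_slope {v : ℝ} (hv : slope v = 0) (θ : ℝ) (u : Circle) :
    j.shear θ (j (u, v)) = j (u, v) := by
  rw [shear, rotate_apply, hv, mul_zero, Circle.exp_zero, mul_one]

lemma shear_neg_shear (θ : ℝ) (x : S) : j.shear (-θ) (j.shear θ x) = x := by
  rw [shear, shear, rotate_rotate]
  simp [rotate_zero]

lemma shear_mem_compl {x : S} (θ : ℝ) (hx : x ∈ j.cycleᶜ) : j.shear θ x ∈ j.cycleᶜ := by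
  rw [Set.mem_compl_iff, shear, rotate_mem_cycle_iff]; exact hx

lemma isClosed_annulus [T2Space S] :
    IsClosed (j '' ((Set.univ : Set Circle) ×ˢ Set.Icc (0 : ℝ) 1)) :=
  ((isCompact_univ.prod isCompact_Icc).image j.continuous).isClosed

lemma continuousAt_shear [T2Space S] (θ : ℝ) {x : S} (hx : x ∈ j.cycleᶜ) :
    ContinuousAt (fun p : ℝ × S => j.shear p.1 p.2) (θ, x) := by
  by_cases h : x ∈ j '' ((Set.univ : Set Circle) ×ˢ Set.Icc (0 : ℝ) 1)
  · obtain ⟨⟨u, v⟩, -, rfl⟩ := h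
    have hv : v ≠ 1 / 2 := fun hv => hx ((j.apply_mem_cycle_iff _).2 hv)
    have hs : ContinuousAt slope v := by
      obtain ⟨c, hc⟩ := slope_eventuallyEq hv
      have := Real.smoothTransition.continuous
      exact (show ContinuousAt (fun v => Real.smoothTransition v - c) v by fun_prop).congr hc.symm
    have he : Topology.IsOpenEmbedding (Prod.map (id : ℝ → ℝ) j) := .prodMap .id j.isOpenEmbedding
    have : ContinuousAt ((fun p : ℝ × S => j.shear p.1 p.2) ∘ Prod.map (id : ℝ → ℝ) j)
        (θ, (u, v)) := by
      have e : (fun p : ℝ × S => j.shear p.1 p.2) ∘ Prod.map (id : ℝ → ℝ) j =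
          fun p : ℝ × Circle × ℝ => j (p.2.1 * Circle.exp (p.1 * slope p.2.2), p.2.2) := by
        funext p
        exact j.rotate_apply (fun v => p.1 * slope v) p.2.1 p.2.2
      rw [e]
      refine j.continuous.continuousAt.comp ?_
      have h2 : ContinuousAt (fun p : ℝ × Circle × ℝ => slope p.2.2) (θ, u, v) :=
        ContinuousAt.comp (x := (θ, u, v)) (f := fun p : ℝ × Circle × ℝ => p.2.2) hs (by fun_prop)
      have h3 : ContinuousAt (fun p : ℝ × Circle × ℝ => Circle.exp (p.1 * slope p.2.2))
          (θ, u, v) := Circle.exp.continuous.continuousAt.comp (continuousAt_fst.mul h2)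
      have h1 : ContinuousAt (fun p : ℝ × Circle × ℝ => p.2.1) (θ, u, v) := by fun_prop
      exact (h1.mul h3).prodMk (by fun_prop)
    exact he.continuousAt_iff.1 this
  · refine (continuousAt_snd).congr ?_
    filter_upwards [(j.isClosed_annulus.isOpen_compl.preimage continuous_snd).mem_nhds h] with p hp
    exact (j.shear_of_notMem p.1 hp).symm

/-- The point of the transported fibre (at angle `θ`) that corresponds to a point of the local
model. -/
def unmodel (θ : ℝ) (x : ℂ × ℂ) : S :=
  j (direction (a x) * Circle.exp (θ * (Real.smoothTransition (1 / 2 + height x) - 1)),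
    1 / 2 + height x)

lemma continuousAt_unmodel (θ : ℝ) {x : ℂ × ℂ} (hx : a x ≠ 0) :
    ContinuousAt (fun p : ℝ × ℂ × ℂ => j.unmodel p.1 p.2) (θ, x) := by
  have h1 : ContinuousAt (fun p : ℝ × ℂ × ℂ => direction (a p.2)) (θ, x) :=
    ContinuousAt.comp (x := (θ, x)) (f := fun p : ℝ × ℂ × ℂ => a p.2)
      (Complex.continuousAt_direction hx)
      (continuous_a.comp continuous_snd).continuousAt
  have h2 : Continuous fun p : ℝ × ℂ × ℂ => height p.2 := continuous_height.comp continuous_snd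
  have := Real.smoothTransition.continuous
  have h3 : Continuous fun p : ℝ × ℂ × ℂ =>
      Circle.exp (p.1 * (Real.smoothTransition (1 / 2 + height p.2) - 1)) := by fun_prop
  exact j.continuous.continuousAt.comp
    ((h1.mul h3.continuousAt).prodMk (continuousAt_const.add h2.continuousAt))

/-- Transport to the fibre over `1`: the inverse of `transport`. -/
def untransport (w : ℂ) (e : j.Total) : S :=
  -- The model formula is used only on the thimble family; elsewhere the normal form lies in the
  -- trivial part. `untransport_inModel` shows that the two formulas agree over `exp w`.
  Sum.elim (j.unmodel w.im) (fun y => j.shear w.im y.2) (j.normalForm e)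

lemma untransport_inTrivial (w : ℂ) (y : ℂ × (j.cycleᶜ : Set S)) :
    j.untransport w (j.inTrivial y) = j.shear w.im y.2 := rfl

/-- Above the curve both formulas use the direction of `a`. Below it the angle is read from `b`, and
`a b = exp w` gives direction of `a` = `e^{iθ}` times the inverse direction of `b`, with `θ = Im w`.
This factor is the jump of `slope`. -/
lemma untransport_inModel {w : ℂ} {x : ℂ × ℂ} (hx : q x = Complex.exp w) :
    j.untransport w (j.inModel x) = j.unmodel w.im x := by
  have hq : q x ≠ 0 := by rw [hx]; exact Complex.exp_ne_zero w
  by_cases h : height x = 0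
  · rw [untransport, normalForm_inModel_of_eq j h, Sum.elim_inl]
  · rw [j.inModel_eq_inTrivial h, untransport_inTrivial, shear, rotate_apply, unmodel, slope]
    rcases lt_or_gt_of_ne h with h' | h'
    · rw [angle_of_height_neg h', if_neg (by linarith)]
      have : direction (a x) = Circle.exp w.im * (direction (b x))⁻¹ := by
        rw [← Complex.direction_exp, ← hx, q_eq, Complex.direction_mul
          (a_ne_zero_of_q_ne_zero hq) (b_ne_zero_of_q_ne_zero hq), mul_inv_cancel_right]
      rw [this, mul_sub, mul_one, Circle.exp_sub]
      congr 2
      rw [mul_comm (Circle.exp w.im), mul_assoc, mul_div_cancel]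
    · rw [angle_of_height_pos h', if_pos (by linarith)]

open Classical in
/-- Transport of the fibre over `1` to the fibre over `exp w`. -/
def transport (w : ℂ) (x : S) : j.Total :=
  if h : x ∈ j.cycleᶜ then j.inTrivial (Complex.exp w, ⟨j.shear (-w.im) x, j.shear_mem_compl _ h⟩)
  else j.inModel (pointA (Complex.exp w)
    ((j.coords x).1 * Circle.exp (w.im * (1 - Real.smoothTransition (j.coords x).2)))
      ((j.coords x).2 - 1 / 2))

lemma transport_of_mem (w : ℂ) {x : S} (h : x ∈ j.cycleᶜ) :
    j.transport w x = j.inTrivial (Complex.exp w, ⟨j.shear (-w.im) x, j.shear_mem_compl _ h⟩) :=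
  dif_pos h

/-- One formula in the model is valid on the whole annulus, across the curve included. With `θ = Im
w`, the direction of `a` turns by `θ (1 - χ)` and that of `b` by `θ χ`. So `b` stands still for `v ≤
0` and `a` stands still for `v ≥ 1`, which matches horizontal transport on both sides. -/
lemma transport_apply (w : ℂ) (u : Circle) (v : ℝ) :
    j.transport w (j (u, v)) = j.inModel (pointA (Complex.exp w)
      (u * Circle.exp (w.im * (1 - Real.smoothTransition v))) (v - 1 / 2)) := by
  have H : Complex.exp w ≠ 0 ∨ 0 < v - 1 / 2 := .inl (Complex.exp_ne_zero w)
  by_cases h : j (u, v) ∈ j.cycleᶜ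
  · rw [transport_of_mem j w h]
    have hv : v - 1 / 2 ≠ 0 := fun h0 => h ((j.apply_mem_cycle_iff _).2 (by
      change v = 1 / 2; linarith))
    refine (j.inModel_eq_inTrivial_iff.2 ⟨?_, (q_pointA H _).symm, ?_⟩).symm
    · rwa [height_pointA H]
    · have hh := height_pointA H (u * Circle.exp (w.im * (1 - Real.smoothTransition v)))
      have hs : j.shear (-w.im) (j (u, v)) = j (u * Circle.exp (-w.im * slope v), v) :=
        j.rotate_apply _ _ _
      rw [hh]
      refine hs.trans ?_
      rw [ add_sub_cancel, slope]
      congr 2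
      rcases hv.lt_or_gt with h' | h'
      · rw [angle_of_height_neg (by rw [hh]; exact h'), if_neg (by linarith)]
        rw [pointA, b_ofAB, Complex.direction_div (Complex.exp_ne_zero w) (a_pointA_ne_zero H _),
          Complex.direction_ofReal_mul_circle (modulus_norm_pos H), Complex.direction_exp,
          mul_inv_rev, inv_inv, mul_assoc, ← Circle.exp_neg, ← Circle.exp_add]
        congr 2
        ring
      · rw [angle_of_height_pos (by rw [hh]; exact h'), if_pos (by linarith),
          direction_a_pointA H]
        congr 2
        ring
  · rw [transport, dif_neg h, coords_apply]

lemma proj_transport (w : ℂ) (x : S) : j.proj (j.transport w x) = Complex.exp w := by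
  by_cases h : x ∈ j.cycleᶜ
  · rw [transport_of_mem j w h]; rfl
  · rw [transport, dif_neg h, proj_inModel, q_pointA (.inl (Complex.exp_ne_zero w))]

lemma untransport_transport (w : ℂ) (x : S) : j.untransport w (j.transport w x) = x := by
  have H : Complex.exp w ≠ 0 := Complex.exp_ne_zero w
  by_cases h : x ∈ j.cycleᶜ
  · rw [transport_of_mem j w h, untransport_inTrivial]
    have := j.shear_neg_shear (-w.im) x
    rwa [neg_neg] at this
  · obtain ⟨⟨u, v⟩, -, rfl⟩ := not_not.1 h
    rw [transport_apply, untransport_inModel j (q_pointA (.inl H) _), unmodel,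
      direction_a_pointA (.inl H), height_pointA (.inl H), add_sub_cancel, mul_assoc,
      ← Circle.exp_add]
    rw [show w.im * (1 - Real.smoothTransition v) + w.im * (Real.smoothTransition v - 1) = 0 by
      ring, Circle.exp_zero, mul_one]

lemma transport_untransport {w : ℂ} {e : j.Total} (he : j.proj e = Complex.exp w) :
    j.transport w (j.untransport w e) = e := by
  rcases j.exists_rep e with ⟨x, rfl⟩ | ⟨y, rfl⟩
  · rw [proj_inModel] at he
    have ha : a x ≠ 0 := a_ne_zero_of_q_ne_zero (by rw [he]; exact Complex.exp_ne_zero w)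
    rw [untransport_inModel j he, unmodel, transport_apply, mul_assoc, ← Circle.exp_add,
      add_sub_cancel_left, ← he]
    rw [show w.im * (Real.smoothTransition (1 / 2 + height x) - 1) +
      w.im * (1 - Real.smoothTransition (1 / 2 + height x)) = 0 by ring, Circle.exp_zero, mul_one,
      pointA_eq ha]
  · rw [proj_inTrivial] at he
    rw [untransport_inTrivial, transport_of_mem j w (j.shear_mem_compl _ y.2.2)]
    congr 1
    exact Prod.ext he.symm (Subtype.ext (j.shear_neg_shear _ _))

/-- This is the monodromy. One turn adds `2π (1 - χ)` to the direction of `a`, the inverse twist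
adds `2π χ`, and the sum is a full turn. -/
lemma transport_add_two_pi [T2Space S] (w : ℂ) (x : S) :
    j.transport (w + 2 * Real.pi * Complex.I) (j.dehnTwist.symm x) = j.transport w x := by
  have he : Complex.exp (w + 2 * Real.pi * Complex.I) = Complex.exp w := Complex.exp_periodic w
  have him : (w + 2 * Real.pi * Complex.I).im = w.im + 2 * Real.pi := by simp
  change j.transport _ (j.twist (-1) x) = _
  by_cases hx : x ∈ Set.range j
  · obtain ⟨⟨u, v⟩, rfl⟩ := hx
    rw [twist_apply, transport_apply, transport_apply, he, him, mul_assoc, ← Circle.exp_add]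
    congr 3
    push_cast
    rw [show -(2 * Real.pi * -1 * Real.smoothTransition v) +
      (w.im + 2 * Real.pi) * (1 - Real.smoothTransition v) =
      w.im * (1 - Real.smoothTransition v) + 2 * Real.pi by ring, Circle.exp_add,
      Circle.exp_two_pi, mul_one]
  · have hc : x ∈ j.cycleᶜ := fun h => hx (Set.image_subset_range _ _ h)
    have e : j.twist (-1) x = x := by rw [twist_eq_rotate, rotate_of_notMem j _ hx]
    rw [e, transport_of_mem j _ hc, transport_of_mem j _ hc]
    congr 1
    refine Prod.ext he (Subtype.ext ?_)
    change j.shear _ x = j.shear _ x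
    rw [shear, shear, rotate_of_notMem j _ hx, rotate_of_notMem j _ hx]

lemma untransport_add_two_pi [T2Space S] {w : ℂ} {e : j.Total} (he : j.proj e = Complex.exp w) :
    j.untransport (w + 2 * Real.pi * Complex.I) e = j.dehnTwist.symm (j.untransport w e) := by
  conv_lhs => rw [← j.transport_untransport he, ← j.transport_add_two_pi]
  rw [untransport_transport]

lemma transport_zero (x : S) : j.transport 0 x = j.fiberIncl x := by
  by_cases h : x ∈ j.cycleᶜ
  · rw [transport_of_mem j _ h, fiberIncl, dif_pos h]
    congr 1
    refine Prod.ext Complex.exp_zero (Subtype.ext ?_)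
    change j.rotate (fun v => -(0 : ℂ).im * slope v) x = x
    simp [rotate_zero]
  · obtain ⟨⟨u, v⟩, -, rfl⟩ := not_not.1 h
    rw [transport_apply, fiberIncl_apply, Complex.exp_zero, Complex.zero_im, zero_mul,
      Circle.exp_zero, mul_one]
    have hm : modulus ‖(1 : ℂ)‖ (v - 1 / 2) = radius (v - 1 / 2) := by
      rw [modulus, radius, norm_one]; norm_num
    congr 1
    apply ext_ab
    · rw [pointA, a_ofAB, a_fiberPoint, hm]
    · rw [pointA, b_ofAB, b_fiberPoint, hm, Circle.coe_inv, one_div, mul_inv]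

/-- Off the curve the flat formula applies and `shear` is continuous; at a point of the curve the
model formula is used, since `slope` jumps there but `pointA` does not. -/
lemma continuous_transport [T2Space S] : Continuous fun p : ℂ × S => j.transport p.1 p.2 := by
  rw [continuous_iff_continuousAt]
  rintro ⟨w, x⟩
  by_cases h : x ∈ j.cycleᶜ
  · have hU : IsOpen (Prod.snd ⁻¹' j.cycleᶜ : Set (ℂ × S)) :=
      j.isClosed_cycle.isOpen_compl.preimage continuous_snd
    have : ContinuousOn (fun p : ℂ × S => j.transport p.1 p.2) (Prod.snd ⁻¹' j.cycleᶜ) := by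
      rw [continuousOn_iff_continuous_domRestrict]
      have e : (Prod.snd ⁻¹' j.cycleᶜ : Set (ℂ × S)).domRestrict
          (fun p : ℂ × S => j.transport p.1 p.2) = fun p => j.inTrivial (Complex.exp p.1.1,
            ⟨j.shear (-p.1.1.im) p.1.2, j.shear_mem_compl _ p.2⟩) := by
        funext p
        exact j.transport_of_mem _ p.2
      rw [e]
      refine j.continuous_inTrivial.comp (Continuous.prodMk (by fun_prop) (Continuous.subtype_mk ?_ _))
      rw [continuous_iff_continuousAt]
      intro p
      exact ContinuousAt.comp (f := fun p : (Prod.snd ⁻¹' j.cycleᶜ : Set (ℂ × S)) =>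
        (-p.1.1.im, p.1.2)) (j.continuousAt_shear (-p.1.1.im) p.2) (by fun_prop)
    exact this.continuousAt (hU.mem_nhds h)
  · obtain ⟨⟨u, v⟩, -, rfl⟩ := not_not.1 h
    have he : Topology.IsOpenEmbedding (Prod.map (id : ℂ → ℂ) j) := .prodMap .id j.isOpenEmbedding
    have : ContinuousAt ((fun p : ℂ × S => j.transport p.1 p.2) ∘ Prod.map (id : ℂ → ℂ) j)
        (w, (u, v)) := by
      have e : (fun p : ℂ × S => j.transport p.1 p.2) ∘ Prod.map (id : ℂ → ℂ) j =
          fun p : ℂ × Circle × ℝ => j.inModel (pointA (Complex.exp p.1)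
            (p.2.1 * Circle.exp (p.1.im * (1 - Real.smoothTransition p.2.2)))
            (p.2.2 - 1 / 2)) := by
        funext p
        exact j.transport_apply _ _ _
      rw [e]
      have := Real.smoothTransition.continuous
      refine j.continuous_inModel.continuousAt.comp ?_
      exact ContinuousAt.comp (x := (w, u, v)) (f := fun p : ℂ × Circle × ℝ => (Complex.exp p.1,
        p.2.1 * Circle.exp (p.1.im * (1 - Real.smoothTransition p.2.2)), p.2.2 - 1 / 2))
        (g := fun p : ℂ × Circle × ℝ => pointA p.1 p.2.1 p.2.2)
        (continuousAt_pointA (.inl (Complex.exp_ne_zero w)) _) (by fun_prop)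
    exact he.continuousAt_iff.1 this

/-- Continuity holds on the fibre product of `exp` and `proj`, where the angle and the point are
compatible; it is checked by locally inverting the two open embeddings. -/
lemma continuous_untransport [T2Space S] :
    Continuous fun p : {p : ℂ × j.Total // j.proj p.2 = Complex.exp p.1} =>
      j.untransport p.1.1 p.1.2 := by
  rw [continuous_iff_continuousAt]
  rintro ⟨⟨w, e⟩, he⟩
  have hc : Continuous fun p : {p : ℂ × j.Total // j.proj p.2 = Complex.exp p.1} => p.1.2 := by
    fun_prop
  rcases j.exists_rep e with ⟨x, rfl⟩ | ⟨y, rfl⟩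
  · have hinv : ∀ x, Function.invFun j.inModel (j.inModel x) = x :=
      Function.leftInverse_invFun j.inModel_injective
    have h1 : ContinuousAt (Function.invFun j.inModel) (j.inModel x) := by
      rw [← j.inModel_isOpenEmbedding.continuousAt_iff]
      exact continuousAt_id.congr (.of_forall fun p => (hinv p).symm)
    have h2 : ContinuousAt (fun p : {p : ℂ × j.Total // j.proj p.2 = Complex.exp p.1} =>
        j.unmodel p.1.1.im (Function.invFun j.inModel p.1.2)) ⟨(w, j.inModel x), he⟩ := by
      refine ContinuousAt.comp (f := fun p : {p : ℂ × j.Total // j.proj p.2 = Complex.exp p.1} =>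
        (p.1.1.im, Function.invFun j.inModel p.1.2)) (g := fun p : ℝ × ℂ × ℂ => j.unmodel p.1 p.2)
        ?_ ?_
      · dsimp only
        rw [hinv]
        refine j.continuousAt_unmodel _ (a_ne_zero_of_q_ne_zero ?_)
        rw [← j.proj_inModel, he]; exact Complex.exp_ne_zero w
      · refine ContinuousAt.prodMk (by fun_prop) ?_
        exact ContinuousAt.comp (x := ⟨(w, j.inModel x), he⟩)
          (f := fun p : {p : ℂ × j.Total // j.proj p.2 = Complex.exp p.1} => p.1.2)
          h1 hc.continuousAt
    refine h2.congr ?_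
    filter_upwards [(j.inModel_isOpenEmbedding.isOpen_range.preimage hc).mem_nhds ⟨x, rfl⟩]
      with p hp
    obtain ⟨x', hx'⟩ := hp
    have hp2 := p.2
    dsimp only at hx'
    rw [← hx'] at hp2 ⊢
    rw [hinv, j.untransport_inModel hp2]
  · have : Nonempty (ℂ × (j.cycleᶜ : Set S)) := ⟨y⟩
    have hinv : ∀ x, Function.invFun j.inTrivial (j.inTrivial x) = x :=
      Function.leftInverse_invFun j.inTrivial_injective
    have h1 : ContinuousAt (Function.invFun j.inTrivial) (j.inTrivial y) := by
      rw [← j.inTrivial_isOpenEmbedding.continuousAt_iff]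
      exact continuousAt_id.congr (.of_forall fun p => (hinv p).symm)
    have h2 : ContinuousAt (fun p : {p : ℂ × j.Total // j.proj p.2 = Complex.exp p.1} =>
        j.shear p.1.1.im (Function.invFun j.inTrivial p.1.2).2) ⟨(w, j.inTrivial y), he⟩ := by
      refine ContinuousAt.comp (f := fun p : {p : ℂ × j.Total // j.proj p.2 = Complex.exp p.1} =>
        (p.1.1.im, ((Function.invFun j.inTrivial p.1.2).2 : S)))
        (g := fun p : ℝ × S => j.shear p.1 p.2) ?_ ?_
      · dsimp only
        rw [hinv]
        exact j.continuousAt_shear _ y.2.2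
      · refine ContinuousAt.prodMk (by fun_prop) ?_
        have h3 : ContinuousAt (fun p : {p : ℂ × j.Total // j.proj p.2 = Complex.exp p.1} =>
          Function.invFun j.inTrivial p.1.2) ⟨(w, j.inTrivial y), he⟩ :=
            ContinuousAt.comp (x := ⟨(w, j.inTrivial y), he⟩)
              (f := fun p : {p : ℂ × j.Total // j.proj p.2 = Complex.exp p.1} => p.1.2)
              h1 hc.continuousAt
        exact (continuous_subtype_val.comp continuous_snd).continuousAt.comp h3
    refine h2.congr ?_
    filter_upwards [(j.inTrivial_isOpenEmbedding.isOpen_range.preimage hc).mem_nhds ⟨y, rfl⟩]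
      with p hp
    obtain ⟨x', hx'⟩ := hp
    dsimp only at hx'
    rw [← hx', hinv, j.untransport_inTrivial]

end AnnularCurve

namespace AnnularCurve

open QuadraticModel unitInterval

variable {S : Type*} [TopologicalSpace S] [ChartedSpace (EuclideanSpace ℝ (Fin 2)) S]
variable (j : AnnularCurve S)

/-! ### The class of a section over the circle -/

lemma continuous_untransport_comp [T2Space S] {Y : Type*} [TopologicalSpace Y] {f : Y → ℂ}
    {g : Y → j.Total} (hf : Continuous f) (hg : Continuous g)
    (h : ∀ y, j.proj (g y) = Complex.exp (f y)) : Continuous fun y => j.untransport (f y) (g y) :=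
  j.continuous_untransport.comp ((hf.prodMk hg).subtype_mk h)

/-- The projection of the boundary to the circle. -/
def boundaryProj : C(j.Boundary, Circle) where
  toFun e := ⟨j.proj e.1, e.2⟩
  continuous_toFun := (j.continuous_proj.comp continuous_subtype_val).subtype_mk _

lemma coe_boundaryProj (e : j.Boundary) : (j.boundaryProj e : ℂ) = j.proj e.1 := rfl

lemma exp_mul_I_mem (θ : ℝ) : Complex.exp (θ * Complex.I) ∈ Metric.sphere (0 : ℂ) 1 := by
  rw [mem_sphere_zero_iff_norm, Complex.norm_exp_ofReal_mul_I]

/-- Homotopic paths in the boundary have homotopic transports to the fibre over `1`. -/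
lemma untransport_homotopic [T2Space S] {x y : j.Boundary} {γ₀ γ₁ : Path x y}
    (h : γ₀.Homotopic γ₁) {θ₀ θ₁ : C(I, ℝ)} (h₀ : ∀ t, Circle.exp (θ₀ t) = j.boundaryProj (γ₀ t))
    (h₁ : ∀ t, Circle.exp (θ₁ t) = j.boundaryProj (γ₁ t)) (h01 : θ₀ 0 = θ₁ 0) {p q : S}
    {c₀ c₁ : Path p q} (hc₀ : ∀ t, c₀ t = j.untransport (θ₀ t * Complex.I) (γ₀ t).1)
    (hc₁ : ∀ t, c₁ t = j.untransport (θ₁ t * Complex.I) (γ₁ t).1) : c₀.Homotopic c₁ := by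
  obtain ⟨F⟩ := h
  let F' := F.compContinuousMap j.boundaryProj
  have e₀ : Circle.exp ∘ θ₀ = ⇑(j.boundaryProj.comp γ₀.toContinuousMap) := funext h₀
  have e₁ : Circle.exp ∘ θ₁ = ⇑(j.boundaryProj.comp γ₁.toContinuousMap) := funext h₁
  -- The projection of the homotopy to the circle is lifted to angles. The two given angle functions
  -- agree at time `0`, which pins the lift and lets it restrict to both of them.
  let G := Circle.isCoveringMap_exp.liftHomotopyRel F' ⟨0, by simp, h01⟩ e₀ e₁
  have hG : ∀ r t, Circle.exp (G (r, t)) = j.boundaryProj (F (r, t)) := fun r t =>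
    congr_fun (Circle.isCoveringMap_exp.liftHomotopy_lifts (F' : C(I × I, Circle)) θ₀
      fun a => (F'.apply_zero a).trans (congr_fun e₀ a).symm) (r, t)
  let K : I × I → S := fun p => j.untransport (G p * Complex.I) (F p).1
  have hK : Continuous K := by
    refine j.continuous_untransport_comp ?_ ?_ ?_
    · exact (Complex.continuous_ofReal.comp G.continuous).mul continuous_const
    · exact continuous_subtype_val.comp F.continuous
    · rintro ⟨r, t⟩
      rw [← coe_boundaryProj, ← hG, Circle.coe_exp]
  refine ⟨{ toFun := K, continuous_toFun := hK, map_zero_left := fun t => ?_,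
            map_one_left := fun t => ?_, prop' := ?_ }⟩
  · have a1 : G (0, t) = θ₀ t := G.apply_zero t
    have a2 : F (0, t) = γ₀ t := F.apply_zero t
    simp only [K, a1, a2]
    exact (hc₀ t).symm
  · have a1 : G (1, t) = θ₁ t := G.apply_one t
    have a2 : F (1, t) = γ₁ t := F.apply_one t
    simp only [K, a1, a2]
    exact (hc₁ t).symm
  · intro r t ht
    have a1 : G (r, t) = θ₀ t := G.prop r t ht
    have a2 : F (r, t) = γ₀ t := F.prop r t ht
    change K (r, t) = c₀ t
    simp only [K, a1, a2]
    exact (hc₀ t).symm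

/-- The transport to the fibre over `1` of a section over the circle, as a function of the
angle. -/
def circleLift (s : j.ContSection (Metric.sphere 0 1)) (θ : ℝ) : S :=
  j.untransport (θ * Complex.I) (s ⟨Complex.exp (θ * Complex.I), exp_mul_I_mem θ⟩)

lemma continuous_circleLift [T2Space S] (s : j.ContSection (Metric.sphere 0 1)) :
    Continuous (j.circleLift s) := by
  refine j.continuous_untransport_comp (by fun_prop) (s.continuous_toFun.comp ?_) fun θ => ?_
  · exact Continuous.subtype_mk (by fun_prop) _
  · exact s.proj_toFun _

/-- The value of the section is the same at `θ` and `θ + 2π`; only the trivialization changes, by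
the monodromy. -/
lemma circleLift_add_two_pi [T2Space S] (s : j.ContSection (Metric.sphere 0 1)) (θ : ℝ) :
    j.circleLift s (θ + 2 * Real.pi) = j.dehnTwist.symm (j.circleLift s θ) := by
  have e : ((θ + 2 * Real.pi : ℝ) : ℂ) * Complex.I =
      θ * Complex.I + 2 * Real.pi * Complex.I := by push_cast; ring
  have hs : s ⟨Complex.exp ((θ + 2 * Real.pi : ℝ) * Complex.I), exp_mul_I_mem _⟩ =
      s ⟨Complex.exp (θ * Complex.I), exp_mul_I_mem θ⟩ := by
    congr 2
    rw [e]
    exact Complex.exp_periodic _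
  rw [circleLift, hs, e, j.untransport_add_two_pi (s.proj_toFun _)]
  rfl

lemma circleLift_zero (s : j.ContSection (Metric.sphere 0 1))
    (hs : s ⟨1, by simp⟩ = j.fiberIncl j.base) : j.circleLift s 0 = j.base := by
  have : s ⟨Complex.exp ((0 : ℝ) * Complex.I), exp_mul_I_mem 0⟩ = s ⟨1, by simp⟩ := by
    congr 2; simp
  rw [circleLift, this, hs, Complex.ofReal_zero, zero_mul, ← j.transport_zero,
    j.untransport_transport]

lemma circleLift_two_pi [T2Space S] (s : j.ContSection (Metric.sphere 0 1))
    (hs : s ⟨1, by simp⟩ = j.fiberIncl j.base) : j.circleLift s (2 * Real.pi) = j.base := by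
  have := j.circleLift_add_two_pi s 0
  rw [zero_add] at this
  rw [this, j.circleLift_zero s hs, j.dehnTwist_symm_base]

/-- The loop in the fibre over `1` obtained by transport of a based section over the circle. -/
def fiberLoop [T2Space S] (s : j.ContSection (Metric.sphere 0 1))
    (hs : s ⟨1, by simp⟩ = j.fiberIncl j.base) : Path j.base j.base where
  toFun t := j.circleLift s (2 * Real.pi * t)
  continuous_toFun := (j.continuous_circleLift s).comp (by fun_prop)
  source' := by simpa using j.circleLift_zero s hs
  target' := by simpa using j.circleLift_two_pi s hs

lemma loopClass_surjective {X : Type*} [TopologicalSpace X] {x : X} :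
    Function.Surjective (loopClass : Path x x → FundamentalGroup X x) :=
  Path.Homotopic.Quotient.mk_surjective

lemma loopClass_eq_iff {X : Type*} [TopologicalSpace X] {x : X} {p q : Path x x} :
    loopClass p = loopClass q ↔ p.Homotopic q :=
  Path.Homotopic.Quotient.eq

lemma loopMul_loopClass {X : Type*} [TopologicalSpace X] {x : X} (p q : Path x x) :
    loopMul (loopClass p) (loopClass q) = loopClass (p.trans q) := rfl

lemma loopClass_inv {X : Type*} [TopologicalSpace X] {x : X} (p : Path x x) :
    (loopClass p)⁻¹ = loopClass p.symm := rfl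

/-- The class of a section is the class of its transport to the fibre over `1`. -/
theorem Represents.eq_loopClass [T2Space S] {s : j.ContSection (Metric.sphere 0 1)}
    {α : FundamentalGroup S j.base} (h : j.Represents s α) :
    ∃ hs : s ⟨1, by simp⟩ = j.fiberIncl j.base, α = loopClass (j.fiberLoop s hs) := by
  obtain ⟨hs, h⟩ := h
  refine ⟨hs, ?_⟩
  obtain ⟨p, rfl⟩ := loopClass_surjective α
  have hmap : FundamentalGroup.map j.boundaryIncl j.base (loopClass p) =
      loopClass (p.map j.boundaryIncl.continuous) := rfl
  rw [hmap] at h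
  let p' : Path j.boundaryBase j.boundaryBase := p.map j.boundaryIncl.continuous
  have h' : (j.sectionLoop s hs).Homotopic
      (p'.trans (j.sectionLoop j.horizontal j.horizontal_one)) := loopClass_eq_iff.1 h
  refine loopClass_eq_iff.2 (.trans (Path.Homotopic.trans_refl p).symm (.symm ?_))
  -- The angle along the concatenation: constant while `p` runs in the fibre over `1`, then one full
  -- turn along the horizontal section. The second half is transported to the constant path, because
  -- `slope` vanishes at the base point, so the result is `p` followed by a constant path.
  let θ₁ : C(I, ℝ) := ⟨fun t => if (t : ℝ) ≤ 1 / 2 then 0 else 2 * Real.pi * (2 * t - 1),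
    Continuous.if_le (by fun_prop) (by fun_prop) (by fun_prop) (by fun_prop) (by
      intro t ht; rw [ht]; norm_num)⟩
  refine j.untransport_homotopic h' (θ₀ := ⟨fun t => 2 * Real.pi * t, by fun_prop⟩) (θ₁ := θ₁)
    (fun t => ?_) (fun t => ?_) (by simp [θ₁]) (fun t => ?_) fun t => ?_
  · apply Circle.ext
    rw [coe_boundaryProj]
    exact (s.proj_toFun (circlePoint t)).symm
  · apply Circle.ext
    rw [coe_boundaryProj, Path.trans_apply]
    simp only [θ₁, ContinuousMap.coe_mk]
    split_ifs with ht
    · rw [Circle.exp_zero, Circle.coe_one]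
      exact (j.proj_fiberIncl _).symm
    · rfl
  · change j.circleLift s (2 * Real.pi * t) = _
    rw [circleLift]
    rfl
  · rw [Path.trans_apply, Path.trans_apply]
    simp only [θ₁, ContinuousMap.coe_mk]
    split_ifs with ht
    · rw [Complex.ofReal_zero, zero_mul]
      change _ = j.untransport 0 (j.fiberIncl _)
      rw [← j.transport_zero, j.untransport_transport]
    · change j.base = j.shear _ j.base
      exact (j.shear_apply_of_slope (slope_of_one_le le_rfl) _ _).symm

end AnnularCurve

namespace AnnularCurve

open QuadraticModel

variable {S : Type*} [TopologicalSpace S] [ChartedSpace (EuclideanSpace ℝ (Fin 2)) S]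
variable (j : AnnularCurve S)

/-! ### Twisted conjugacy classes as homotopy classes of twisted paths -/

/-- The inverse Dehn twist as a continuous map. -/
def invTwist [T2Space S] : C(S, S) := (j.dehnTwist.symm : C(S, S))

lemma invTwist_apply [T2Space S] (u : Circle) (v : ℝ) :
    j.invTwist (j (u, v)) = j (u * Circle.exp (2 * Real.pi * Real.smoothTransition v), v) := by
  change j.twist (-1) _ = _
  rw [twist_apply]
  push_cast
  congr 4
  ring

lemma invTwist_base [T2Space S] : j.base = j.invTwist j.base := j.dehnTwist_symm_base.symm

/-- The loop that winds `m` times along the push-off of the curve. -/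
def windingLoop (m : ℤ) : Path j.base j.base where
  toFun t := j (Circle.exp (2 * Real.pi * (m * t)), 1)
  continuous_toFun := j.continuous.comp (by fun_prop)
  source' := by simp [base]
  target' := by simp [base, exp_int]

lemma windingLoop_apply (m : ℤ) (t : unitInterval) :
    j.windingLoop m t = j (Circle.exp (2 * Real.pi * (m * t)), 1) := rfl

/-- All three loops are images of segments of `ℝ` under the map `E` of period one, and in `ℝ` paths
with the same end points are homotopic. -/
lemma windingLoop_trans (m n : ℤ) :
    (j.windingLoop (n + m)).Homotopic ((j.windingLoop n).trans (j.windingLoop m)) := by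
  let E : ℝ → S := fun x => j (Circle.exp (2 * Real.pi * x), 1)
  have hE : Continuous E := j.continuous.comp (by fun_prop)
  have hE' : ∀ (k : ℤ) (x : ℝ), E (k + x) = E x := fun k x => by
    simp only [E]
    rw [mul_add, Circle.exp_add, exp_int, one_mul]
  have hEk : ∀ k : ℤ, j.base = E k := fun k => by
    have := hE' k 0
    rw [add_zero] at this
    rw [this]; simp [E, base]
  have hE0 : j.base = E 0 := by simpa using hEk 0
  let l : ∀ x y : ℝ, Path x y := fun x y => ⟨⟨fun t => x + t * (y - x), by fun_prop⟩, by simp, by simp⟩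
  have h1 : j.windingLoop (n + m) = ((l 0 ((n + m : ℤ) : ℝ)).map hE).cast hE0 (hEk _) := by
    ext t
    simp [windingLoop, l, E, mul_comm]
  have h2 : j.windingLoop n = ((l 0 n).map hE).cast hE0 (hEk _) := by
    ext t
    simp [windingLoop, l, E, mul_comm]
  have h3 : j.windingLoop m = ((l n ((n + m : ℤ) : ℝ)).map hE).cast (hEk _) (hEk _) := by
    ext t
    change E (m * t) = E (n + t * (((n + m : ℤ) : ℝ) - n))
    rw [hE']
    push_cast
    congr 1
    ring
  rw [h1, h2, h3, ← Path.cast_trans, ← Path.map_trans]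
  exact ((SimplyConnectedSpace.paths_homotopic _ _).map ⟨E, hE⟩).pathCast _ _

lemma loopClass_pushOff_zpow (m : ℤ) :
    loopClass j.pushOff ^ m = loopClass (j.windingLoop m) := by
  let f : Multiplicative ℤ →* FundamentalGroup S j.base :=
    MonoidHom.mk' (fun m => loopClass (j.windingLoop m.toAdd)) fun m n => by
      -- The exponents are swapped because multiplication in `FundamentalGroup` is opposite to
      -- concatenation.
      rw [toAdd_mul, add_comm]
      exact loopClass_eq_iff.2 (j.windingLoop_trans _ _)
  have h1 : loopClass j.pushOff = f (Multiplicative.ofAdd 1) := by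
    change loopClass _ = loopClass _
    congr 1
    ext t
    change j (Circle.exp (2 * Real.pi * t), 1) = j (Circle.exp (2 * Real.pi * ((1 : ℤ) * t)), 1)
    simp
  rw [h1, ← map_zpow, ← ofAdd_zsmul, smul_eq_mul, mul_one]
  rfl

/-- The class of a loop is a twisted conjugate of the `m`-th power of the push-off if and only if
the loop is homotopic to that power through twisted paths. -/
theorem isTwistedConj_loopClass_iff [T2Space S] (m : ℤ) (p : Path j.base j.base) :
    j.IsTwistedConj m (loopClass p) ↔ TwistedHomotopic j.invTwist p (j.windingLoop m) := by
  rw [twistedHomotopic_iff j.invTwist_base, IsTwistedConj, loopClass_surjective.exists]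
  refine exists_congr fun ζ => ?_
  have h1 : j.dehnTwistInvMap (loopClass ζ) =
      loopClass ((ζ.map j.invTwist.continuous).cast j.invTwist_base j.invTwist_base) := by
    rw [dehnTwistInvMap, FundamentalGroup.mapOfEq_apply]
    rfl
  rw [map_inv, h1, loopClass_inv, loopClass_pushOff_zpow, loopMul_loopClass, loopMul_loopClass,
    loopClass_eq_iff]

/-- A twisted path in the annulus is homotopic to a winding loop through twisted paths. -/
lemma exists_twistedHomotopic_windingLoop [T2Space S] {γ : C(unitInterval, S)}
    (hγ : IsTwistedPath j.invTwist γ) (hr : ∀ t, γ t ∈ Set.range j) :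
    ∃ m : ℤ, TwistedHomotopic j.invTwist γ (j.windingLoop m) := by
  have hc : Continuous fun t => j.coords (γ t) := by
    rw [continuous_iff_continuousAt]
    intro t
    obtain ⟨p, hp⟩ := hr t
    exact ContinuousAt.comp (by rw [← hp]; exact j.continuousAt_coords p) γ.continuous.continuousAt
  let u : C(unitInterval, Circle) := ⟨fun t => (j.coords (γ t)).1, by fun_prop⟩
  let v : C(unitInterval, ℝ) := ⟨fun t => (j.coords (γ t)).2, by fun_prop⟩
  have hγuv : ∀ t, γ t = j (u t, v t) := fun t => (j.apply_coords (hr t)).symm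
  obtain ⟨x, hx⟩ := Circle.exp_surjective (u 0)
  obtain ⟨θ, hθ, -⟩ := Circle.isCoveringMap_exp.exists_path_lifts u x hx.symm
  have hθ' : ∀ t, Circle.exp (θ t) = u t := fun t => congr_fun hθ t
  have hγ' : γ 1 = j.invTwist (γ 0) := hγ
  rw [hγuv, hγuv, invTwist_apply, j.injective.eq_iff, Prod.mk.injEq, ← hθ', ← hθ',
    ← Circle.exp_add] at hγ'
  obtain ⟨h1, hv⟩ := hγ'
  obtain ⟨m, hm⟩ := Circle.exp_eq_exp.1 h1
  -- The lifted angle satisfies `θ 1 = θ 0 + 2π χ (v 0) + 2π m`. The path will be pushed to height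
  -- `1`, where `χ = 1` contributes one more turn.
  refine ⟨m + 1, ?_⟩
  let χ := Real.smoothTransition
  have hχ : Continuous χ := Real.smoothTransition.continuous
  let vr : unitInterval → ℝ := fun r => (1 - r) * v 0 + r
  -- Linear interpolation from `θ` to `2π (m + 1) t`, with a correction linear in `t` because `χ` is
  -- not affine along the way. It makes `A (r, 1) - A (r, 0) = 2π χ (vr r) + 2π m` for all `r`,
  -- which is the twisted condition at height `vr r`.
  let A : unitInterval × unitInterval → ℝ := fun p => (1 - p.1) * θ p.2 + p.1 * (2 * Real.pi * ((m + 1) * p.2)) +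
    p.2 * (2 * Real.pi * χ (vr p.1) - (1 - p.1) * (2 * Real.pi * χ (v 0)) - 2 * Real.pi * p.1)
  let F : C(unitInterval × unitInterval, S) := ⟨fun p => j (Circle.exp (A p), (1 - p.1) * v p.2 + p.1), by
    have : Continuous A := by fun_prop
    exact j.continuous.comp (by fun_prop)⟩
  refine .of_square F (fun t => ?_) (fun t => ?_) fun r => ?_
  · simp [F, A, vr, hγuv, hθ']
  · simp [F, A, vr, χ, Real.smoothTransition.one_of_one_le le_rfl, windingLoop_apply]
  · simp only [F, ContinuousMap.coe_mk]
    rw [invTwist_apply, ← Circle.exp_add, hv]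
    congr 2
    rw [Circle.exp_eq_exp]
    refine ⟨m, ?_⟩
    simp only [A, hm, Set.Icc.coe_one, Set.Icc.coe_zero]
    ring

lemma windingLoop_zero (t : unitInterval) : j.windingLoop 0 t = j.base := by
  rw [windingLoop_apply]; simp [base]

/-- The constant path below the curve is homotopic to the push-off through twisted paths. -/
lemma twistedHomotopic_windingLoop_one [T2Space S] :
    TwistedHomotopic j.invTwist (.const unitInterval (j (1, 0))) (j.windingLoop 1) := by
  have hχ : Continuous Real.smoothTransition := Real.smoothTransition.continuous
  refine .of_square ⟨fun p => j (Circle.exp (2 * Real.pi * (p.2 * Real.smoothTransition p.1)), p.1),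
    j.continuous.comp (by fun_prop)⟩ (fun t => ?_) (fun t => ?_) fun r => ?_
  · simp [Real.smoothTransition.zero_of_nonpos le_rfl]
  · simp [windingLoop_apply, Real.smoothTransition.one_of_one_le le_rfl]
  · simp [invTwist_apply]

lemma invTwist_fix [T2Space S] {v : ℝ} (hv : v = 0 ∨ v = 1) :
    j.invTwist (j (1, v)) = j (1, v) := by
  rcases hv with rfl | rfl
  · simp [invTwist_apply, Real.smoothTransition.zero_of_nonpos le_rfl]
  · simp [invTwist_apply, Real.smoothTransition.one_of_one_le le_rfl]

/-- The classes with exponent `0` or `1` are those of constant paths. -/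
theorem exists_isTwistedConj_iff [T2Space S] (p : Path j.base j.base) :
    (∃ m : ℤ, (m = 0 ∨ m = 1) ∧ j.IsTwistedConj m (loopClass p)) ↔
      ∃ v : ℝ, (v = 0 ∨ v = 1) ∧ TwistedHomotopic j.invTwist p (.const unitInterval (j (1, v))) := by
  have h0 : (j.windingLoop 0 : C(unitInterval, S)) = .const unitInterval (j (1, 1)) := by
    ext t; exact j.windingLoop_zero t
  simp only [isTwistedConj_loopClass_iff]
  constructor
  · rintro ⟨m, rfl | rfl, h⟩
    · exact ⟨1, .inr rfl, by rwa [h0] at h⟩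
    · exact ⟨0, .inl rfl, h.trans j.twistedHomotopic_windingLoop_one.symm⟩
  · rintro ⟨v, rfl | rfl, h⟩
    · exact ⟨1, .inr rfl, h.trans j.twistedHomotopic_windingLoop_one⟩
    · exact ⟨0, .inl rfl, by rwa [h0]⟩

/-! ### From sections over the disk to twisted homotopies -/

lemma exp_mem_closedBall {w : ℂ} (hw : w.re ≤ 0) : Complex.exp w ∈ Metric.closedBall (0 : ℂ) 1 := by
  rw [mem_closedBall_zero_iff, Complex.norm_exp]
  exact Real.exp_le_one_iff.2 hw

/-- The transport to the fibre over `1` of a section over the disk, in logarithmic coordinates. -/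
def diskLift (σ : j.ContSection (Metric.closedBall 0 1)) (w : {w : ℂ // w.re ≤ 0}) : S :=
  j.untransport w (σ ⟨Complex.exp w, exp_mem_closedBall w.2⟩)

lemma continuous_diskLift [T2Space S] (σ : j.ContSection (Metric.closedBall 0 1)) :
    Continuous (j.diskLift σ) := by
  refine j.continuous_untransport_comp (by fun_prop) (σ.continuous_toFun.comp ?_) fun w => ?_
  · exact Continuous.subtype_mk (by fun_prop) _
  · exact σ.proj_toFun _

/-- The point with logarithmic coordinates `-L + 2 π i t`. -/
def logPoint (L : ℝ) (hL : 0 ≤ L) (t : ℝ) : {w : ℂ // w.re ≤ 0} :=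
  ⟨-L + 2 * Real.pi * t * Complex.I, by simpa using hL⟩

lemma diskLift_twisted [T2Space S] (σ : j.ContSection (Metric.closedBall 0 1)) (L : ℝ)
    (hL : 0 ≤ L) :
    j.diskLift σ (logPoint L hL 1) = j.invTwist (j.diskLift σ (logPoint L hL 0)) := by
  have e : (logPoint L hL 1 : ℂ) = logPoint L hL 0 + 2 * Real.pi * Complex.I := by
    simp [logPoint]
  have hs : σ ⟨Complex.exp (logPoint L hL 1), exp_mem_closedBall (logPoint L hL 1).2⟩ =
      σ ⟨Complex.exp (logPoint L hL 0), exp_mem_closedBall (logPoint L hL 0).2⟩ := by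
    congr 2
    rw [e]
    exact Complex.exp_periodic _
  rw [diskLift, hs, e, j.untransport_add_two_pi (σ.proj_toFun _)]
  rfl

/-- The transport of the restriction of a section to the circle of radius `exp (-L)`. -/
def ringPath [T2Space S] (σ : j.ContSection (Metric.closedBall 0 1)) (L : ℝ) (hL : 0 ≤ L) :
    C(unitInterval, S) where
  toFun t := j.diskLift σ (logPoint L hL t)
  continuous_toFun := (j.continuous_diskLift σ).comp (Continuous.subtype_mk (by fun_prop) _)

lemma ringPath_isTwisted [T2Space S] (σ : j.ContSection (Metric.closedBall 0 1)) (L : ℝ)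
    (hL : 0 ≤ L) : IsTwistedPath j.invTwist (j.ringPath σ L hL) := by
  simpa [IsTwistedPath, ringPath] using j.diskLift_twisted σ L hL

/-- Shrinking the radius from `1` to `exp (-L)` is the homotopy, and the restriction to each
intermediate circle is a twisted path. -/
lemma fiberLoop_twistedHomotopic_ringPath [T2Space S] {s : j.ContSection (Metric.sphere 0 1)}
    (hs : s ⟨1, by simp⟩ = j.fiberIncl j.base) {σ : j.ContSection (Metric.closedBall 0 1)}
    (hσ : σ.Extends s) (L : ℝ) (hL : 0 ≤ L) :
    TwistedHomotopic j.invTwist (j.fiberLoop s hs) (j.ringPath σ L hL) := by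
  have hrL : ∀ r : unitInterval, 0 ≤ r * L := fun r => mul_nonneg r.2.1 hL
  refine .of_square ⟨fun p => j.diskLift σ (logPoint (p.1 * L) (hrL p.1) p.2),
    (j.continuous_diskLift σ).comp (Continuous.subtype_mk (by fun_prop) _)⟩
    (fun t => ?_) (fun t => ?_) fun r => ?_
  · change j.diskLift σ _ = j.circleLift s (2 * Real.pi * t)
    rw [diskLift, circleLift, ← hσ]
    have : (logPoint ((0 : unitInterval) * L) (hrL 0) t : ℂ) = ((2 * Real.pi * t : ℝ) : ℂ) * Complex.I := by
      simp [logPoint]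
    simp only [this]
  · simp [ringPath]
  · simpa using j.diskLift_twisted σ (r * L) (hrL r)

lemma eventually_atTop_exp_mem {P : Metric.closedBall (0 : ℂ) 1 → Prop}
    (hP : ∀ᶠ z in 𝓝 ⟨0, by simp⟩, P z) :
    ∃ L : ℝ, 0 ≤ L ∧ ∀ z : Metric.closedBall (0 : ℂ) 1, ‖(z : ℂ)‖ ≤ Real.exp (-L) → P z := by
  obtain ⟨ε, hε, h⟩ := Metric.eventually_nhds_iff.1 hP
  -- This choice gives `exp (-L) ≤ ε / e < ε`.
  refine ⟨max 0 (1 - Real.log ε), le_max_left _ _, fun z hz => h ?_⟩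
  rw [Subtype.dist_eq, dist_zero_right]
  refine hz.trans_lt ?_
  calc Real.exp (-max 0 (1 - Real.log ε)) ≤ Real.exp (Real.log ε - 1) :=
        Real.exp_le_exp.2 (by linarith [le_max_right 0 (1 - Real.log ε)])
    _ < Real.exp (Real.log ε) := Real.exp_lt_exp.2 (by linarith)
    _ = ε := Real.exp_log hε

/-- By continuity the section stays in the local model near `0`, so on a small circle its transport
runs inside the annulus, where twisted paths are winding loops. -/
theorem exists_winding_of_section [T2Space S] {s : j.ContSection (Metric.sphere 0 1)}
    (hs : s ⟨1, by simp⟩ = j.fiberIncl j.base) {σ : j.ContSection (Metric.closedBall 0 1)}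
    (hσ : σ.Extends s) (h0 : σ ⟨0, by simp⟩ = j.crit) :
    ∃ m : ℤ, TwistedHomotopic j.invTwist (j.fiberLoop s hs) (j.windingLoop m) := by
  have hev : ∀ᶠ z in 𝓝 (⟨0, by simp⟩ : Metric.closedBall (0 : ℂ) 1), σ z ∈ Set.range j.inModel :=
    (j.inModel_isOpenEmbedding.isOpen_range.preimage σ.continuous_toFun).mem_nhds
      ⟨(0, 0), h0.symm⟩
  obtain ⟨L, hL, h⟩ := eventually_atTop_exp_mem hev
  obtain ⟨m, hm⟩ := j.exists_twistedHomotopic_windingLoop (j.ringPath_isTwisted σ L hL) fun t => by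
    have h1 := h ⟨Complex.exp (logPoint L hL t), exp_mem_closedBall (logPoint L hL t).2⟩ (by
      rw [Complex.norm_exp]; simp [logPoint])
    obtain ⟨x, hx⟩ := h1
    have h2 := σ.proj_toFun ⟨Complex.exp (logPoint L hL t), exp_mem_closedBall (logPoint L hL t).2⟩
    change j.diskLift σ _ ∈ _
    rw [diskLift, ← hx, j.untransport_inModel]
    · exact ⟨_, rfl⟩
    · rw [← j.proj_inModel, hx, h2]
  exact ⟨m, (j.fiberLoop_twistedHomotopic_ringPath hs hσ L hL).trans hm⟩

/-- Above the curve the angles `2π (χ - 1)` and `2π χ` differ by a full turn. Hence a horizontal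
loop, sheared along one circuit, is a twisted path. -/
lemma shear_two_pi [T2Space S] (x : S) : j.shear (2 * Real.pi) x = j.invTwist x := by
  by_cases hx : x ∈ Set.range j
  · obtain ⟨⟨u, v⟩, rfl⟩ := hx
    rw [shear, rotate_apply, invTwist_apply, slope]
    congr 3
    split_ifs
    · rw [mul_sub, mul_one, Circle.exp_sub, Circle.exp_two_pi, div_one]
    · rfl
  · rw [shear, rotate_of_notMem j _ hx]
    exact (rotate_of_notMem j (fun v => -(2 * Real.pi * (-1 : ℤ) * Real.smoothTransition v)) hx).symm

lemma shear_zero (x : S) : j.shear 0 x = x := by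
  simp [shear, rotate_zero]

/-- Every point off the curve can be joined off the curve to one of its two sides. -/
lemma joinedIn_compl_cycle [T2Space S] [ConnectedSpace S] {x : S} (hx : x ∈ j.cycleᶜ) :
    ∃ v : ℝ, (v = 0 ∨ v = 1) ∧ JoinedIn j.cycleᶜ x (j (1, v)) := by
  have : LocallyPathConnectedSpace S :=
    ChartedSpace.locallyPathConnectedSpace (EuclideanSpace ℝ (Fin 2)) S
  have ho : IsOpen j.cycleᶜ := j.isClosed_cycle.isOpen_compl
  have hconn : ∀ (K : Set ℝ), Convex ℝ K → (1 / 2 : ℝ) ∉ K → ∀ (u : Circle) (v v' : ℝ), v ∈ K →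
      v' ∈ K → JoinedIn j.cycleᶜ (j (u, v)) (j (1, v')) := by
    intro K hK hK' u v v' hv hv'
    have hpc : IsPathConnected ((Set.univ : Set ℝ) ×ˢ K) :=
      (convex_univ.prod hK).isPathConnected ⟨(0, v), by simpa using hv⟩
    have hf : Continuous fun p : ℝ × ℝ => j (Circle.exp p.1, p.2) := j.continuous.comp (by fun_prop)
    obtain ⟨θ, hθ⟩ := Circle.exp_surjective u
    refine ((hpc.image hf).joinedIn _ ⟨(θ, v), ⟨trivial, hv⟩, by simp only [hθ]⟩ _
      ⟨(0, v'), ⟨trivial, hv'⟩, by simp only [Circle.exp_zero]⟩).mono ?_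
    rintro _ ⟨⟨θ', t⟩, ⟨-, ht⟩, rfl⟩
    rw [Set.mem_compl_iff, apply_mem_cycle_iff]
    rintro rfl
    exact hK' ht
  let A : Set S := {x | ∃ v : ℝ, (v = 0 ∨ v = 1) ∧ JoinedIn j.cycleᶜ x (j (1, v))}
  have hrange : Set.range j ⊆ A ∪ j.cycle := by
    rintro _ ⟨⟨u, v⟩, rfl⟩
    rcases lt_trichotomy v (1 / 2) with h | h | h
    · exact .inl ⟨0, .inl rfl, hconn (Set.Iio (1 / 2)) (convex_Iio _) (by simp) u v 0 h (by simp)⟩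
    · exact .inr ((j.apply_mem_cycle_iff _).2 h)
    · exact .inl ⟨1, .inr rfl, hconn (Set.Ioi (1 / 2)) (convex_Ioi _) (by simp) u v 1 h
        (by norm_num)⟩
  -- The points that can be joined to a side, together with the curve, form an open set because the
  -- annulus is a neighbourhood of the curve contained in it. The complement is open by local path
  -- connectedness. Connectedness of `S` then finishes.
  have hclopen : IsClopen (A ∪ j.cycle) := by
    constructor
    · rw [← isOpen_compl_iff, isOpen_iff_mem_nhds]
      intro y hy
      have hyc : y ∈ j.cycleᶜ := fun h => hy (.inr h)
      filter_upwards [pathComponentIn_mem_nhds (ho.mem_nhds hyc)] with z hz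
      rintro (⟨v, hv, h⟩ | h)
      · exact hy (.inl ⟨v, hv, hz.trans h⟩)
      · exact (pathComponentIn_subset hz) h
    · rw [isOpen_iff_mem_nhds]
      rintro y (⟨v, hv, h⟩ | h)
      · filter_upwards [pathComponentIn_mem_nhds (ho.mem_nhds h.source_mem)] with z hz
        exact .inl ⟨v, hv, hz.symm.trans h⟩
      · exact Filter.mem_of_superset (j.isOpenEmbedding.isOpen_range.mem_nhds
          (Set.image_subset_range _ _ h)) hrange
  have huniv := hclopen.eq_univ ⟨j (1, 1), hrange ⟨_, rfl⟩⟩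
  rcases (huniv ▸ Set.mem_univ x : x ∈ A ∪ j.cycle) with h | h
  · exact h
  · exact absurd h hx

/-- The singular fibre `a b = 0` is a pair of lines and meets the thimble family `|a| = |b|` only at
the origin. So the singular fibre minus the critical point lies in the trivial part. -/
lemma height_ne_zero_of_q_eq_zero {x : ℂ × ℂ} (hx : x ≠ (0, 0)) (hq : q x = 0) : height x ≠ 0 := by
  intro hh
  rw [q_eq, mul_eq_zero] at hq
  rw [height, sub_eq_zero] at hh
  have ha : a x = 0 := by
    rcases hq with h | h
    · exact h
    · rw [h, norm_zero] at hh
      simpa using hh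
  have hb : b x = 0 := by
    rw [ha, norm_zero] at hh
    simpa using hh.symm
  exact hx (ext_ab (by rw [ha]; simp [a]) (by rw [hb]; simp [b]))

lemma exists_inTrivial_of_ne_crit {e : j.Total} (he : j.proj e = 0) (hc : e ≠ j.crit) :
    ∃ x : (j.cycleᶜ : Set S), e = j.inTrivial (0, x) := by
  rcases j.exists_rep e with ⟨x, rfl⟩ | ⟨w, rfl⟩
  · have hx : x ≠ (0, 0) := fun h => hc (by rw [h]; rfl)
    have hh := height_ne_zero_of_q_eq_zero hx he
    exact ⟨_, by rw [j.inModel_eq_inTrivial hh]; rw [← j.proj_inModel, he]⟩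
  · exact ⟨w.2, by rw [← he]; rfl⟩

/-- Near `0` the section is a map to `S ∖ V` over a disk, hence contractible to its value at `0`.
That value is then moved off `V` to a side, where the shear acts trivially. -/
theorem exists_const_of_section [T2Space S] [ConnectedSpace S]
    {s : j.ContSection (Metric.sphere 0 1)}
    (hs : s ⟨1, by simp⟩ = j.fiberIncl j.base) {σ : j.ContSection (Metric.closedBall 0 1)}
    (hσ : σ.Extends s) (h0 : σ ⟨0, by simp⟩ ≠ j.crit) :
    ∃ v : ℝ, (v = 0 ∨ v = 1) ∧
      TwistedHomotopic j.invTwist (j.fiberLoop s hs) (.const unitInterval (j (1, v))) := by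
  obtain ⟨x₀, hx₀⟩ := j.exists_inTrivial_of_ne_crit (σ.proj_toFun _) h0
  have hev : ∀ᶠ z in 𝓝 (⟨0, by simp⟩ : Metric.closedBall (0 : ℂ) 1), σ z ∈ Set.range j.inTrivial :=
    (j.inTrivial_isOpenEmbedding.isOpen_range.preimage σ.continuous_toFun).mem_nhds
      ⟨_, hx₀.symm⟩
  obtain ⟨L, hL, h⟩ := eventually_atTop_exp_mem hev
  have hnorm : ∀ r t : unitInterval, ‖(1 - r : ℂ) * Complex.exp (logPoint L hL t)‖ ≤ Real.exp (-L) := by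
    intro r t
    rw [norm_mul, Complex.norm_exp]
    have h1 : ‖(1 - r : ℂ)‖ ≤ 1 := by
      rw [← Complex.ofReal_one, ← Complex.ofReal_sub, Complex.norm_real, Real.norm_of_nonneg]
      · linarith [r.2.1]
      · linarith [r.2.2]
    have h2 : (logPoint L hL t : ℂ).re = -L := by simp [logPoint]
    rw [h2]
    exact mul_le_of_le_one_left (Real.exp_nonneg _) h1
  -- The circle of radius `exp (-L)` is contracted radially to `0`; `y` below is the component of
  -- the section in `S ∖ V`.
  let Z : unitInterval × unitInterval → Metric.closedBall (0 : ℂ) 1 := fun p =>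
    ⟨(1 - p.1 : ℂ) * Complex.exp (logPoint L hL p.2), by
      rw [mem_closedBall_zero_iff]
      exact (hnorm p.1 p.2).trans (Real.exp_le_one_iff.2 (by linarith))⟩
  have hZc : Continuous Z := by
    refine Continuous.subtype_mk ?_ _
    simp only [logPoint]
    fun_prop
  have hZ : ∀ p, ∃ y : (j.cycleᶜ : Set S), σ (Z p) = j.inTrivial (Z p, y) := fun p => by
    obtain ⟨w, hw⟩ := h (Z p) (hnorm p.1 p.2)
    refine ⟨w.2, ?_⟩
    rw [← hw, ← σ.proj_toFun, ← hw]
    rfl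
  choose y hy using hZ
  have hyc : Continuous y := by
    have h1 : Continuous fun p => j.inTrivial ((Z p : ℂ), y p) := by
      simp only [← hy]
      exact σ.continuous_toFun.comp hZc
    exact continuous_snd.comp (j.inTrivial_isOpenEmbedding.isInducing.continuous_iff.2 h1)
  have hy1 : ∀ p q, Z p = Z q → y p = y q := fun p q hpq => by
    have := hy p
    rw [hpq, hy q, j.inTrivial_injective.eq_iff, Prod.mk.injEq] at this
    exact this.2.symm
  have hyx : ∀ t, y (1, t) = x₀ := fun t => by
    have e : Z (1, t) = ⟨0, by simp⟩ := Subtype.ext (by simp [Z])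
    have := hy (1, t)
    rw [e, hx₀, j.inTrivial_injective.eq_iff, Prod.mk.injEq] at this
    exact this.2.symm
  have hshear : ∀ f : unitInterval × unitInterval → (j.cycleᶜ : Set S), Continuous f →
      Continuous fun p : unitInterval × unitInterval => j.shear (2 * Real.pi * p.2) (f p) := by
    intro f hf
    rw [continuous_iff_continuousAt]
    intro p
    exact ContinuousAt.comp (x := p) (f := fun p : unitInterval × unitInterval => (2 * Real.pi * (p.2 : ℝ), (f p : S)))
      (g := fun p : ℝ × S => j.shear p.1 p.2) (j.continuousAt_shear _ (f p).2)
      (by fun_prop)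
  obtain ⟨v, hv, hjoin⟩ := j.joinedIn_compl_cycle x₀.2
  refine ⟨v, hv, (j.fiberLoop_twistedHomotopic_ringPath hs hσ L hL).trans ?_⟩
  -- In transported coordinates the path at stage `r` is the shear by `2π t` of `y (r, t)`. It is
  -- twisted since `y` closes up in `t` and a shear by `2π` is the inverse twist.
  have hring : TwistedHomotopic j.invTwist (j.ringPath σ L hL)
      ⟨fun t => j.shear (2 * Real.pi * t) x₀,
        (hshear (fun _ => x₀) continuous_const).comp (f := fun t : unitInterval => ((0 : unitInterval), t))
          (by fun_prop)⟩ := by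
    refine .of_square ⟨_, hshear y hyc⟩ (fun t => ?_) (fun t => ?_) fun r => ?_
    · have e : Z (0, t) = ⟨Complex.exp (logPoint L hL t), exp_mem_closedBall (logPoint L hL t).2⟩ :=
        Subtype.ext (by simp [Z])
      change _ = j.diskLift σ (logPoint L hL t)
      rw [diskLift, ← e, hy, j.untransport_inTrivial]
      simp [logPoint]
    · change j.shear _ _ = j.shear _ _
      rw [hyx]
    · have e : Z (r, 1) = Z (r, 0) := by
        refine Subtype.ext ?_
        simp only [Z, logPoint]
        congr 1
        simp [Complex.exp_add, Complex.exp_two_pi_mul_I]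
      have := hy1 _ _ e
      simp [this, shear_two_pi, shear_zero]
  refine hring.trans ?_
  -- The horizontal path of `x₀` is slid along `δ`; at its end `slope` vanishes and the path is
  -- constant.
  let δ : unitInterval → (j.cycleᶜ : Set S) := fun r => ⟨hjoin.somePath r, hjoin.somePath_mem r⟩
  have hδ : Continuous δ := hjoin.somePath.continuous.subtype_mk _
  refine TwistedHomotopic.of_square ⟨_, hshear (fun p => δ p.1) (hδ.comp continuous_fst)⟩ (fun t => ?_)
    (fun t => ?_) fun r => ?_
  · simp [δ]
  · have : slope v = 0 := by
      rcases hv with rfl | rfl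
      · exact slope_of_nonpos le_rfl
      · exact slope_of_one_le le_rfl
    simp [δ, j.shear_apply_of_slope this]
  · simp [shear_two_pi, shear_zero]

end AnnularCurve

/-- Equivariant maps of the line that agree on a fundamental domain are equal. -/
lemma eq_of_equivariant {X : Type*} [TopologicalSpace X] (τ : X ≃ₜ X) {T : ℝ} {f g : ℝ → X}
    (hf : ∀ t, f (t + T) = τ (f t)) (hg : ∀ t, g (t + T) = τ (g t)) (hT : 0 < T)
    (h : ∀ t : unitInterval, f (T * t) = g (T * t)) : f = g := by
  have key : ∀ (n : ℤ) (t : ℝ), f t = g t → f (t + n * T) = g (t + n * T) := by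
    intro n
    induction n using Int.induction_on with
    | zero => intro t ht; simpa using ht
    | succ n ih =>
      intro t ht
      push_cast at ih ⊢
      rw [add_mul, one_mul, ← add_assoc, hf, hg, ih t ht]
    | pred n ih =>
      intro t ht
      push_cast at ih ⊢
      apply τ.injective
      rw [← hf, ← hg, show t + (-n - 1) * T + T = t + -n * T by ring]
      exact ih t ht
  funext t
  have h1 := h ⟨Int.fract (t / T), Int.fract_nonneg _, (Int.fract_lt_one _).le⟩
  have h2 := key ⌊t / T⌋ _ h1
  have e : T * Int.fract (t / T) + ⌊t / T⌋ * T = t := by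
    rw [Int.fract]; field_simp; ring
  rwa [e] at h2

namespace AnnularCurve

open QuadraticModel

variable {S : Type*} [TopologicalSpace S] [ChartedSpace (EuclideanSpace ℝ (Fin 2)) S]
variable (j : AnnularCurve S)

/-! ### From twisted homotopies to sections over the disk -/

/-- A twisted homotopy that starts at the transport of a section over the circle gives an
equivariant map of the plane. -/
theorem exists_equivariant_lift [T2Space S] {s : j.ContSection (Metric.sphere 0 1)}
    {hs : s ⟨1, by simp⟩ = j.fiberIncl j.base} {γ : C(unitInterval, S)}
    (h : TwistedHomotopic j.invTwist (j.fiberLoop s hs) γ) {g : ℝ → S}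
    (hg : ∀ θ, g (θ + 2 * Real.pi) = j.dehnTwist.symm (g θ))
    (hγ : ∀ t, γ t = g (2 * Real.pi * t)) :
    ∃ C : ℂ → S, Continuous C ∧
      (∀ w, C (w + 2 * Real.pi * Complex.I) = j.dehnTwist.symm (C w)) ∧
      (∀ w : ℂ, -1 ≤ w.re → C w = j.circleLift s w.im) ∧
      ∀ w : ℂ, w.re ≤ -2 → C w = g w.im := by
  obtain ⟨F, h0, h1, hF⟩ := h.exists_square
  obtain ⟨C, hC, hCτ, hCF⟩ := exists_equivariant_extension j.dehnTwist.symm F hF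
  have hpi : 2 * Real.pi ≠ 0 := by positivity
  have hCτ' : ∀ r θ : ℝ, C (r, (θ + 2 * Real.pi) / (2 * Real.pi)) =
      j.dehnTwist.symm (C (r, θ / (2 * Real.pi))) := fun r θ => by
    rw [add_div, div_self hpi, hCτ]
  -- The homotopy is run while the real part falls from `-1` to `-2`. The collars on both sides
  -- leave room for gluing and smoothing without touching the boundary values.
  refine ⟨fun w => C (-w.re - 1, w.im / (2 * Real.pi)), by fun_prop, fun w => ?_, fun w hw => ?_,
    fun w hw => ?_⟩
  · simpa using hCτ' (-w.re - 1) w.im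
  · refine congr_fun (eq_of_equivariant j.dehnTwist.symm (f := fun θ => C (-w.re - 1,
      θ / (2 * Real.pi))) (hCτ' _) (j.circleLift_add_two_pi s) (by positivity) fun t => ?_) w.im
    rw [mul_div_cancel_left₀ _ hpi, hCF, Set.projIcc_of_le_left _ (by linarith)]
    exact h0 t
  · refine congr_fun (eq_of_equivariant j.dehnTwist.symm (f := fun θ => C (-w.re - 1,
      θ / (2 * Real.pi))) (hCτ' _) hg (by positivity) fun t => ?_) w.im
    rw [mul_div_cancel_left₀ _ hpi, hCF, Set.projIcc_of_right_le _ (by linarith), ← hγ]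
    exact h1 t

/-- A local branch of the logarithm at a nonzero point. -/
def logNear (z₀ z : ℂ) : ℂ := Complex.log (z / z₀) + Complex.log z₀

lemma exp_logNear {z₀ z : ℂ} (h₀ : z₀ ≠ 0) (h : z ≠ 0) : Complex.exp (logNear z₀ z) = z := by
  rw [logNear, Complex.exp_add, Complex.exp_log (div_ne_zero h h₀), Complex.exp_log h₀,
    div_mul_cancel₀ _ h₀]

/-- Dividing by `z₀` moves the argument of the logarithm to `1`, away from the branch cut. -/
lemma contDiffAt_logNear {z₀ : ℂ} (h₀ : z₀ ≠ 0) : ContDiffAt ℝ ∞ (logNear z₀) z₀ := by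
  have h1 : ContDiffAt ℂ ∞ (fun z => Complex.log (z / z₀)) z₀ := by
    refine ContDiffAt.comp z₀ (Complex.contDiffAt_log ?_) (contDiffAt_id.div_const z₀)
    simp [div_self h₀]
  exact (h1.restrict_scalars ℝ).add contDiffAt_const

/-- Two logarithms of the same number have the same image under an equivariant map. -/
lemma transport_equivariant [T2Space S] {C : ℂ → S}
    (hC : ∀ w, C (w + 2 * Real.pi * Complex.I) = j.dehnTwist.symm (C w)) {w w' : ℂ}
    (h : Complex.exp w = Complex.exp w') : j.transport w (C w) = j.transport w' (C w') := by
  have h1 : ∀ w, j.transport (w + 2 * Real.pi * Complex.I) (C (w + 2 * Real.pi * Complex.I)) =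
      j.transport w (C w) := fun w => by rw [hC, j.transport_add_two_pi]
  have key : ∀ (n : ℤ) (w : ℂ), j.transport (w + n * (2 * Real.pi * Complex.I))
      (C (w + n * (2 * Real.pi * Complex.I))) = j.transport w (C w) := by
    intro n
    induction n using Int.induction_on with
    | zero => intro w; simp
    | succ n ih =>
      intro w
      rw [← ih w, ← h1 (w + (n : ℤ) * _)]
      push_cast
      ring_nf
    | pred n ih =>
      intro w
      rw [← ih w, ← h1]
      push_cast
      ring_nf
  obtain ⟨n, hn⟩ := Complex.exp_eq_exp_iff_exists_int.1 h
  rw [hn, key]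

/-- An equivariant map of the plane with a limit at `-∞` gives a section over the plane. -/
theorem exists_section_of_lift [T2Space S] {C : ℂ → S} (hC : Continuous C)
    (hCτ : ∀ w, C (w + 2 * Real.pi * Complex.I) = j.dehnTwist.symm (C w)) {e : j.Total}
    (he : j.proj e = 0) (hlim : Filter.Tendsto (fun w => j.transport w (C w))
      (Filter.comap Complex.re Filter.atBot) (𝓝 e)) :
    ∃ f : ℂ → j.Total, Continuous f ∧ (∀ z, j.proj (f z) = z) ∧ f 0 = e ∧
      ∀ w, f (Complex.exp w) = j.transport w (C w) := by
  -- The principal logarithm is only a representative: by equivariance any other logarithm gives the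
  -- same point, so there is no jump at the branch cut.
  let f : ℂ → j.Total := fun z =>
    if z = 0 then e else j.transport (Complex.log z) (C (Complex.log z))
  have hf0 : f 0 = e := if_pos rfl
  have hf : ∀ w, f (Complex.exp w) = j.transport w (C w) := fun w => by
    simp only [f, if_neg (Complex.exp_ne_zero w)]
    exact j.transport_equivariant hCτ (Complex.exp_log (Complex.exp_ne_zero w))
  refine ⟨f, ?_, fun z => ?_, hf0, hf⟩
  · rw [continuous_iff_continuousAt]
    intro z₀
    by_cases hz : z₀ = 0
    · subst hz
      -- Punctured neighbourhoods of `0` are the images under `exp` of the half planes far to the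
      -- left, which turns continuity at `0` into the limit hypothesis.
      rw [continuousAt_iff_punctured_nhds, hf0, ← Complex.map_exp_comap_re_atBot,
        Filter.tendsto_map'_iff]
      exact hlim.congr fun w => (hf w).symm
    · have h1 : ContinuousAt (fun z => j.transport (logNear z₀ z) (C (logNear z₀ z))) z₀ := by
        have hl := (contDiffAt_logNear hz).continuousAt
        have hCl : ContinuousAt (fun z => C (logNear z₀ z)) z₀ := hC.continuousAt.comp hl
        exact ContinuousAt.comp (x := z₀) (f := fun z => (logNear z₀ z, C (logNear z₀ z)))
          (g := fun p : ℂ × S => j.transport p.1 p.2) j.continuous_transport.continuousAt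
          (hl.prodMk hCl)
      refine h1.congr ?_
      filter_upwards [isOpen_ne.mem_nhds hz] with z hz'
      rw [← hf, exp_logNear hz hz']
  · by_cases hz : z = 0
    · rw [hz, hf0, he]
    · rw [← Complex.exp_log hz, hf, proj_transport]

variable {j} in
/-- The section over a subset of the plane given by a section over the plane. -/
def ContSection.ofGlobal {f : ℂ → j.Total} (hf : Continuous f) (hp : ∀ z, j.proj (f z) = z)
    (A : Set ℂ) : j.ContSection A where
  toFun z := f z
  continuous_toFun := hf.comp continuous_subtype_val
  proj_toFun z := hp z

lemma extends_ofGlobal {s : j.ContSection (Metric.sphere 0 1)} {C : ℂ → S}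
    (hCs : ∀ w : ℂ, w.re = 0 → C w = j.circleLift s w.im) {f : ℂ → j.Total} (hf : Continuous f)
    (hp : ∀ z, j.proj (f z) = z) (hfC : ∀ w, f (Complex.exp w) = j.transport w (C w)) :
    (ContSection.ofGlobal hf hp (Metric.closedBall 0 1)).Extends s := by
  rintro ⟨z, hz⟩
  have hz1 : ‖z‖ = 1 := mem_sphere_zero_iff_norm.1 hz
  have e : z = Complex.exp (z.arg * Complex.I) := by
    have := Complex.norm_mul_exp_arg_mul_I z
    rw [hz1, Complex.ofReal_one, one_mul] at this
    exact this.symm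
  have hs : s ⟨z, hz⟩ = s ⟨Complex.exp (z.arg * Complex.I), exp_mul_I_mem _⟩ := by
    congr 2
  change f z = s ⟨z, hz⟩
  rw [hs]
  conv_lhs => rw [e]
  rw [hfC, hCs _ (by simp), circleLift]
  have him : ((z.arg : ℂ) * Complex.I).im = z.arg := by simp
  rw [him, j.transport_untransport (s.proj_toFun _)]

lemma inTrivial_ne_crit (w : ℂ × (j.cycleᶜ : Set S)) : j.inTrivial w ≠ j.crit := fun h =>
  (j.inModel_eq_inTrivial_iff.1 h.symm).1 (by simp [height, a, b])

lemma apply_sides_mem_compl {v : ℝ} (hv : v = 0 ∨ v = 1) : j (1, v) ∈ j.cycleᶜ := by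
  rw [Set.mem_compl_iff, apply_mem_cycle_iff]
  rcases hv with rfl | rfl <;> norm_num

lemma slope_sides {v : ℝ} (hv : v = 0 ∨ v = 1) : slope v = 0 := by
  rcases hv with rfl | rfl
  · exact slope_of_nonpos le_rfl
  · exact slope_of_one_le le_rfl

lemma transport_sides {v : ℝ} (hv : v = 0 ∨ v = 1) (w : ℂ) :
    j.transport w (j (1, v)) =
      j.inTrivial (Complex.exp w, ⟨j (1, v), j.apply_sides_mem_compl hv⟩) := by
  rw [transport_of_mem j w (j.apply_sides_mem_compl hv)]
  congr 3
  exact j.shear_apply_of_slope (slope_sides hv) _ _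

/-- An equivariant map that is constant near `-∞` with value on one of the sides of the curve
gives a section over the plane that is horizontal near `0`. -/
theorem exists_section_of_lift_const [T2Space S] {C : ℂ → S} (hC : Continuous C)
    (hCτ : ∀ w, C (w + 2 * Real.pi * Complex.I) = j.dehnTwist.symm (C w)) {v R : ℝ}
    (hv : v = 0 ∨ v = 1) (hR : ∀ w : ℂ, w.re ≤ R → C w = j (1, v)) :
    ∃ f : ℂ → j.Total, Continuous f ∧ (∀ z, j.proj (f z) = z) ∧
      f 0 = j.inTrivial (0, ⟨j (1, v), j.apply_sides_mem_compl hv⟩) ∧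
      ∀ w, f (Complex.exp w) = j.transport w (C w) := by
  refine j.exists_section_of_lift hC hCτ rfl ?_
  have h1 : Filter.Tendsto (fun w => j.inTrivial (Complex.exp w,
      ⟨j (1, v), j.apply_sides_mem_compl hv⟩)) (Filter.comap Complex.re Filter.atBot)
      (𝓝 (j.inTrivial (0, ⟨j (1, v), j.apply_sides_mem_compl hv⟩))) := by
    have hc : Continuous fun z : ℂ => j.inTrivial (z, ⟨j (1, v), j.apply_sides_mem_compl hv⟩) :=
      j.continuous_inTrivial.comp (by fun_prop)
    exact (hc.tendsto 0).comp Complex.tendsto_exp_comap_re_atBot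
  refine h1.congr' ?_
  filter_upwards [Filter.preimage_mem_comap (Filter.Iic_mem_atBot R)] with w hw
  rw [hR w hw, j.transport_sides hv]

/-- Only moduli matter: `|a|` is `modulus ‖z‖ h` and `|b|² = |a|² - h`, so both vanish in the limit.
No control of the angle `u` is needed, and this is why every winding number can be capped off at the
critical point. -/
lemma tendsto_pointA_zero {ι : Type*} {l : Filter ι} {z : ι → ℂ} {u : ι → Circle} {h : ι → ℝ}
    (hz0 : ∀ i, z i ≠ 0) (hz : Filter.Tendsto z l (𝓝 0)) (hh : Filter.Tendsto h l (𝓝 0)) :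
    Filter.Tendsto (fun i => pointA (z i) (u i) (h i)) l (𝓝 (0, 0)) := by
  have hm : Filter.Tendsto (fun i => modulus ‖z i‖ (h i)) l (𝓝 0) := by
    have h1 : Filter.Tendsto (fun i => (‖z i‖, h i)) l (𝓝 (0, 0)) := by
      have := hz.norm
      rw [norm_zero] at this
      exact this.prodMk_nhds hh
    have := (continuous_modulus.tendsto (0, 0)).comp h1
    simpa [modulus, Function.comp_def] using this
  have hna : ∀ i, ‖a (pointA (z i) (u i) (h i))‖ = modulus ‖z i‖ (h i) := fun i => by
    rw [pointA, a_ofAB, norm_mul, Circle.norm_coe, mul_one, Complex.norm_real,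
      Real.norm_of_nonneg (modulus_norm_pos (.inl (hz0 i))).le]
  have ha : Filter.Tendsto (fun i => a (pointA (z i) (u i) (h i))) l (𝓝 0) := by
    rw [tendsto_zero_iff_norm_tendsto_zero]
    simpa only [hna] using hm
  have hb : Filter.Tendsto (fun i => b (pointA (z i) (u i) (h i))) l (𝓝 0) := by
    rw [tendsto_zero_iff_norm_tendsto_zero]
    have h2 : ∀ i, ‖b (pointA (z i) (u i) (h i))‖ = Real.sqrt (modulus ‖z i‖ (h i) ^ 2 - h i) := by
      intro i
      have := height_pointA (z := z i) (h := h i) (.inl (hz0 i)) (u i)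
      rw [height, hna] at this
      rw [← Real.sqrt_sq (norm_nonneg (b _))]
      congr 1
      linarith
    simp only [h2]
    have := (Real.continuous_sqrt.tendsto _).comp ((hm.pow 2).sub hh)
    simpa [Function.comp_def] using this
  have hab : Continuous fun p : ℂ × ℂ => ofAB p.1 p.2 := by unfold ofAB; fun_prop
  have := (hab.tendsto (0, 0)).comp (ha.prodMk_nhds hb)
  have e : ofAB 0 0 = (0, 0) := by simp [ofAB]
  rw [e] at this
  refine this.congr fun i => ?_
  exact ext_ab (a_ofAB _ _) (b_ofAB _ _)

/-- Inside the homotopy to the winding loop a spiral is glued in that approaches the core curve as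
the real part tends to `-∞`. -/
theorem exists_section_of_winding [T2Space S] {s : j.ContSection (Metric.sphere 0 1)}
    {hs : s ⟨1, by simp⟩ = j.fiberIncl j.base} {m : ℤ}
    (h : TwistedHomotopic j.invTwist (j.fiberLoop s hs) (j.windingLoop m)) :
    ∃ σ : j.ContSection (Metric.closedBall 0 1), σ.Extends s ∧ σ ⟨0, by simp⟩ = j.crit := by
  obtain ⟨C, hC, hCτ, hCs, hCm⟩ := j.exists_equivariant_lift h
    (g := fun θ => j (Circle.exp (m * θ), 1)) (fun θ => by
      refine Eq.trans ?_ (j.invTwist_apply _ _).symm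
      rw [Real.smoothTransition.one_of_one_le le_rfl, mul_one, Circle.exp_two_pi, mul_one, mul_add,
        Circle.exp_add, Circle.exp_intCast_mul, Circle.exp_intCast_mul, Circle.exp_two_pi,
        one_zpow, mul_one]) (fun t => by
      change j _ = j _
      congr 3
      ring)
  let χ := Real.smoothTransition
  have hχ : Continuous χ := Real.smoothTransition.continuous
  -- The height is `1` at real part `-2`, where the spiral meets the winding loop, and decreases to
  -- `1/2` at `-∞`.
  let v : ℝ → ℝ := fun x => 1 / 2 + Real.exp (x + 2) / 2
  have hv : Continuous v := by fun_prop
  -- Each turn must advance the angle by `2π χ (v)` modulo `2π`, hence the rate `χ (v)` plus an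
  -- integer. The integer `m - 1` gives rate `m` at `v = 1`.
  let B : ℂ → S := fun w => j (Circle.exp (w.im * (m - 1 + χ (v w.re))), v w.re)
  have hB : Continuous B := j.continuous.comp (by fun_prop)
  have hBτ : ∀ w, B (w + 2 * Real.pi * Complex.I) = j.dehnTwist.symm (B w) := fun w => by
    refine Eq.trans ?_ (j.invTwist_apply _ _).symm
    have e1 : (w + 2 * Real.pi * Complex.I).im = w.im + 2 * Real.pi := by simp
    have e2 : (w + 2 * Real.pi * Complex.I).re = w.re := by simp
    simp only [B, e1, e2]
    rw [← Circle.exp_add]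
    congr 2
    rw [Circle.exp_eq_exp]
    refine ⟨m - 1, ?_⟩
    push_cast
    simp only [χ]
    ring
  let C' : ℂ → S := fun w => if -2 ≤ w.re then C w else B w
  have hC' : Continuous C' := by
    refine Continuous.if_le hC hB continuous_const Complex.continuous_re fun w hw => ?_
    have hv1 : v w.re = 1 := by simp only [v]; rw [← hw]; norm_num
    rw [hCm w hw.ge]
    simp only [B, hv1, χ, Real.smoothTransition.one_of_one_le le_rfl]
    congr 3
    ring
  have hC'τ : ∀ w, C' (w + 2 * Real.pi * Complex.I) = j.dehnTwist.symm (C' w) := fun w => by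
    have e2 : (w + 2 * Real.pi * Complex.I).re = w.re := by simp
    simp only [C', e2]
    split_ifs
    · exact hCτ w
    · exact hBτ w
  obtain ⟨f, hf, hp, hf0, hfC⟩ := j.exists_section_of_lift hC' hC'τ (e := j.crit)
    (by simp [crit, proj_inModel, q]) (by
      have h1 : Filter.Tendsto (fun w : ℂ => j.inModel (pointA (Complex.exp w)
          (Circle.exp (w.im * (m - 1 + χ (v w.re))) * Circle.exp (w.im * (1 - χ (v w.re))))
          (v w.re - 1 / 2))) (Filter.comap Complex.re Filter.atBot) (𝓝 j.crit) := by
        refine (j.continuous_inModel.tendsto (0, 0)).comp ?_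
        refine tendsto_pointA_zero (fun w => Complex.exp_ne_zero w)
          Complex.tendsto_exp_comap_re_atBot ?_
        have h2 : Filter.Tendsto (fun x : ℝ => v x - 1 / 2) Filter.atBot (𝓝 0) := by
          simp only [v, add_sub_cancel_left]
          have h3 := Real.tendsto_exp_atBot.comp (Filter.tendsto_atBot_add_const_right _ (2 : ℝ)
            Filter.tendsto_id)
          simpa using h3.div_const 2
        exact h2.comp Filter.tendsto_comap
      refine h1.congr' ?_
      filter_upwards [Filter.preimage_mem_comap (Filter.Iio_mem_atBot (-2))] with w hw
      have hw' : ¬ -2 ≤ w.re := not_le.2 hw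
      simp only [C', if_neg hw', B]
      rw [j.transport_apply])
  refine ⟨.ofGlobal hf hp _, j.extends_ofGlobal (C := C') (fun w hw => ?_) hf hp hfC, hf0⟩
  have h2 : -2 ≤ w.re := by rw [hw]; norm_num
  simp only [C', if_pos h2]
  exact hCs w (by rw [hw]; norm_num)

/-- The lift of a section that is homotopic to a constant on one of the sides of the curve. -/
theorem exists_lift_const [T2Space S] {s : j.ContSection (Metric.sphere 0 1)}
    {hs : s ⟨1, by simp⟩ = j.fiberIncl j.base} {v : ℝ} (hv : v = 0 ∨ v = 1)
    (h : TwistedHomotopic j.invTwist (j.fiberLoop s hs) (.const _ (j (1, v)))) :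
    ∃ C : ℂ → S, Continuous C ∧
      (∀ w, C (w + 2 * Real.pi * Complex.I) = j.dehnTwist.symm (C w)) ∧
      (∀ w : ℂ, -1 ≤ w.re → C w = j.circleLift s w.im) ∧
      ∀ w : ℂ, w.re ≤ -2 → C w = j (1, v) :=
  j.exists_equivariant_lift h (g := fun _ => j (1, v)) (fun _ => (j.invTwist_fix hv).symm)
    fun _ => rfl

/-- Near `0` the section is horizontal through a point off `V`, so it extends over `0` inside the
trivial part; only the fibre over `0` could contain the critical point. -/
theorem exists_section_of_const [T2Space S] {s : j.ContSection (Metric.sphere 0 1)}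
    {hs : s ⟨1, by simp⟩ = j.fiberIncl j.base} {v : ℝ} (hv : v = 0 ∨ v = 1)
    (h : TwistedHomotopic j.invTwist (j.fiberLoop s hs) (.const _ (j (1, v)))) :
    ∃ σ : j.ContSection (Metric.closedBall 0 1), σ.Extends s ∧ ∀ z, σ z ≠ j.crit := by
  obtain ⟨C, hC, hCτ, hCs, hCv⟩ := j.exists_lift_const hv h
  obtain ⟨f, hf, hp, hf0, hfC⟩ := j.exists_section_of_lift_const hC hCτ hv hCv
  refine ⟨.ofGlobal hf hp _, j.extends_ofGlobal (fun w hw => hCs w (by rw [hw]; norm_num))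
    hf hp hfC, fun z hz => ?_⟩
  have hz' : f z = j.crit := hz
  have hz0 : (z : ℂ) = 0 := by
    rw [← hp z, hz']
    simp [crit, proj_inModel, q]
  rw [hz0, hf0] at hz'
  exact j.inTrivial_ne_crit _ hz'

end AnnularCurve

/-! ### Smoothing of continuous maps -/

section Smoothing

variable {E F M : Type*} [NormedAddCommGroup E] [NormedSpace ℝ E] [FiniteDimensional ℝ E]
  [NormedAddCommGroup F] [NormedSpace ℝ F] [TopologicalSpace M] [ChartedSpace F M]
  [IsManifold 𝓘(ℝ, F) ∞ M]

/-- A continuous map can be smoothed on a small ball, preserving smoothness and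
finitely many open conditions on compact sets. -/
lemma Continuous.exists_smooth_on_ball {f : E → M} (hf : Continuous f) {x₀ : E} {r : ℝ}
    (hr : 0 < r) {y : M} (hy : ∀ x ∈ Metric.closedBall x₀ (2 * r), f x ∈ (chartAt F y).source)
    {ι : Type*} [Finite ι] {Q : ι → Set E} {O : ι → Set M} (hQ : ∀ i, IsCompact (Q i))
    (hO : ∀ i, IsOpen (O i)) (hQO : ∀ i, Set.MapsTo f (Q i) (O i)) :
    ∃ g : E → M, Continuous g ∧ (∀ x ∉ Metric.closedBall x₀ (2 * r), g x = f x) ∧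
      (∀ x ∈ Metric.closedBall x₀ r, ContMDiffAt 𝓘(ℝ, E) 𝓘(ℝ, F) ∞ g x) ∧
      (∀ x, ContMDiffAt 𝓘(ℝ, E) 𝓘(ℝ, F) ∞ f x → ContMDiffAt 𝓘(ℝ, E) 𝓘(ℝ, F) ∞ g x) ∧
      ∀ i, Set.MapsTo g (Q i) (O i) := by
  have : ProperSpace E := FiniteDimensional.proper ℝ E
  set φ := chartAt F y with hφ
  set K := Metric.closedBall x₀ (2 * r) with hK
  have hKc : IsCompact K := isCompact_closedBall _ _
  set Y : E → F := fun x => φ (f x) with hY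
  have hYc : ContinuousOn Y K := φ.continuousOn.comp hf.continuousOn hy
  have hYt : ∀ x ∈ K, Y x ∈ φ.target := fun x hx => φ.map_source (hy x hx)
  have hback : ∀ x ∈ K, φ.symm (Y x) = f x := fun x hx => φ.left_inv (hy x hx)
  -- The radii are nested, `r < 5/4 r < 3/2 r < 7/4 r < 2r`. The function `bump` is one near the
  -- small ball, and `cut` is one wherever `bump` can be nonzero; `cut` makes the chart expression
  -- of `f` a continuous function on all of `E`.
  let bump : ContDiffBump x₀ := ⟨5 / 4 * r, 3 / 2 * r, by linarith, by linarith⟩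
  let cut : ContDiffBump x₀ := ⟨3 / 2 * r, 7 / 4 * r, by linarith, by linarith⟩
  have hYe : Continuous fun x => cut x • Y x := by
    rw [continuous_iff_continuousAt]
    intro x
    by_cases hx : x ∈ Metric.ball x₀ (2 * r)
    · exact cut.continuous.continuousAt.smul
        (hYc.continuousAt (Filter.mem_of_superset (Metric.isOpen_ball.mem_nhds hx)
          Metric.ball_subset_closedBall))
    · have hx' : x ∈ (Metric.closedBall x₀ (7 / 4 * r))ᶜ := by
        simp only [Set.mem_compl_iff, Metric.mem_closedBall, Metric.mem_ball, not_lt, not_le] at hx ⊢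
        linarith
      refine (continuousAt_const (y := (0 : F))).congr ?_
      filter_upwards [Metric.isClosed_closedBall.isOpen_compl.mem_nhds hx'] with z hz
      have : cut z = 0 := by
        apply cut.zero_of_le_dist
        simp only [Set.mem_compl_iff, Metric.mem_closedBall, not_le] at hz
        exact hz.le
      rw [this, zero_smul]
  have hev : ∀ (A : Set F) (B : Set F), IsCompact A → IsOpen B → A ⊆ B →
      ∀ᶠ ε in 𝓝[>] (0 : ℝ), Metric.thickening ε A ⊆ B := by
    intro A B hA hB hAB
    obtain ⟨δ, hδ, h⟩ := hA.exists_thickening_subset_open hB hAB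
    filter_upwards [Ioo_mem_nhdsGT hδ] with ε hε
    exact (Metric.thickening_mono hε.2.le _).trans h
  have h1 : ∀ᶠ ε in 𝓝[>] (0 : ℝ), Metric.thickening ε (Y '' K) ⊆ φ.target :=
    hev _ _ (hKc.image_of_continuousOn hYc) φ.open_target (Set.image_subset_iff.2 hYt)
  -- By compactness each open condition survives perturbations of the chart expression by less than
  -- a small `ε`.
  have h2 : ∀ᶠ ε in 𝓝[>] (0 : ℝ), ∀ i, Metric.thickening ε (Y '' (K ∩ Q i)) ⊆
      φ.target ∩ φ.symm ⁻¹' O i := by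
    rw [Filter.eventually_all]
    intro i
    refine hev _ _ ((hKc.inter (hQ i)).image_of_continuousOn (hYc.mono Set.inter_subset_left))
      (φ.symm.isOpen_inter_preimage (hO i)) ?_
    rintro _ ⟨x, hx, rfl⟩
    refine ⟨hYt x hx.1, ?_⟩
    rw [Set.mem_preimage, hback x hx.1]
    exact hQO i hx.2
  obtain ⟨ε, ⟨hε1, hε2⟩, hε⟩ := ((h1.and h2).and self_mem_nhdsWithin).exists
  obtain ⟨Ys, hYs, hYsd, -⟩ := hYe.exists_contDiff_approx (ε := fun _ => ε) ⊤ continuous_const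
    fun _ => hε
  -- The approximation replaces `Y` where `bump = 1` and is faded out elsewhere. Where `Y` was
  -- already smooth, so is `N`.
  let N : E → F := fun x => Y x + bump x • (Ys x - Y x)
  have hbump0 : ∀ x, 3 / 2 * r ≤ dist x x₀ → bump x = 0 := fun x hx => bump.zero_of_le_dist hx
  have hNd : ∀ x, dist (N x) (Y x) < ε := by
    intro x
    rw [dist_eq_norm, add_sub_cancel_left, norm_smul]
    rcases le_or_gt (3 / 2 * r) (dist x x₀) with hx | hx
    · rw [hbump0 x hx, norm_zero, zero_mul]; exact hε
    · have hc : cut x = 1 := cut.one_of_mem_closedBall hx.le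
      have := hYsd x
      rw [hc, one_smul, dist_eq_norm] at this
      refine lt_of_le_of_lt ?_ this
      refine mul_le_of_le_one_left (norm_nonneg _) ?_
      rw [Real.norm_of_nonneg bump.nonneg]
      exact bump.le_one
  have hNt : ∀ x ∈ K, N x ∈ φ.target := fun x hx =>
    hε1 (Metric.mem_thickening_iff.2 ⟨Y x, ⟨x, hx, rfl⟩, hNd x⟩)
  classical
  let g : E → M := fun x => if x ∈ K then φ.symm (N x) else f x
  have hgK : ∀ x ∈ K, g x = φ.symm (N x) := fun x hx => if_pos hx
  have hgf : ∀ x, 3 / 2 * r ≤ dist x x₀ → g x = f x := by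
    intro x hx
    by_cases hxK : x ∈ K
    · rw [hgK x hxK]
      simp only [N, hbump0 x hx, zero_smul, add_zero]
      exact hback x hxK
    · exact if_neg hxK
  have hnhdsK : ∀ x, dist x x₀ < 2 * r → K ∈ 𝓝 x := fun x hx =>
    Filter.mem_of_superset (Metric.isOpen_ball.mem_nhds hx) Metric.ball_subset_closedBall
  have hgev : ∀ x, dist x x₀ < 2 * r → g =ᶠ[𝓝 x] fun x => φ.symm (N x) := fun x hx =>
    Filter.eventuallyEq_of_mem (hnhdsK x hx) hgK
  have hgev' : ∀ x, 2 * r ≤ dist x x₀ → g =ᶠ[𝓝 x] f := fun x hx => by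
    have : {z | 3 / 2 * r < dist z x₀} ∈ 𝓝 x :=
      (isOpen_lt continuous_const (by fun_prop)).mem_nhds (by
        change 3 / 2 * r < dist x x₀; linarith)
    filter_upwards [this] with z hz
    exact hgf z (le_of_lt hz)
  have hsymm : ∀ z ∈ φ.target, ContMDiffAt 𝓘(ℝ, F) 𝓘(ℝ, F) ∞ φ.symm z := fun z hz =>
    (contMDiffOn_chart_symm (I := 𝓘(ℝ, F)) (x := y)).contMDiffAt (φ.open_target.mem_nhds hz)
  refine ⟨g, ?_, fun x hx => if_neg hx, fun x hx => ?_, fun x hx => ?_, fun i x hx => ?_⟩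
  · rw [continuous_iff_continuousAt]
    intro x
    rcases lt_or_ge (dist x x₀) (2 * r) with h | h
    · have hxK : x ∈ K := le_of_lt h
      have hN : ContinuousAt N x := by
        have hYx : ContinuousAt Y x := hYc.continuousAt (hnhdsK x h)
        exact hYx.add (bump.continuous.continuousAt.smul
          (hYs.continuous.continuousAt.sub hYx))
      refine ContinuousAt.congr ?_ (hgev x h).symm
      exact ContinuousAt.comp (f := N) (φ.symm.continuousAt (hNt x hxK)) hN
    · exact hf.continuousAt.congr (hgev' x h).symm
  · have hx' : dist x x₀ ≤ r := hx
    have hxK : x ∈ K := by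
      change dist x x₀ ≤ 2 * r; linarith
    have e1 : N =ᶠ[𝓝 x] Ys := by
      have : Metric.closedBall x₀ (5 / 4 * r) ∈ 𝓝 x :=
        Filter.mem_of_superset (Metric.isOpen_ball.mem_nhds (Metric.mem_ball.2
          (by linarith : dist x x₀ < 5 / 4 * r))) Metric.ball_subset_closedBall
      filter_upwards [this] with z hz
      have : bump z = 1 := bump.one_of_mem_closedBall hz
      simp [N, this]
    have e2 : g =ᶠ[𝓝 x] φ.symm ∘ Ys := by
      filter_upwards [hgev x (by linarith), e1] with z h1 h2
      rw [h1, h2]; rfl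
    refine ContMDiffAt.congr_of_eventuallyEq ?_ e2
    refine ContMDiffAt.comp x (hsymm _ ?_) hYs.contMDiff.contMDiffAt
    rw [← e1.eq_of_nhds]
    exact hNt x hxK
  · rcases lt_or_ge (dist x x₀) (2 * r) with h | h
    · have hxK : x ∈ K := le_of_lt h
      have hYx : ContMDiffAt 𝓘(ℝ, E) 𝓘(ℝ, F) ∞ Y x := by
        have : ContMDiffAt 𝓘(ℝ, F) 𝓘(ℝ, F) ∞ φ (f x) :=
          (contMDiffOn_chart (I := 𝓘(ℝ, F)) (x := y)).contMDiffAt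
            (φ.open_source.mem_nhds (hy x hxK))
        exact ContMDiffAt.comp x this hx
      have hYx' : ContDiffAt ℝ ∞ Y x := contMDiffAt_iff_contDiffAt.1 hYx
      have hN : ContDiffAt ℝ ∞ N x :=
        hYx'.add (bump.contDiff.contDiffAt.smul (hYs.contDiffAt.sub hYx'))
      refine ContMDiffAt.congr_of_eventuallyEq ?_ (hgev x h)
      exact ContMDiffAt.comp (f := N) x (hsymm _ (hNt x hxK)) hN.contMDiffAt
    · exact hx.congr_of_eventuallyEq (hgev' x h)
  · by_cases hxK : x ∈ K
    · rw [hgK x hxK]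
      exact (hε2 i (Metric.mem_thickening_iff.2 ⟨Y x, ⟨x, ⟨hxK, hx⟩, rfl⟩, hNd x⟩)).2
    · have : g x = f x := if_neg hxK
      rw [this]
      exact hQO i hx

/-- A continuous map to a manifold can be smoothed on a compact set, changing it only in a given
neighbourhood and preserving smoothness. -/
theorem Continuous.exists_smooth_on_compact {f : E → M} (hf : Continuous f) {K U : Set E}
    (hK : IsCompact K) (hU : IsOpen U) (hKU : K ⊆ U) :
    ∃ g : E → M, Continuous g ∧ (∀ x ∉ U, g x = f x) ∧
      (∀ x ∈ K, ContMDiffAt 𝓘(ℝ, E) 𝓘(ℝ, F) ∞ g x) ∧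
      ∀ x, ContMDiffAt 𝓘(ℝ, E) 𝓘(ℝ, F) ∞ f x → ContMDiffAt 𝓘(ℝ, E) 𝓘(ℝ, F) ∞ g x := by
  have : ProperSpace E := FiniteDimensional.proper ℝ E
  have hrad : ∀ x : K, ∃ r > 0, Metric.closedBall (x : E) (2 * r) ⊆
      U ∩ f ⁻¹' (chartAt F (f x)).source := by
    rintro ⟨x, hx⟩
    have : U ∩ f ⁻¹' (chartAt F (f x)).source ∈ 𝓝 x :=
      (hU.inter ((chartAt F (f x)).open_source.preimage hf)).mem_nhds
        ⟨hKU hx, mem_chart_source F (f x)⟩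
    obtain ⟨ε, hε, h⟩ := Metric.nhds_basis_closedBall.mem_iff.1 this
    exact ⟨ε / 2, by positivity, by rwa [mul_div_cancel₀ _ two_ne_zero]⟩
  choose r hr hrU using hrad
  obtain ⟨t, ht⟩ := hK.elim_finite_subcover (fun x : K => Metric.ball (x : E) (r x))
    (fun _ => Metric.isOpen_ball) fun x hx =>
      Set.mem_iUnion.2 ⟨⟨x, hx⟩, Metric.mem_ball_self (hr _)⟩
  -- The balls are treated one at a time. The last clause keeps every ball, including those still to
  -- be treated, inside its chart domain.
  have key : ∀ u : Finset K, u ⊆ t → ∃ g : E → M, Continuous g ∧ (∀ x ∉ U, g x = f x) ∧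
      (∀ x ∈ u, ∀ z ∈ Metric.closedBall (x : E) (r x), ContMDiffAt 𝓘(ℝ, E) 𝓘(ℝ, F) ∞ g z) ∧
      (∀ x, ContMDiffAt 𝓘(ℝ, E) 𝓘(ℝ, F) ∞ f x → ContMDiffAt 𝓘(ℝ, E) 𝓘(ℝ, F) ∞ g x) ∧
      ∀ x : t, Set.MapsTo g (Metric.closedBall (x.1 : E) (2 * r x))
        (chartAt F (f x.1)).source := by
    classical
    intro u
    induction u using Finset.induction_on with
    | empty =>
      intro _
      exact ⟨f, hf, fun _ _ => rfl, by simp, fun _ h => h, fun x z hz => (hrU x hz).2⟩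
    | insert x u hxu ih =>
      intro hsub
      obtain ⟨g, hg, hgU, hgu, hgs, hgm⟩ := ih ((Finset.subset_insert x u).trans hsub)
      have hxt : x ∈ t := hsub (Finset.mem_insert_self x u)
      obtain ⟨g', hg', hgg', hx', hs', hm'⟩ := hg.exists_smooth_on_ball (hr x)
        (y := f x) (fun z hz => hgm ⟨x, hxt⟩ hz)
        (Q := fun x : t => Metric.closedBall (x.1 : E) (2 * r x))
        (O := fun x : t => (chartAt F (f x.1)).source) (fun _ => isCompact_closedBall _ _)
        (fun _ => (chartAt F _).open_source) hgm
      refine ⟨g', hg', fun z hz => ?_, fun z hz y hy => ?_, fun z hz => hs' z (hgs z hz), hm'⟩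
      · rw [hgg' z fun h => hz (hrU x h).1, hgU z hz]
      · rcases Finset.mem_insert.1 hz with rfl | hz
        · exact hx' y hy
        · exact hs' y (hgu z hz y hy)
  obtain ⟨g, hg, hgU, hgu, hgs, -⟩ := key t subset_rfl
  refine ⟨g, hg, hgU, fun x hx => ?_, hgs⟩
  obtain ⟨y, hy, hxy⟩ := Set.mem_iUnion₂.1 (ht hx)
  exact hgu y hy x (Metric.ball_subset_closedBall hxy)

end Smoothing

/-! ### Smoothing of equivariant maps -/

section EquivariantSmoothing

variable {F M : Type*} [NormedAddCommGroup F] [NormedSpace ℝ F] [TopologicalSpace M]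
  [ChartedSpace F M]

lemma Homeomorph.contMDiff_zpow {τ : M ≃ₜ M} (hτ : ContMDiff 𝓘(ℝ, F) 𝓘(ℝ, F) ∞ τ)
    (hτinv : ContMDiff 𝓘(ℝ, F) 𝓘(ℝ, F) ∞ τ.symm) (n : ℤ) :
    ContMDiff 𝓘(ℝ, F) 𝓘(ℝ, F) ∞ (τ ^ n : M ≃ₜ M) := by
  induction n using Int.induction_on with
  | zero => rw [zpow_zero]; exact contMDiff_id
  | succ n ih => rw [zpow_add_one]; exact ih.comp hτ
  | pred n ih => rw [zpow_sub_one]; exact ih.comp hτinv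

/-- The translation of the logarithmic plane by `n` turns. -/
def turn (n : ℤ) : ℂ := n * (2 * Real.pi * Complex.I)

lemma turn_re (n : ℤ) : (turn n).re = 0 := by simp [turn]

lemma turn_im (n : ℤ) : (turn n).im = 2 * Real.pi * n := by simp [turn, mul_comm]

lemma equivariant_turn {τ : M ≃ₜ M} {C : ℂ → M}
    (hC : ∀ w, C (w + 2 * Real.pi * Complex.I) = τ (C w)) (n : ℤ) (w : ℂ) :
    C (w + turn n) = (τ ^ n) (C w) := by
  induction n using Int.induction_on with
  | zero => simp [turn]
  | succ n ih =>
    have e : w + turn (n + 1) = w + turn n + 2 * Real.pi * Complex.I := by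
      simp only [turn]; push_cast; ring
    rw [e, hC, ih, add_comm, zpow_add, zpow_one]
    rfl
  | pred n ih =>
    apply τ.injective
    have e : w + turn (-n - 1) + 2 * Real.pi * Complex.I = w + turn (-n) := by
      simp only [turn]; push_cast; ring
    rw [← hC, e, ih]
    change _ = (τ * τ ^ (-(n : ℤ) - 1)) (C w)
    rw [← zpow_one_add]
    congr 2
    ring

lemma equivariant_turn' {τ : M ≃ₜ M} {C : ℂ → M}
    (hC : ∀ w, C (w + 2 * Real.pi * Complex.I) = τ (C w)) (n : ℤ) (w : ℂ) :
    (τ ^ n) (C (w - turn n)) = C w := by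
  rw [← equivariant_turn hC, sub_add_cancel]

variable [IsManifold 𝓘(ℝ, F) ∞ M]

/-- An equivariant map can be smoothed on the translates of a rectangle. -/
lemma exists_equivariant_smooth_on_strip {τ : M ≃ₜ M} (hτ : ContMDiff 𝓘(ℝ, F) 𝓘(ℝ, F) ∞ τ)
    (hτinv : ContMDiff 𝓘(ℝ, F) 𝓘(ℝ, F) ∞ τ.symm) {C : ℂ → M} (hC : Continuous C)
    (hCτ : ∀ w, C (w + 2 * Real.pi * Complex.I) = τ (C w)) (c p q : ℝ) :
    ∃ C' : ℂ → M, Continuous C' ∧ (∀ w, C' (w + 2 * Real.pi * Complex.I) = τ (C' w)) ∧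
      (∀ w : ℂ, w.re ∉ Set.Ioo (p - 1) (q + 1) → C' w = C w) ∧
      (∀ w : ℂ, w.re ∈ Set.Icc p q → (∃ n : ℤ, |w.im - c - 2 * Real.pi * n| ≤ 2) →
        ContMDiffAt 𝓘(ℝ, ℂ) 𝓘(ℝ, F) ∞ C' w) ∧
      ∀ w, ContMDiffAt 𝓘(ℝ, ℂ) 𝓘(ℝ, F) ∞ C w → ContMDiffAt 𝓘(ℝ, ℂ) 𝓘(ℝ, F) ∞ C' w := by
  have hpi := Real.pi_gt_three
  -- The map is changed only in a rectangle of height `6 < 2π`, so its translates by full turns are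
  -- disjoint and the change can be repeated equivariantly.
  have hK : IsCompact (Set.Icc p q ×ℂ Set.Icc (c - 2) (c + 2)) :=
    isCompact_Icc.reProdIm isCompact_Icc
  have hU : IsOpen (Set.Ioo (p - 1) (q + 1) ×ℂ Set.Ioo (c - 3) (c + 3)) :=
    isOpen_Ioo.reProdIm isOpen_Ioo
  obtain ⟨f, hf, hfU, hfK, hfs⟩ := hC.exists_smooth_on_compact (F := F) hK hU (by
    rintro w ⟨⟨h1, h2⟩, h3, h4⟩
    exact ⟨⟨by linarith, by linarith⟩, by linarith, by linarith⟩)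
  have hfim : ∀ w : ℂ, 3 ≤ |w.im - c| → f w = C w := fun w hw => hfU w fun h => by
    have h1 : c - 3 < w.im := h.2.1
    have h2 : w.im < c + 3 := h.2.2
    exact absurd hw (not_le.2 (abs_lt.2 ⟨by linarith, by linarith⟩))
  let k : ℂ → ℤ := fun w => round ((w.im - c) / (2 * Real.pi))
  let C' : ℂ → M := fun w => (τ ^ k w) (f (w - turn (k w)))
  have hk : ∀ w : ℂ, |w.im - c - 2 * Real.pi * k w| ≤ Real.pi := fun w => by
    have h1 := abs_sub_round ((w.im - c) / (2 * Real.pi))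
    have e : w.im - c - 2 * Real.pi * k w =
        2 * Real.pi * ((w.im - c) / (2 * Real.pi) - k w) := by
      field_simp
    rw [e, abs_mul, abs_of_pos (by positivity : 0 < 2 * Real.pi)]
    calc 2 * Real.pi * |(w.im - c) / (2 * Real.pi) - k w| ≤ 2 * Real.pi * (1 / 2) := by gcongr
      _ = Real.pi := by ring
  have hsub : ∀ (n : ℤ) (w : ℂ), (w - turn n).im - c = w.im - c - 2 * Real.pi * n := fun n w => by
    rw [Complex.sub_im, turn_im]; ring
  -- The formula with a fixed `n` holds on a band wider than the rounding cell, since `π < 2π - 3`;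
  -- this gives regularity across the jumps of `k`. If `k w ≠ n`, both translates are at distance at
  -- least `3` from the centre, where `f = C`, and equivariance of `C` compares them.
  have hloc : ∀ (n : ℤ) (w : ℂ), |w.im - c - 2 * Real.pi * n| < 2 * Real.pi - 3 →
      C' w = (τ ^ n) (f (w - turn n)) := by
    intro n w hw
    by_cases hn : k w = n
    · simp only [C', hn]
    · have hd : 2 * Real.pi ≤ |2 * Real.pi * n - 2 * Real.pi * k w| := by
        rw [← mul_sub, abs_mul, abs_of_pos (by positivity : 0 < 2 * Real.pi)]
        have h1 : (1 : ℝ) ≤ |(n : ℝ) - k w| := by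
          have : (1 : ℤ) ≤ |n - k w| := Int.one_le_abs (sub_ne_zero.2 (Ne.symm hn))
          exact_mod_cast this
        nlinarith
      have htri : |2 * Real.pi * n - 2 * Real.pi * k w| ≤
          |w.im - c - 2 * Real.pi * n| + |w.im - c - 2 * Real.pi * k w| := by
        have e : 2 * Real.pi * n - 2 * Real.pi * k w =
            -(w.im - c - 2 * Real.pi * n) + (w.im - c - 2 * Real.pi * k w) := by ring
        rw [e]
        exact (abs_add_le _ _).trans (by rw [abs_neg])
      have h1 : f (w - turn n) = C (w - turn n) := hfim _ (by
        rw [hsub]; linarith [hk w])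
      have h2 : f (w - turn (k w)) = C (w - turn (k w)) := hfim _ (by
        rw [hsub]; linarith)
      simp only [C']
      rw [h1, h2, equivariant_turn' hCτ, equivariant_turn' hCτ]
  have hev : ∀ (n : ℤ) (w : ℂ), |w.im - c - 2 * Real.pi * n| < 2 * Real.pi - 3 →
      C' =ᶠ[𝓝 w] fun w => (τ ^ n) (f (w - turn n)) := fun n w hw => by
    have ho : IsOpen {w : ℂ | |w.im - c - 2 * Real.pi * n| < 2 * Real.pi - 3} :=
      isOpen_lt (by fun_prop) continuous_const
    filter_upwards [ho.mem_nhds hw] with z hz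
    exact hloc n z hz
  have hkw : ∀ w : ℂ, |w.im - c - 2 * Real.pi * k w| < 2 * Real.pi - 3 := fun w => by
    linarith [hk w]
  have hsm : ∀ (n : ℤ) (w : ℂ), |w.im - c - 2 * Real.pi * n| < 2 * Real.pi - 3 →
      ContMDiffAt 𝓘(ℝ, ℂ) 𝓘(ℝ, F) ∞ f (w - turn n) → ContMDiffAt 𝓘(ℝ, ℂ) 𝓘(ℝ, F) ∞ C' w := by
    intro n w hw h
    refine ContMDiffAt.congr_of_eventuallyEq ?_ (hev n w hw)
    refine ContMDiffAt.comp w (Homeomorph.contMDiff_zpow hτ hτinv n).contMDiffAt ?_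
    refine ContMDiffAt.comp (f := fun w => w - turn n) w h ?_
    exact (contDiff_id.sub contDiff_const).contMDiff.contMDiffAt
  refine ⟨C', ?_, fun w => ?_, fun w hw => ?_, fun w hw hn => ?_, fun w hw => ?_⟩
  · rw [continuous_iff_continuousAt]
    intro w
    refine ContinuousAt.congr ?_ (hev (k w) w (hkw w)).symm
    exact ((τ ^ k w).continuous.comp (hf.comp (by fun_prop))).continuousAt
  · have e1 : k (w + 2 * Real.pi * Complex.I) = k w + 1 := by
      simp only [k]
      rw [← round_add_one]
      congr 1
      simp only [Complex.add_im, Complex.mul_im, Complex.mul_re, Complex.ofReal_im,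
        Complex.ofReal_re, Complex.I_re, Complex.I_im, Complex.re_ofNat, Complex.im_ofNat]
      field_simp
      ring
    have e2 : w + 2 * Real.pi * Complex.I - turn (k w + 1) = w - turn (k w) := by
      simp only [turn]; push_cast; ring
    simp only [C']
    rw [e1, e2, add_comm, zpow_add, zpow_one]
    rfl
  · simp only [C']
    rw [hfU _ fun h => hw ?_, equivariant_turn' hCτ]
    have : (w - turn (k w)).re ∈ Set.Ioo (p - 1) (q + 1) := h.1
    rwa [Complex.sub_re, turn_re, sub_zero] at this
  · obtain ⟨n, hn⟩ := hn
    refine hsm n w (by linarith) (hfK _ ?_)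
    have h1 := abs_le.1 hn
    have h2 := hsub n w
    refine ⟨?_, ?_, ?_⟩
    · change (w - turn n).re ∈ Set.Icc p q
      rwa [Complex.sub_re, turn_re, sub_zero]
    · linarith
    · linarith
  · refine hsm (k w) w (hkw w) (hfs _ ?_)
    -- Equivariance moves smoothness of `C` at `w` to the translated point, where `f` inherits it.
    have e : C = fun z => (τ ^ (-k w)) (C (z + turn (k w))) := by
      funext z
      rw [equivariant_turn hCτ]
      change _ = (τ ^ (-k w) * τ ^ k w) (C z)
      rw [← zpow_add, neg_add_cancel, zpow_zero]
      rfl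
    rw [e]
    refine ContMDiffAt.comp (w - turn (k w)) (Homeomorph.contMDiff_zpow hτ hτinv _).contMDiffAt ?_
    refine ContMDiffAt.comp (f := fun z => z + turn (k w)) (w - turn (k w)) ?_
      (contDiff_id.add contDiff_const).contMDiff.contMDiffAt
    rw [sub_add_cancel]
    exact hw

/-- An equivariant map of the plane can be smoothed over a compact interval of real parts. -/
theorem exists_equivariant_smooth {τ : M ≃ₜ M} (hτ : ContMDiff 𝓘(ℝ, F) 𝓘(ℝ, F) ∞ τ)
    (hτinv : ContMDiff 𝓘(ℝ, F) 𝓘(ℝ, F) ∞ τ.symm) {C : ℂ → M} (hC : Continuous C)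
    (hCτ : ∀ w, C (w + 2 * Real.pi * Complex.I) = τ (C w)) (p q : ℝ) :
    ∃ C' : ℂ → M, Continuous C' ∧ (∀ w, C' (w + 2 * Real.pi * Complex.I) = τ (C' w)) ∧
      (∀ w : ℂ, w.re ∉ Set.Ioo (p - 1) (q + 1) → C' w = C w) ∧
      (∀ w : ℂ, w.re ∈ Set.Icc p q → ContMDiffAt 𝓘(ℝ, ℂ) 𝓘(ℝ, F) ∞ C' w) ∧
      ∀ w, ContMDiffAt 𝓘(ℝ, ℂ) 𝓘(ℝ, F) ∞ C w → ContMDiffAt 𝓘(ℝ, ℂ) 𝓘(ℝ, F) ∞ C' w := by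
  obtain ⟨C₁, h1, h1τ, h1C, h1K, h1s⟩ :=
    exists_equivariant_smooth_on_strip hτ hτinv hC hCτ 0 p q
  obtain ⟨C₂, h2, h2τ, h2C, h2K, h2s⟩ :=
    exists_equivariant_smooth_on_strip hτ hτinv h1 h1τ Real.pi p q
  refine ⟨C₂, h2, h2τ, fun w hw => by rw [h2C w hw, h1C w hw], fun w hw => ?_,
    fun w hw => h2s w (h1s w hw)⟩
  have hlt := Real.pi_lt_four
  have hpos := Real.pi_pos
  have ha1 := Int.floor_le (w.im / (2 * Real.pi))
  have ha2 := Int.lt_floor_add_one (w.im / (2 * Real.pi))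
  rw [le_div_iff₀ (by positivity)] at ha1
  rw [div_lt_iff₀ (by positivity)] at ha2
  set n := ⌊w.im / (2 * Real.pi)⌋
  -- The bands of half-width `2` around the multiples of `π` cover the plane, because neighbouring
  -- centres are `π < 4` apart. The second smoothing keeps what the first achieved.
  rcases le_total (w.im - 2 * Real.pi * n) (Real.pi / 2) with h | h
  · exact h2s w (h1K w hw ⟨n, abs_le.2 ⟨by linarith, by linarith⟩⟩)
  · rcases le_total (w.im - 2 * Real.pi * n) (3 * Real.pi / 2) with h' | h'
    · exact h2K w hw ⟨n, abs_le.2 ⟨by linarith, by linarith⟩⟩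
    · refine h2s w (h1K w hw ⟨n + 1, abs_le.2 ⟨?_, ?_⟩⟩) <;> push_cast <;> linarith

end EquivariantSmoothing

/-! ### Smoothness of the transport -/

section CircleSmooth

instance : ContMDiffMul (𝓡 1) ∞ Circle := ContMDiffMul.of_le (n := ω) le_top

lemma Circle.contMDiff_coe : ContMDiff (𝓡 1) 𝓘(ℝ, ℂ) ∞ (fun u : Circle => (u : ℂ)) := by
  have := finrank_real_complex_fact'
  exact contMDiff_coe_sphere (E := ℂ) (n := 1)

/-- Near `z` the argument is replaced by the smooth branch `arg z + Im log (w / z)`. -/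
lemma Complex.contMDiffAt_direction {z : ℂ} (hz : z ≠ 0) :
    ContMDiffAt 𝓘(ℝ, ℂ) (𝓡 1) ∞ direction z := by
  have h1 : ContDiffAt ℝ ∞ (fun w : ℂ => Complex.arg z + (Complex.log (w / z)).im) z := by
    have h2 : ContDiffAt ℂ ∞ (fun w : ℂ => Complex.log (w / z)) z := by
      refine ContDiffAt.comp z (Complex.contDiffAt_log ?_) (contDiffAt_id.div_const z)
      simp [div_self hz]
    exact contDiffAt_const.add (Complex.imCLM.contDiff.contDiffAt.comp z (h2.restrict_scalars ℝ))
  have h3 : ContMDiffAt 𝓘(ℝ, ℂ) (𝓡 1) ∞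
      (fun w : ℂ => Circle.exp (Complex.arg z + (Complex.log (w / z)).im)) z :=
    ContMDiffAt.comp z contMDiff_circleExp.contMDiffAt h1.contMDiffAt
  refine h3.congr_of_eventuallyEq ?_
  filter_upwards [isOpen_ne.mem_nhds hz] with w hw
  rw [Circle.exp_add, Complex.log_im]
  change direction w = direction z * direction (w / z)
  rw [← Complex.direction_mul hz (div_ne_zero hw hz), mul_div_cancel₀ _ hz]

end CircleSmooth

namespace QuadraticModel

lemma contDiff_a : ContDiff ℝ ∞ a := by unfold a; fun_prop

lemma contDiff_b : ContDiff ℝ ∞ b := by unfold b; fun_prop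

lemma contDiff_height : ContDiff ℝ ∞ height := by
  unfold height
  exact (contDiff_a.norm_sq ℝ).sub (contDiff_b.norm_sq ℝ)

/-- Both square roots in `modulus` are taken of positive numbers when `z₀ ≠ 0`, whatever the height.
-/
lemma contDiffAt_pointA {z₀ : ℂ} (hz₀ : z₀ ≠ 0) {u : ℂ → Circle} {h : ℂ → ℝ}
    (hu : ContDiffAt ℝ ∞ (fun z => (u z : ℂ)) z₀) (hh : ContDiffAt ℝ ∞ h z₀) :
    ContDiffAt ℝ ∞ (fun z => pointA z (u z) (h z)) z₀ := by
  have h0 : ContDiffAt ℝ ∞ (fun z => h z ^ 2 + 4 * ‖z‖ ^ 2) z₀ :=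
    (hh.pow 2).add (contDiffAt_const.mul (contDiffAt_id.norm_sq ℝ))
  have hpos : h z₀ ^ 2 + 4 * ‖z₀‖ ^ 2 ≠ 0 := by
    have := norm_pos_iff.2 hz₀
    positivity
  have h1 : ContDiffAt ℝ ∞ (fun z => modulus ‖z‖ (h z)) z₀ := by
    unfold modulus
    refine ((hh.add (h0.sqrt hpos)).div_const 2).sqrt ?_
    exact (modulus_aux (.inl (norm_ne_zero_iff.2 hz₀))).ne'
  have h2 : ContDiffAt ℝ ∞ (fun z => (modulus ‖z‖ (h z) : ℂ) * u z) z₀ :=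
    (Complex.ofRealCLM.contDiff.contDiffAt.comp z₀ h1).mul hu
  have h3 : ContDiffAt ℝ ∞ (fun z => z / ((modulus ‖z‖ (h z) : ℂ) * u z)) z₀ := by
    simp only [div_eq_mul_inv]
    exact contDiffAt_id.mul (h2.inv (a_pointA_ne_zero (.inl hz₀) _))
  unfold pointA ofAB
  exact ((h2.add h3).div_const 2).prodMk ((h2.sub h3).div_const _)

end QuadraticModel

namespace AnnularCurve

open QuadraticModel

variable {S : Type*} [TopologicalSpace S] [ChartedSpace (EuclideanSpace ℝ (Fin 2)) S]
variable (j : AnnularCurve S)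

/-- Because `j` is injective, `coords` agrees near `j p` with the smooth inverse of the local
diffeomorphism. -/
lemma contMDiffAt_coords (p : Circle × ℝ) :
    ContMDiffAt (𝓡 2) ((𝓡 1).prod 𝓘(ℝ, ℝ)) ∞ j.coords (j p) := by
  have h := j.isLocalDiffeomorph p
  refine h.localInverse_contMDiffAt.congr_of_eventuallyEq ?_
  filter_upwards [h.localInverse_eventuallyEq_right] with y hy
  have hy' : j (h.localInverse y) = y := hy
  conv_lhs => rw [← hy']
  rw [coords_apply]

section Rotation

variable {E N H : Type*} [NormedAddCommGroup E] [NormedSpace ℝ E] [TopologicalSpace H]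
  {I : ModelWithCorners ℝ E H} [TopologicalSpace N] [ChartedSpace H N]

lemma contMDiffAt_apply {x : N} {u : N → Circle} {v : N → ℝ} (hu : ContMDiffAt I (𝓡 1) ∞ u x)
    (hv : ContMDiffAt I 𝓘(ℝ, ℝ) ∞ v x) : ContMDiffAt I (𝓡 2) ∞ (fun x => j (u x, v x)) x :=
  ContMDiffAt.comp (f := fun x => (u x, v x)) x
    (j.isLocalDiffeomorph.contMDiff.contMDiffAt) (hu.prodMk hv)

/-- Rotation of the annulus by a smoothly varying angle preserves smoothness. -/
lemma contMDiffAt_rotate {x : N} {f : N → S} (hf : ContMDiffAt I (𝓡 2) ∞ f x)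
    (hx : f x ∈ Set.range j) {κ : N → ℝ → ℝ}
    (hκ : ContMDiffAt I 𝓘(ℝ, ℝ) ∞ (fun y => κ y (j.coords (f y)).2) x) :
    ContMDiffAt I (𝓡 2) ∞ (fun y => j.rotate (κ y) (f y)) x := by
  obtain ⟨p, hp⟩ := hx
  have hc : ContMDiffAt I ((𝓡 1).prod 𝓘(ℝ, ℝ)) ∞ (fun y => j.coords (f y)) x :=
    ContMDiffAt.comp x (by rw [← hp]; exact j.contMDiffAt_coords p) hf
  have h1 : ContMDiffAt I (𝓡 1) ∞ (fun y => (j.coords (f y)).1) x := hc.fst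
  have h2 : ContMDiffAt I 𝓘(ℝ, ℝ) ∞ (fun y => (j.coords (f y)).2) x := hc.snd
  have h3 : ContMDiffAt I (𝓡 1) ∞ (fun y => Circle.exp (κ y (j.coords (f y)).2)) x :=
    ContMDiffAt.comp x contMDiff_circleExp.contMDiffAt hκ
  refine (j.contMDiffAt_apply (h1.mul h3) h2).congr_of_eventuallyEq ?_
  have hr : ∀ᶠ y in 𝓝 x, f y ∈ Set.range j :=
    hf.continuousAt.eventually_mem (j.isOpenEmbedding.isOpen_range.mem_nhds ⟨p, hp⟩)
  filter_upwards [hr] with y hy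
  rw [rotate, if_pos hy]
  rfl

end Rotation

lemma contMDiff_twist [T2Space S] (n : ℤ) : ContMDiff (𝓡 2) (𝓡 2) ∞ (j.twist n) := by
  intro x
  by_cases h : x ∈ j '' ((Set.univ : Set Circle) ×ˢ Set.Icc (0 : ℝ) 1)
  · have hx : x ∈ Set.range j := Set.image_subset_range _ _ h
    refine j.contMDiffAt_rotate contMDiffAt_id hx
      (κ := fun _ v => -(2 * Real.pi * n * Real.smoothTransition v)) ?_
    obtain ⟨p, rfl⟩ := hx
    have h2 : ContMDiffAt (𝓡 2) 𝓘(ℝ, ℝ) ∞ (fun y => (j.coords y).2) (j p) :=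
      (j.contMDiffAt_coords p).snd
    have h1 : ContDiff ℝ ∞ fun v => -(2 * Real.pi * n * Real.smoothTransition v) :=
      (contDiff_const.mul Real.smoothTransition.contDiff).neg
    exact ContMDiffAt.comp (g := fun v => -(2 * Real.pi * n * Real.smoothTransition v))
      (f := fun y => (j.coords y).2) (j p) h1.contMDiff.contMDiffAt h2
  · refine contMDiffAt_id.congr_of_eventuallyEq ?_
    filter_upwards [j.isClosed_annulus.isOpen_compl.mem_nhds h] with y hy
    exact j.twist_of_notMem n hy

lemma contDiffAt_slope {v : ℝ} (hv : v ≠ 1 / 2) : ContDiffAt ℝ ∞ slope v := by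
  obtain ⟨c, hc⟩ := slope_eventuallyEq hv
  exact (Real.smoothTransition.contDiff.contDiffAt.sub contDiffAt_const).congr_of_eventuallyEq hc

/-- The transport of a smooth section over the circle is smooth. -/
theorem contMDiff_circleLift [T2Space S] {s : j.ContSection (Metric.sphere 0 1)}
    (hs : s.IsSmooth) : ContMDiff 𝓘(ℝ, ℝ) (𝓡 2) ∞ (j.circleLift s) := by
  intro θ₀
  let e : ℝ → ℂ := fun θ => Complex.exp (θ * Complex.I)
  have he : ContDiff ℝ ∞ e := by
    have : ContDiff ℝ ∞ fun θ : ℝ => (θ : ℂ) * Complex.I :=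
      Complex.ofRealCLM.contDiff.mul contDiff_const
    exact this.cexp
  let e' : ℝ → Metric.sphere (0 : ℂ) 1 := fun θ => ⟨e θ, exp_mul_I_mem θ⟩
  have he' : Continuous e' := he.continuous.subtype_mk _
  have hmaps : Set.MapsTo e Set.univ (Metric.sphere (0 : ℂ) 1) := fun θ _ => exp_mul_I_mem θ
  rcases hs (e' θ₀) with ⟨f, hf, hfs⟩ | ⟨g, hg, hgs⟩
  · have hfe : ContDiffAt ℝ ∞ (fun θ => f (e θ)) θ₀ := by
      rw [← contDiffWithinAt_univ]
      exact ContDiffWithinAt.comp θ₀ hf he.contDiffAt.contDiffWithinAt hmaps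
    have hev : ∀ᶠ θ in 𝓝 θ₀, s (e' θ) = j.inModel (f (e θ)) := he'.continuousAt.eventually hfs
    have hq : ∀ᶠ θ in 𝓝 θ₀, q (f (e θ)) = Complex.exp (θ * Complex.I) := by
      filter_upwards [hev] with θ hθ
      rw [← j.proj_inModel, ← hθ, s.proj_toFun]
    have ha : a (f (e θ₀)) ≠ 0 := a_ne_zero_of_q_ne_zero (by
      rw [hq.self_of_nhds]; exact Complex.exp_ne_zero _)
    have h1 : ContMDiffAt 𝓘(ℝ, ℝ) (𝓡 1) ∞ (fun θ => direction (a (f (e θ)))) θ₀ :=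
      ContMDiffAt.comp (g := direction) (f := fun θ => a (f (e θ))) θ₀
        (Complex.contMDiffAt_direction ha)
        (contDiff_a.contDiffAt.comp θ₀ hfe).contMDiffAt
    have h2 : ContDiffAt ℝ ∞ (fun θ => 1 / 2 + height (f (e θ))) θ₀ :=
      contDiffAt_const.add (contDiff_height.contDiffAt.comp θ₀ hfe)
    have h3 : ContDiffAt ℝ ∞ (fun θ => θ * (Real.smoothTransition (1 / 2 + height (f (e θ))) - 1))
        θ₀ := contDiffAt_id.mul
          ((Real.smoothTransition.contDiff.contDiffAt.comp θ₀ h2).sub contDiffAt_const)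
    have h4 : ContMDiffAt 𝓘(ℝ, ℝ) (𝓡 1) ∞ (fun θ =>
        Circle.exp (θ * (Real.smoothTransition (1 / 2 + height (f (e θ))) - 1))) θ₀ :=
      ContMDiffAt.comp θ₀ contMDiff_circleExp.contMDiffAt h3.contMDiffAt
    refine (j.contMDiffAt_apply (h1.mul h4) h2.contMDiffAt).congr_of_eventuallyEq ?_
    filter_upwards [hev, hq] with θ hθ hqθ
    have hθ' : s ⟨Complex.exp (θ * Complex.I), exp_mul_I_mem θ⟩ = j.inModel (f (e θ)) := hθ
    rw [circleLift, hθ', j.untransport_inModel hqθ, unmodel]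
    simp
  · have hge : ContMDiffAt 𝓘(ℝ, ℝ) (𝓡 2) ∞ (fun θ => g (e θ)) θ₀ := by
      rw [← contMDiffWithinAt_univ]
      exact ContMDiffWithinAt.comp θ₀ hg he.contDiffAt.contMDiffAt.contMDiffWithinAt hmaps
    have hev : ∀ᶠ θ in 𝓝 θ₀, ∃ hw : g (e θ) ∈ j.cycleᶜ,
        s (e' θ) = j.inTrivial (e θ, ⟨g (e θ), hw⟩) := he'.continuousAt.eventually hgs
    have hlift : ∀ᶠ θ in 𝓝 θ₀, j.circleLift s θ = j.shear θ (g (e θ)) := by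
      filter_upwards [hev] with θ hθ
      obtain ⟨hw, hθ⟩ := hθ
      have hθ' : s ⟨Complex.exp (θ * Complex.I), exp_mul_I_mem θ⟩ =
        j.inTrivial (e θ, ⟨g (e θ), hw⟩) := hθ
      rw [circleLift, hθ', j.untransport_inTrivial]
      simp
    obtain ⟨hc, -⟩ := hev.self_of_nhds
    -- On the closed annulus the point is off the curve, where `slope` is smooth. Off the annulus
    -- the shear is the identity.
    by_cases h : g (e θ₀) ∈ j '' ((Set.univ : Set Circle) ×ˢ Set.Icc (0 : ℝ) 1)
    · have hr : g (e θ₀) ∈ Set.range j := Set.image_subset_range _ _ h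
      refine ContMDiffAt.congr_of_eventuallyEq (f := fun θ => j.shear θ (g (e θ))) ?_ hlift
      refine j.contMDiffAt_rotate hge hr (κ := fun θ v => θ * slope v) ?_
      obtain ⟨p, hp⟩ := hr
      have h2 : ContMDiffAt 𝓘(ℝ, ℝ) 𝓘(ℝ, ℝ) ∞ (fun θ => (j.coords (g (e θ))).2) θ₀ :=
        ContMDiffAt.comp (g := fun y => (j.coords y).2) (I' := 𝓡 2) θ₀
          (by rw [← hp]; exact (j.contMDiffAt_coords p).snd) hge
      have hv : (j.coords (g (e θ₀))).2 ≠ 1 / 2 := fun hv => hc (by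
        rw [← hp] at hv ⊢
        rw [coords_apply] at hv
        exact (j.apply_mem_cycle_iff p).2 hv)
      exact (contDiffAt_id.mul ((contDiffAt_slope hv).comp θ₀
        (contMDiffAt_iff_contDiffAt.1 h2))).contMDiffAt
    · refine hge.congr_of_eventuallyEq ?_
      have hn : ∀ᶠ θ in 𝓝 θ₀, g (e θ) ∈ (j '' ((Set.univ : Set Circle) ×ˢ Set.Icc (0 : ℝ) 1))ᶜ :=
        hge.continuousAt.eventually_mem (j.isClosed_annulus.isOpen_compl.mem_nhds h)
      filter_upwards [hlift, hn] with θ h1 h2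
      rw [h1, j.shear_of_notMem θ h2]

/-- A section given by a smooth equivariant map is smooth off the origin. -/
lemma isSmooth_of_lift [T2Space S] {C : ℂ → S}
    (hC : ContMDiff 𝓘(ℝ, ℂ) (𝓡 2) ∞ C) {f : ℂ → j.Total}
    (hfC : ∀ w, f (Complex.exp w) = j.transport w (C w)) {z₀ : ℂ} (hz₀ : z₀ ≠ 0) :
    (∃ F : ℂ → ℂ × ℂ, ContDiffAt ℝ ∞ F z₀ ∧ ∀ᶠ z in 𝓝 z₀, f z = j.inModel (F z)) ∨
    (∃ g : ℂ → S, ContMDiffAt 𝓘(ℝ, ℂ) (𝓡 2) ∞ g z₀ ∧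
      ∀ᶠ z in 𝓝 z₀, ∃ hw : g z ∈ j.cycleᶜ, f z = j.inTrivial (z, ⟨g z, hw⟩)) := by
  have hL := contDiffAt_logNear hz₀
  have hD : ContMDiffAt 𝓘(ℝ, ℂ) (𝓡 2) ∞ (fun z => C (logNear z₀ z)) z₀ :=
    ContMDiffAt.comp z₀ hC.contMDiffAt hL.contMDiffAt
  have hne : ∀ᶠ z in 𝓝 z₀, z ≠ 0 := isOpen_ne.mem_nhds hz₀
  have hft : ∀ᶠ z in 𝓝 z₀, f z = j.transport (logNear z₀ z) (C (logNear z₀ z)) := by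
    filter_upwards [hne] with z hz
    rw [← hfC, exp_logNear hz₀ hz]
  -- On the whole annular neighbourhood, curve included, the model chart is used; elsewhere the
  -- section is horizontal transport in the trivial part.
  by_cases hx : C (logNear z₀ z₀) ∈ Set.range j
  · left
    obtain ⟨p, hp⟩ := hx
    have hc : ContMDiffAt 𝓘(ℝ, ℂ) ((𝓡 1).prod 𝓘(ℝ, ℝ)) ∞
        (fun z => j.coords (C (logNear z₀ z))) z₀ :=
      ContMDiffAt.comp z₀ (by rw [← hp]; exact j.contMDiffAt_coords p) hD
    have h1 : ContMDiffAt 𝓘(ℝ, ℂ) (𝓡 1) ∞ (fun z => (j.coords (C (logNear z₀ z))).1) z₀ := hc.fst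
    have h2 : ContDiffAt ℝ ∞ (fun z => (j.coords (C (logNear z₀ z))).2) z₀ :=
      contMDiffAt_iff_contDiffAt.1 hc.snd
    have h3 : ContDiffAt ℝ ∞ (fun z => (logNear z₀ z).im *
        (1 - Real.smoothTransition (j.coords (C (logNear z₀ z))).2)) z₀ :=
      (Complex.imCLM.contDiff.contDiffAt.comp z₀ hL).mul
        (contDiffAt_const.sub (Real.smoothTransition.contDiff.contDiffAt.comp z₀ h2))
    have h4 : ContMDiffAt 𝓘(ℝ, ℂ) (𝓡 1) ∞ (fun z => (j.coords (C (logNear z₀ z))).1 *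
        Circle.exp ((logNear z₀ z).im *
          (1 - Real.smoothTransition (j.coords (C (logNear z₀ z))).2))) z₀ :=
      h1.mul (ContMDiffAt.comp z₀ contMDiff_circleExp.contMDiffAt h3.contMDiffAt)
    have h5 : ContDiffAt ℝ ∞ (fun z => (((j.coords (C (logNear z₀ z))).1 *
        Circle.exp ((logNear z₀ z).im *
          (1 - Real.smoothTransition (j.coords (C (logNear z₀ z))).2)) : Circle) : ℂ)) z₀ :=
      contMDiffAt_iff_contDiffAt.1
        (ContMDiffAt.comp z₀ Circle.contMDiff_coe.contMDiffAt h4)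
    refine ⟨_, contDiffAt_pointA hz₀ h5 (h2.sub (contDiffAt_const (c := 1 / 2))), ?_⟩
    have hr : ∀ᶠ z in 𝓝 z₀, C (logNear z₀ z) ∈ Set.range j :=
      hD.continuousAt.eventually_mem (j.isOpenEmbedding.isOpen_range.mem_nhds ⟨p, hp⟩)
    filter_upwards [hft, hr, hne] with z hz hzr hz0
    rw [hz]
    conv_lhs => rw [← j.apply_coords hzr]
    rw [← Prod.mk.eta (p := j.coords (C (logNear z₀ z))), j.transport_apply,
      exp_logNear hz₀ hz0]
  · right
    refine ⟨_, hD, ?_⟩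
    have hn : ∀ᶠ z in 𝓝 z₀, C (logNear z₀ z) ∈
        (j '' ((Set.univ : Set Circle) ×ˢ Set.Icc (0 : ℝ) 1))ᶜ :=
      hD.continuousAt.eventually_mem (j.isClosed_annulus.isOpen_compl.mem_nhds
        fun h => hx (Set.image_subset_range _ _ h))
    filter_upwards [hft, hn, hne] with z hz hzn hz0
    have hzc : C (logNear z₀ z) ∈ j.cycleᶜ := fun h => hzn (by
      obtain ⟨p, hp, hpz⟩ := h
      refine ⟨p, ⟨trivial, ?_⟩, hpz⟩
      rw [show p.2 = 1 / 2 from hp]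
      norm_num)
    refine ⟨hzc, ?_⟩
    rw [hz, j.transport_of_mem _ hzc]
    congr 1
    exact Prod.ext (exp_logNear hz₀ hz0) (Subtype.ext (j.shear_of_notMem _ hzn))

/-- The continuous filling is constant for real part at most `-2` and is the transport of `s` for
real part at least `-1`. So smoothing over `[-2, -1]` yields a smooth equivariant map. -/
theorem exists_smooth_section_of_const [T2Space S] [IsManifold (𝓡 2) ∞ S]
    {s : j.ContSection (Metric.sphere 0 1)} (hsm : s.IsSmooth)
    {hs : s ⟨1, by simp⟩ = j.fiberIncl j.base} {v : ℝ} (hv : v = 0 ∨ v = 1)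
    (h : TwistedHomotopic j.invTwist (j.fiberLoop s hs) (.const _ (j (1, v)))) :
    ∃ σ : j.ContSection (Metric.closedBall 0 1), σ.Extends s ∧ σ.IsSmooth := by
  obtain ⟨C, hC, hCτ, hCs, hCv⟩ := j.exists_lift_const hv h
  obtain ⟨C', hC', hC'τ, hC'C, hC'K, hC's⟩ := exists_equivariant_smooth
    (F := EuclideanSpace ℝ (Fin 2)) (τ := j.dehnTwist.symm) (j.contMDiff_twist (-1))
    (j.contMDiff_twist 1) hC hCτ (-2) (-1)
  have hsmooth : ContMDiff 𝓘(ℝ, ℂ) (𝓡 2) ∞ C' := by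
    intro w
    rcases lt_or_ge w.re (-2) with h1 | h1
    · refine hC's w ((contMDiffAt_const (c := j (1, v))).congr_of_eventuallyEq ?_)
      filter_upwards [(isOpen_Iio.preimage Complex.continuous_re).mem_nhds h1] with z hz
      exact hCv z (le_of_lt hz)
    · rcases le_or_gt w.re (-1) with h2 | h2
      · exact hC'K w ⟨h1, h2⟩
      · have h3 : ContMDiffAt 𝓘(ℝ, ℂ) (𝓡 2) ∞ (fun w : ℂ => j.circleLift s w.im) w :=
          ContMDiffAt.comp w (j.contMDiff_circleLift hsm).contMDiffAt
            Complex.imCLM.contDiff.contMDiff.contMDiffAt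
        refine hC's w (h3.congr_of_eventuallyEq ?_)
        filter_upwards [(isOpen_Ioi.preimage Complex.continuous_re).mem_nhds h2] with z hz
        exact hCs z (le_of_lt hz)
  -- The smoothing acts only on real parts in `(-3, 0)`: the boundary values at real part `0` are
  -- kept, and the section stays horizontal near the origin.
  have hC'v : ∀ w : ℂ, w.re ≤ -3 → C' w = j (1, v) := fun w hw => by
    rw [hC'C w fun h => by have := h.1; linarith]
    exact hCv w (by linarith)
  obtain ⟨f, hf, hp, hf0, hfC⟩ := j.exists_section_of_lift_const hC' hC'τ hv hC'v
  refine ⟨.ofGlobal hf hp _, j.extends_ofGlobal (C := C') (fun w hw => ?_) hf hp hfC, fun z => ?_⟩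
  · rw [hC'C w fun h => by have := h.2; rw [hw] at this; norm_num at this]
    exact hCs w (by rw [hw]; norm_num)
  · by_cases hz : (z : ℂ) = 0
    · refine .inr ⟨fun _ => j (1, v), contMDiffWithinAt_const, ?_⟩
      have hlt : ‖(z : ℂ)‖ < Real.exp (-3) := by rw [hz, norm_zero]; exact Real.exp_pos _
      have ho : IsOpen {w : Metric.closedBall (0 : ℂ) 1 | ‖(w : ℂ)‖ < Real.exp (-3)} :=
        isOpen_lt (by fun_prop) continuous_const
      filter_upwards [ho.mem_nhds hlt] with w hw
      refine ⟨j.apply_sides_mem_compl hv, ?_⟩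
      change f w = _
      by_cases hw0 : (w : ℂ) = 0
      · rw [hw0, hf0]
      · have hre : (Complex.log w).re ≤ -3 := by
          rw [Complex.log_re]
          exact ((Real.log_lt_iff_lt_exp (norm_pos_iff.2 hw0)).2 hw).le
        have := hfC (Complex.log w)
        rwa [Complex.exp_log hw0, hC'v _ hre, j.transport_sides hv, Complex.exp_log hw0] at this
    · have hev : ∀ {P : ℂ → Prop}, (∀ᶠ w in 𝓝 (z : ℂ), P w) →
          ∀ᶠ w : Metric.closedBall (0 : ℂ) 1 in 𝓝 z, P w := fun h =>
        continuous_subtype_val.continuousAt.eventually h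
      rcases j.isSmooth_of_lift hsmooth hfC hz with ⟨F, hF, hFe⟩ | ⟨g, hg, hge⟩
      · exact .inl ⟨F, hF.contDiffWithinAt, hev hFe⟩
      · exact .inr ⟨g, hg.contMDiffWithinAt, hev hge⟩

/-- A smooth section does not pass through the critical point. -/
theorem ContSection.IsSmooth.ne_crit {σ : j.ContSection (Metric.closedBall 0 1)}
    (hσ : σ.IsSmooth) : σ ⟨0, by simp⟩ ≠ j.crit := by
  intro h0
  rcases hσ ⟨0, by simp⟩ with ⟨f, hf, hfe⟩ | ⟨g, -, hge⟩
  · have hball : Metric.closedBall (0 : ℂ) 1 ∈ 𝓝 (0 : ℂ) := Metric.closedBall_mem_nhds 0 one_pos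
    have hf0 : f 0 = (0, 0) := by
      have := hfe.self_of_nhds
      rw [h0] at this
      exact (j.inModel_injective this).symm
    have hd : DifferentiableAt ℝ f 0 := (hf.contDiffAt hball).differentiableAt (by simp)
    -- By the chain rule `q ∘ f` has zero derivative at `0`, yet `q ∘ f` is the identity near `0`
    -- because `f` represents a section.
    have hq : HasFDerivAt (𝕜 := ℝ) q 0 ((0, 0) : ℂ × ℂ) := by
      have h1 : HasFDerivAt (𝕜 := ℝ) (fun x : ℂ × ℂ => x.1 ^ 2 + x.2 ^ 2) _ ((0, 0) : ℂ × ℂ) :=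
        (hasFDerivAt_fst.pow 2).add (hasFDerivAt_snd.pow 2)
      refine h1.congr_fderiv ?_
      ext <;> simp
    have hcomp : HasFDerivAt (𝕜 := ℝ) (q ∘ f) (0 : ℂ →L[ℝ] ℂ) 0 := by
      have := HasFDerivAt.comp (0 : ℂ) (by rw [hf0]; exact hq) hd.hasFDerivAt
      simpa using this
    have hid : q ∘ f =ᶠ[𝓝 0] id := by
      have h1 : ∀ᶠ w in 𝓝[Metric.closedBall (0 : ℂ) 1] 0, q (f w) = w := by
        rw [nhdsWithin_eq_map_subtype_coe (by simp), Filter.eventually_map]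
        filter_upwards [hfe] with w hw
        rw [← j.proj_inModel, ← hw, σ.proj_toFun]
      rw [nhdsWithin_eq_nhds.2 hball] at h1
      exact h1
    have huniq := (hcomp.congr_of_eventuallyEq hid.symm).unique (hasFDerivAt_id (0 : ℂ))
    have := congrArg (fun L : ℂ →L[ℝ] ℂ => L 1) huniq
    simp at this
  · obtain ⟨hw, h⟩ := hge.self_of_nhds
    exact j.inTrivial_ne_crit _ (h.symm.trans h0)

end AnnularCurve

end

/-! ### The extension theorem -/

theorem mainTheorem3 {S : Type*} [TopologicalSpace S] [T2Space S] [CompactSpace S]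
    [ConnectedSpace S] [ChartedSpace (EuclideanSpace ℝ (Fin 2)) S] [IsManifold (𝓡 2) ∞ S]
    (V : AnnularCurve S) (hV : V.IsEssential)
    (α : FundamentalGroup S V.base) (s : V.ContSection (Metric.sphere 0 1))
    (hs : V.Represents s α) :
    ((∃ σ : V.ContSection (Metric.closedBall 0 1),
        σ.Extends s ∧ σ ⟨0, by simp⟩ = V.crit) ↔
      ∃ m : ℤ, V.IsTwistedConj m α) ∧
    ((∃ σ : V.ContSection (Metric.closedBall 0 1),
        σ.Extends s ∧ ∀ z, σ z ≠ V.crit) ↔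
      ∃ m : ℤ, (m = 0 ∨ m = 1) ∧ V.IsTwistedConj m α) ∧
    (s.IsSmooth →
      ((∃ σ : V.ContSection (Metric.closedBall 0 1), σ.Extends s ∧ σ.IsSmooth) ↔
        ∃ m : ℤ, (m = 0 ∨ m = 1) ∧ V.IsTwistedConj m α)) := by
  obtain ⟨hs1, rfl⟩ := hs.eq_loopClass
  -- Exponents `0` and `1` become homotopies to a constant path on a side of the curve, the form
  -- used for sections that avoid the critical point.
  rw [V.exists_isTwistedConj_iff]
  refine ⟨⟨?_, ?_⟩, ⟨?_, ?_⟩, fun hsm => ⟨?_, ?_⟩⟩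
  · rintro ⟨σ, hσ, h0⟩
    obtain ⟨m, hm⟩ := V.exists_winding_of_section hs1 hσ h0
    exact ⟨m, (V.isTwistedConj_loopClass_iff m _).2 hm⟩
  · rintro ⟨m, hm⟩
    exact V.exists_section_of_winding ((V.isTwistedConj_loopClass_iff m _).1 hm)
  · rintro ⟨σ, hσ, h0⟩
    exact V.exists_const_of_section hs1 hσ (h0 _)
  · rintro ⟨v, hv, h⟩
    exact V.exists_section_of_const hv h
  · rintro ⟨σ, hσ, h0⟩
    exact V.exists_const_of_section hs1 hσ (AnnularCurve.ContSection.IsSmooth.ne_crit V h0)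
  · rintro ⟨v, hv, h⟩
    exact V.exists_smooth_section_of_const hsm hv h
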